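/- **Conventions.** Algorithms are randomized programs with assignments, conditionals, while-loops and fair coin tosses over binary trees (a programming-language model polynomially equivalent to Turing machines), possibly with an oracle. Each elementary operation, coin toss and oracle call takes one step. All logarithms are to base $2$. An algorithm *runs in time $O(t(n))$* if there is a $T(n)=O(t(n))$, as $n\to\infty$, such that on every input with parameter $n$ it halts after at most $T(n)$ steps with probability $1$. *Linear-3-RL.* A deterministic MDP has a state space with an end state $\bot$, a starting state $s_0$, three actions, transitions $P(s,a)$, reward distributions $R(s,a)$ on $[0,1]$, and a horizon $H$ such that every deterministic stationary policy, from every state, reaches $\bot$ after at most $H$ actions. $V^\pi(s)$ is the expected total reward collected by the policy $\pi$ from $s$ until $\bot$ is reached, $Q^\pi(s,a)$ is the same when the first action is $a$, and $V^*=\sup_\pi V^\pi$, $Q^*=\sup_\pi Q^\pi$. Fix constants $C>0$ and $b\ge 1$. An instance with feature dimension $d$ consists of such an MDP with $H\le C d$ and of features $\psi(s),\psi(s,a)\in\mathbb{Q}^d$ for which some $\theta\in\mathbb{R}^d$ satisfies $V^*(s)=\langle\theta,\psi(s)\rangle$ and $Q^*(s,a)=\langle\theta,\psi(s,a)\rangle$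 for all states $s\ne\bot$ and actions $a$; states are named by bit strings, rewards are rational, and names of states, rewards and feature coordinates have at most $d^b$ bits. The algorithm receives $d$, $H$ and $s_0$, and by oracle calls obtains independent samples from $R(s,a)$, the state $P(s,a)$, and the features $\psi(s)$, $\psi(s,a)$. It has to output the sequence of actions that a policy $\pi$ with $V^\pi(s_0)>V^*(s_0)-1/4$ takes from $s_0$ to $\bot$ (further entries are ignored). It *solves the problem with error $\varepsilon$* if on every instance it does so with probability at least $1-\varepsilon$. *Unique-3-SAT.* Fix a constant $c\in\mathbb{N}$. The input is a 3-CNF formula with $v$ variables and at most $cv$ clauses. An algorithm *solves the problem with error $\varepsilon$* if it answers YES with probability at least $1-\varepsilon$ on formulas with exactly one satisfying assignment, and NO with probability $1$ on unsatisfiable formulas. (The time bound is required on all formulas.) **Proposition.** Let $C>0$, $b\ge 1$ and $c$ be constants. If Linear-3-RL with feature dimension $d$ can be solved in time $O\big(d^{\log d/(32\log\log d)}\big)$ with error $1/10$, then Unique-3-SAT with $v$ variables can be solved in time $2^{O(v/\log v)}$ with error $1/8$. -/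

import Mathlib

open Filter Asymptotics

namespace LinearRL

/-! ### Data: binary trees -/

/-- The values manipulated by programs: unlabelled binary trees (S-expressions over one atom). -/
inductive Data : Type
  | nil : Data
  | cons : Data → Data → Data

namespace Data

/-- Left component (`nil` for the atom). -/
def hd : Data → Data
  | nil => nil
  | cons a _ => a

/-- Right component (`nil` for the atom). -/
def tl : Data → Data
  | nil => nil
  | cons _ b => b

/-- The list `[x₁, …, xₙ]` as the tree `(x₁ . (x₂ . … (xₙ . nil)))`. -/
def ofList : List Data → Data
  | [] => nil
  | x :: xs => cons x (ofList xs)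

/-- A bit: `false` is the atom, `true` is `(nil . nil)`. -/
def ofBool : Bool → Data
  | false => nil
  | true => cons nil nil

/-- A bit string. -/
def ofBits (l : List Bool) : Data := ofList (l.map ofBool)

/-- A natural number in unary. -/
def unary (n : ℕ) : Data := ofList (List.replicate n nil)

/-- A natural number in binary, least significant bit first. -/
def ofNat (n : ℕ) : Data := ofBits n.bits

/-- A rational number in lowest terms: sign, absolute value of the numerator, denominator. -/
def ofRat (q : ℚ) : Data :=
  cons (ofBool (decide (q < 0))) (cons (ofNat q.num.natAbs) (ofNat q.den))

/-- A vector of rational numbers, as the list of its coordinates. -/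
def ofVec {d : ℕ} (x : Fin d → ℚ) : Data := ofList (List.ofFn fun i => ofRat (x i))

theorem ofList_injective : Function.Injective ofList := by
  intro l₁
  induction l₁ with
  | nil => intro l₂ h; cases l₂ with
    | nil => rfl
    | cons y ys => simp [ofList] at h
  | cons x xs ih => intro l₂ h; cases l₂ with
    | nil => simp [ofList] at h
    | cons y ys =>
      simp only [ofList, cons.injEq] at h
      rw [h.1, ih h.2]

theorem ofBool_injective : Function.Injective ofBool := by
  intro a b h
  cases a <;> cases b <;> simp_all [ofBool]

theorem ofBits_injective : Function.Injective ofBits :=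
  ofList_injective.comp (List.map_injective_iff.mpr ofBool_injective)

theorem unary_injective : Function.Injective unary :=
  ofList_injective.comp (List.replicate_left_injective nil)

end Data

/-! ### Randomized oracle programs and their running time -/

/-- Expressions over the program variables `0, 1, 2, …`. -/
inductive Expr : Type
  | var : ℕ → Expr
  | nil : Expr
  | cons : Expr → Expr → Expr
  | hd : Expr → Expr
  | tl : Expr → Expr

/-- The contents of the variables. -/
abbrev Store := ℕ → Data

/-- Value of an expression. -/
def Expr.eval (σ : Store) : Expr → Data
  | .var n => σ n
  | .nil => .nil
  | .cons a b => .cons (a.eval σ) (b.eval σ)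
  | .hd a => (a.eval σ).hd
  | .tl a => (a.eval σ).tl

/-- Randomized WHILE programs over binary trees with access to an oracle. Tests ask whether an
expression evaluates to something other than `nil`. -/
inductive Program : Type
  | skip : Program
  /-- `x := e` -/
  | assign (x : ℕ) (e : Expr) : Program
  /-- `x :=` a fair random bit -/
  | flip (x : ℕ) : Program
  /-- `x :=` the oracle's answer to the query `e` -/
  | query (x : ℕ) (e : Expr) : Program
  | seq (p q : Program) : Program
  | ite (e : Expr) (p q : Program) : Program
  | loop (e : Expr) (p : Program) : Program

/-- A (possibly randomized) oracle; the answers to different calls are independent samples. -/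
abbrev Oracle := Data → PMF Data

/-- The oracle that carries no information. -/
noncomputable def noOracle : Oracle := fun _ => PMF.pure .nil

/-- A configuration: the stack of program pieces still to be executed, and the store. -/
structure Config : Type where
  code : List Program
  store : Store

open Classical in
/-- One step of computation. Evaluating one of the finitely many expressions of the program, a
coin toss and an oracle call each take a single step. A halted configuration does not change. -/
noncomputable def step (O : Oracle) : Config → PMF Config
  | ⟨[], σ⟩ => PMF.pure ⟨[], σ⟩
  | ⟨.skip :: k, σ⟩ => PMF.pure ⟨k, σ⟩
  | ⟨.assign x e :: k, σ⟩ => PMF.pure ⟨k, Function.update σ x (e.eval σ)⟩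
  | ⟨.flip x :: k, σ⟩ =>
      (PMF.uniformOfFintype Bool).map fun b => ⟨k, Function.update σ x (Data.ofBool b)⟩
  | ⟨.query x e :: k, σ⟩ => (O (e.eval σ)).map fun y => ⟨k, Function.update σ x y⟩
  | ⟨.seq p q :: k, σ⟩ => PMF.pure ⟨p :: q :: k, σ⟩
  | ⟨.ite e p q :: k, σ⟩ =>
      if e.eval σ = .nil then PMF.pure ⟨q :: k, σ⟩ else PMF.pure ⟨p :: k, σ⟩
  | ⟨.loop e p :: k, σ⟩ =>
      if e.eval σ = .nil then PMF.pure ⟨k, σ⟩ else PMF.pure ⟨p :: .loop e p :: k, σ⟩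

/-- The distribution of the configuration after `n` steps. -/
noncomputable def run (O : Oracle) : ℕ → Config → PMF Config
  | 0, c => PMF.pure c
  | n + 1, c => (step O c).bind (run O n)

/-- Start of `A` on input `x`: the input is in variable `0`, all other variables are `nil`. -/
def start (A : Program) (x : Data) : Config := ⟨[A], fun n => if n = 0 then x else .nil⟩

/-- With probability one, `A` with oracle `O` halts on input `x` after at most `T` steps. -/
def HaltsWithin (O : Oracle) (A : Program) (x : Data) (T : ℕ) : Prop :=
  ∀ c ∈ (run O T (start A x)).support, c.code = []

/-- The probability that `A` with oracle `O` halts on input `x` after at most `T` steps with an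
output (the final value of variable `0`) in `S`. -/
noncomputable def outputProb (O : Oracle) (A : Program) (x : Data) (T : ℕ) (S : Set Data) : ℝ :=
  ((run O T (start A x)).toOuterMeasure {c | c.code = [] ∧ c.store 0 ∈ S}).toReal

/-! ### Deterministic MDPs with linear optimal value functions -/

/-- A Markov decision process with deterministic transitions, `k` actions, stochastic rewards in
`[0,1]`, and horizon `H`. The end state `⊥` is represented by `none`, so `State` is the set of the
other states; whatever the policy and the first state, `⊥` is reached after at most `H` actions.
Policies are deterministic and stationary. -/
structure MDP (k : ℕ) : Type 1 where
  State : Type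
  start : State
  trans : State → Fin k → Option State
  reward : State → Fin k → PMF ℚ
  reward_mem : ∀ s a, ∀ x ∈ (reward s a).support, 0 ≤ x ∧ x ≤ 1
  horizon : ℕ
  ends : ∀ (π : State → Fin k) (s : State),
    (fun o : Option State => o.bind fun s' => trans s' (π s'))^[horizon] (some s) = none

/-- Expectation of a distribution on the rationals. -/
noncomputable def expect (p : PMF ℚ) : ℝ := ∑' x : ℚ, (p x).toReal * (x : ℝ)

namespace MDP

variable {k : ℕ} (M : MDP k)

/-- Deterministic stationary policies. -/
abbrev Policy := M.State → Fin k

/-- The state `S_t` of the trajectory of the policy `π` from `s`; `none` after the end. -/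
def traj (π : M.Policy) (s : M.State) (t : ℕ) : Option M.State :=
  (fun o : Option M.State => o.bind fun s' => M.trans s' (π s'))^[t] (some s)

/-- The distribution of the sum of the rewards that `π` collects in at most `n` actions, stopping
when the end state is reached. -/
noncomputable def returnDist (π : M.Policy) : ℕ → Option M.State → PMF ℚ
  | 0, _ => PMF.pure 0
  | _ + 1, none => PMF.pure 0
  | n + 1, some s =>
      (M.reward s (π s)).bind fun x => (returnDist π n (M.trans s (π s))).map fun y => x + y

/-- `V^π(s)`. -/
noncomputable def V (π : M.Policy) (s : M.State) : ℝ :=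
  expect (M.returnDist π M.horizon (some s))

/-- `Q^π(s, a)`: the first action is `a`, the later ones are those of `π`. -/
noncomputable def Q (π : M.Policy) (s : M.State) (a : Fin k) : ℝ :=
  expect ((M.reward s a).bind fun x =>
    (M.returnDist π M.horizon (M.trans s a)).map fun y => x + y)

/-- `V^*(s)`. -/
noncomputable def Vstar (s : M.State) : ℝ := ⨆ π : M.Policy, M.V π s

/-- `Q^*(s, a)`. -/
noncomputable def Qstar (s : M.State) (a : Fin k) : ℝ := ⨆ π : M.Policy, M.Q π s a

/-- The sequence of actions `as` describes the policy `π`: these are the actions that `π` takes on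
the way from the starting state to the end state (entries after that are ignored). -/
def Describes (as : List (Fin k)) (π : M.Policy) : Prop :=
  ∀ (t : ℕ) (s : M.State), M.traj π M.start t = some s → as[t]? = some (π s)

/-- Outputs that describe a good policy `π`, that is, `V^π > V^* - 1/4` at the starting state. -/
def goodOutputs : Set Data :=
  {y | ∃ (as : List (Fin k)) (π : M.Policy),
    y = Data.ofList (as.map fun a => Data.unary a) ∧ M.Describes as π ∧
      M.V π M.start > M.Vstar M.start - 1 / 4}

end MDP

/-- Number of bits of a rational number. -/
def bitSize (q : ℚ) : ℕ := q.num.natAbs.size + q.den.size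

/-- What an algorithm for linear RL has access to: an MDP, `d`-dimensional features of states and of
state-action pairs, and names of the states by bit strings. -/
structure FeaturedMDP (k d : ℕ) : Type 1 extends MDP k where
  featS : State → Fin d → ℚ
  featSA : State → Fin k → Fin d → ℚ
  code : State → List Bool
  code_injective : Function.Injective code

namespace FeaturedMDP

variable {k d : ℕ} (M : FeaturedMDP k d)

/-- `V^*` and `Q^*` are linear in the features, with the same coefficient vector. -/
def IsLinear : Prop :=
  ∃ θ : Fin d → ℝ,
    (∀ s, M.Vstar s = ∑ i, θ i * (M.featS s i : ℝ)) ∧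
    (∀ s a, M.Qstar s a = ∑ i, θ i * (M.featSA s a i : ℝ))

/-- Names of states, rewards and features (per coordinate) have at most `B` bits. -/
def SizeBound (B : ℕ) : Prop :=
  (∀ s, (M.code s).length ≤ B) ∧
  (∀ s a, ∀ x ∈ (M.reward s a).support, bitSize x ≤ B) ∧
  (∀ s i, bitSize (M.featS s i) ≤ B) ∧
  (∀ s a i, bitSize (M.featSA s a i) ≤ B)

/-- The tree naming a state. -/
def stateData (s : M.State) : Data := Data.ofBits (M.code s)

/-- The calls an algorithm can make. -/
inductive Call : Type
  | reward (s : M.State) (a : Fin k) : Call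
  | trans (s : M.State) (a : Fin k) : Call
  | featS (s : M.State) : Call
  | featSA (s : M.State) (a : Fin k) : Call

/-- A call as a tree. -/
def Call.toData : M.Call → Data
  | .reward s a => .cons (.unary 0) (.cons (M.stateData s) (.unary a))
  | .trans s a => .cons (.unary 1) (.cons (M.stateData s) (.unary a))
  | .featS s => .cons (.unary 2) (M.stateData s)
  | .featSA s a => .cons (.unary 3) (.cons (M.stateData s) (.unary a))

/-- The answer to a call: a fresh sample of `R(s,a)`, the next state `P(s,a)` (`nil` stands for the
end state, `(nil . s')` for the state `s'`), or a feature vector. -/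
noncomputable def Call.answer : M.Call → PMF Data
  | .reward s a => (M.reward s a).map Data.ofRat
  | .trans s a => PMF.pure <| match M.trans s a with
      | none => .nil
      | some s' => .cons .nil (M.stateData s')
  | .featS s => PMF.pure (Data.ofVec (M.featS s))
  | .featSA s a => PMF.pure (Data.ofVec (M.featSA s a))

theorem stateData_injective : Function.Injective M.stateData :=
  Data.ofBits_injective.comp M.code_injective

/-- A tree is the name of at most one call. -/
theorem Call.toData_injective : Function.Injective (Call.toData M) := by
  have hs := M.stateData_injective
  have hu : ∀ a b : Fin k, Data.unary a = Data.unary b → a = b := fun a b h =>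
    Fin.ext (Data.unary_injective h)
  have ht : ∀ m n : ℕ, Data.unary m = Data.unary n → m = n := fun m n h =>
    Data.unary_injective h
  intro x y h
  cases x <;> cases y <;> simp only [Call.toData, Data.cons.injEq] at h <;>
    first
    | exact absurd (ht _ _ h.1) (by decide)
    | rw [hs h.2.1, hu _ _ h.2.2]
    | rw [hs h.2]

open Classical in
/-- Access to `M` as an oracle; a query that is not a call is answered by `nil`. -/
noncomputable def oracle : Oracle := fun q =>
  if h : ∃ c : M.Call, c.toData = q then h.choose.answer else PMF.pure .nil

/-- The input of an algorithm: the feature dimension, the horizon and the starting state. -/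
def input : Data := .cons (.unary d) (.cons (.unary M.horizon) (M.stateData M.start))

end FeaturedMDP

/-- Linear-`k`-RL, for MDPs with horizon at most `C * d` whose names of states, rewards and feature
coordinates have at most `d ^ b` bits, can be solved by a randomized algorithm in time `O(t d)`,
`d` the feature dimension, with error probability `ε`. -/
def LinearRLSolvable (k : ℕ) (C : ℝ) (b : ℕ) (t : ℕ → ℝ) (ε : ℝ) : Prop :=
  ∃ (A : Program) (T : ℕ → ℕ), (fun d => (T d : ℝ)) =O[atTop] t ∧
    ∀ (d : ℕ) (M : FeaturedMDP k d),
      (M.horizon : ℝ) ≤ C * d → M.SizeBound (d ^ b) → M.IsLinear →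
        HaltsWithin M.oracle A M.input (T d) ∧
        1 - ε ≤ outputProb M.oracle A M.input (T d) M.goodOutputs

/-! ### Unique-3-SAT -/

/-- A literal over `v` variables: a variable and the truth value that makes the literal true. -/
abbrev Literal (v : ℕ) := Fin v × Bool

/-- A clause with three literals (repetitions are allowed). -/
abbrev Clause (v : ℕ) := Fin 3 → Literal v

/-- A 3-CNF formula over `v` variables, as the list of its clauses. -/
abbrev Formula (v : ℕ) := List (Clause v)

/-- The assignment `w` satisfies the formula. -/
def Satisfies {v : ℕ} (w : Fin v → Bool) (φ : Formula v) : Prop :=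
  ∀ c ∈ φ, ∃ i, w (c i).1 = (c i).2

/-- A literal as a tree. -/
def literalData {v : ℕ} (l : Literal v) : Data := .cons (.ofBool l.2) (.unary l.1)

/-- A formula as a tree: the number of variables and the list of the clauses. -/
def formulaData {v : ℕ} (φ : Formula v) : Data :=
  .cons (.unary v)
    (Data.ofList (φ.map fun c => Data.ofList (List.ofFn fun i => literalData (c i))))

/-- Unique-3-SAT, for formulas with `v` variables and at most `c * v` clauses, can be solved by a
randomized algorithm in time `O(t v)` with error probability `ε`. Output `nil` means NO, every other
output YES. -/
def Unique3SATSolvable (c : ℕ) (t : ℕ → ℝ) (ε : ℝ) : Prop :=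
  ∃ (A : Program) (T : ℕ → ℕ), (fun v => (T v : ℝ)) =O[atTop] t ∧
    ∀ (v : ℕ) (φ : Formula v), φ.length ≤ c * v →
      HaltsWithin noOracle A (formulaData φ) (T v) ∧
      ((∃! w, Satisfies w φ) →
        1 - ε ≤ outputProb noOracle A (formulaData φ) (T v) {y | y ≠ .nil}) ∧
      ((¬ ∃ w, Satisfies w φ) →
        outputProb noOracle A (formulaData φ) (T v) {.nil} = 1)

end LinearRL

open scoped ENNReal

namespace LinearRL

/-! ### Runs of deterministic steps, and halting probabilities -/

/-! A satisfiable formula is turned into a game with a hidden goal. A state is a counter `l < 2 ^ m`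
together with an assignment `w`; an action picks a literal of the first clause violated by `w` and
flips its variable. The only reward comes at the end: a Bernoulli variable with mean `((2 ^ m + v -
l - dist(w, w₀)) / (2 ^ m + v)) ^ r`, where `w₀` satisfies the formula. Some literal of a violated
clause is true under `w₀`. Flipping it brings `w` one step closer to `w₀` while the counter grows by
one, so this expression can be kept constant; no action increases it (`exists_value_next_eq`,
`value_next_le`). Hence it is `V^*`. Its base is affine in the bits of `l` and `w`, so its `r`-th
power is linear in the `r`-th tensor power of `(1, bits)`. Only the coefficient vector involves
`w₀`, not the features (`Game.isLinear`).

The whole oracle can therefore be simulated without `w₀`, except for the final reward. If a query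
names a satisfying assignment, the simulation stops with YES. Otherwise a final reward occurs only
when the counter is exhausted; its mean is then at most `p = ((1 + v) / 2 ^ m) ^ r`, and it is
replaced by zero. An algorithm making `T` steps notices this with probability at most `T * p`
(`tsum_oracle_le`, `Potential.of_oracle`). A good action sequence must run through a satisfying
assignment, since every other one earns at most `p` while `V^*` is close to 1 at the start
(`walk_of_good`). The output is checked by following it, so NO is certain on unsatisfiable formulas.

Parameters: with `M` about `(log v) / 3`, take `r = 2 ^ M`, `m = 4 M r` and dimension `d = 2 ^ (m +
c₀)`. Then `(1 + m + v) ^ r ≤ 2 ^ m ≤ d`, the assumed time bound is at most a constant times `2 ^ (M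
r ^ 2)` (`rpow_dim_le`), `p` is about `2 ^ (-4 M r ^ 2)` (`error_bound`), and `(log d) ^ 2 = O(v /
log v)` (`logDim_sq_le`).

The rest is programming. A small functional language with a verified compiler (`reach_compile`) and
a polynomial cost bound (`cost_le`) supplies the subroutines. A clocked interpreter runs the given
algorithm. Its success probability is bounded below by any quantity that does not decrease along
steps (`Potential.le_Pr`). -/

theorem run_add (O : Oracle) (n m : ℕ) (c : Config) :
    run O (n + m) c = (run O n c).bind (run O m) := by
  induction n generalizing c with
  | zero => simp [run]
  | succ n ih => simp only [Nat.succ_add, run, PMF.bind_bind, funext ih]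

/-- From `c` the program surely reaches `c'` after some number of steps, at most `t`. -/
def Reach (O : Oracle) (c c' : Config) (t : ℕ) : Prop :=
  ∃ n ≤ t, run O n c = PMF.pure c'

theorem Reach.refl (O : Oracle) (c : Config) (t : ℕ) : Reach O c c t := ⟨0, Nat.zero_le _, rfl⟩

theorem Reach.trans {O : Oracle} {c c' c'' : Config} {s t : ℕ} (h : Reach O c c' s)
    (h' : Reach O c' c'' t) : Reach O c c'' (s + t) := by
  obtain ⟨n, hn, h⟩ := h
  obtain ⟨m, hm, h'⟩ := h'
  exact ⟨n + m, by omega, by rw [run_add, h, PMF.pure_bind, h']⟩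

theorem Reach.mono {O : Oracle} {c c' : Config} {s t : ℕ} (h : Reach O c c' s) (hst : s ≤ t) :
    Reach O c c' t := by
  obtain ⟨n, hn, h⟩ := h
  exact ⟨n, hn.trans hst, h⟩

theorem Reach.head {O : Oracle} {c c' c'' : Config} {s t : ℕ} (hc : step O c = PMF.pure c')
    (h : Reach O c' c'' s) (hst : s + 1 ≤ t) : Reach O c c'' t := by
  obtain ⟨n, hn, h⟩ := h
  exact ⟨n + 1, by omega, by rw [run, hc, PMF.pure_bind, h]⟩

section Steps

variable (O : Oracle) (k : List Program) (σ : Store)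

theorem step_skip : step O ⟨.skip :: k, σ⟩ = PMF.pure ⟨k, σ⟩ := by simp [step]

theorem step_assign (x : ℕ) (e : Expr) :
    step O ⟨.assign x e :: k, σ⟩ = PMF.pure ⟨k, Function.update σ x (e.eval σ)⟩ := by simp [step]

theorem step_seq (p q : Program) : step O ⟨.seq p q :: k, σ⟩ = PMF.pure ⟨p :: q :: k, σ⟩ := by
  simp [step]

theorem step_ite_nil {e : Expr} (p q : Program) (h : e.eval σ = .nil) :
    step O ⟨.ite e p q :: k, σ⟩ = PMF.pure ⟨q :: k, σ⟩ := by simp [step, h]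

theorem step_ite_ne {e : Expr} (p q : Program) (h : e.eval σ ≠ .nil) :
    step O ⟨.ite e p q :: k, σ⟩ = PMF.pure ⟨p :: k, σ⟩ := by simp [step, h]

theorem step_loop_nil {e : Expr} (p : Program) (h : e.eval σ = .nil) :
    step O ⟨.loop e p :: k, σ⟩ = PMF.pure ⟨k, σ⟩ := by simp [step, h]

theorem step_loop_ne {e : Expr} (p : Program) (h : e.eval σ ≠ .nil) :
    step O ⟨.loop e p :: k, σ⟩ = PMF.pure ⟨p :: .loop e p :: k, σ⟩ := by simp [step, h]

end Steps

/-- The probability to halt within `n` steps with an output in `S`. -/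
noncomputable def Pr (O : Oracle) (n : ℕ) (c : Config) (S : Set Data) : ℝ≥0∞ :=
  (run O n c).toOuterMeasure {c | c.code = [] ∧ c.store 0 ∈ S}

theorem Pr_succ (O : Oracle) (n : ℕ) (c : Config) (S : Set Data) :
    Pr O (n + 1) c S = ∑' c', step O c c' * Pr O n c' S := by
  simp [Pr, run, PMF.toOuterMeasure_bind_apply]

open Classical in
theorem Pr_zero (O : Oracle) (c : Config) (S : Set Data) :
    Pr O 0 c S = if c.code = [] ∧ c.store 0 ∈ S then 1 else 0 := by
  simp [Pr, run]

theorem Pr_le_one (O : Oracle) (n : ℕ) (c : Config) (S : Set Data) : Pr O n c S ≤ 1 := by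
  refine (MeasureTheory.measure_mono (Set.subset_univ _)).trans ?_
  rw [(PMF.toOuterMeasure_apply_eq_one_iff _ _).2 (Set.subset_univ _)]

theorem Pr_succ_of_step {O : Oracle} {c c' : Config} (h : step O c = PMF.pure c') (n : ℕ)
    (S : Set Data) : Pr O (n + 1) c S = Pr O n c' S := by
  simp [Pr, run, h]

theorem Pr_succ_of_step_map {α : Type*} {O : Oracle} {c : Config} {μ : PMF α} {g : α → Config}
    (h : step O c = μ.map g) (n : ℕ) (S : Set Data) :
    Pr O (n + 1) c S = ∑' a, μ a * Pr O n (g a) S := by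
  have : run O (n + 1) c = μ.bind fun a => run O n (g a) := by
    rw [run, h, PMF.bind_map]; rfl
  simp [Pr, this, PMF.toOuterMeasure_bind_apply]

open Classical in
theorem Pr_halted (O : Oracle) (n : ℕ) (σ : Store) (S : Set Data) :
    Pr O n ⟨[], σ⟩ S = if σ 0 ∈ S then 1 else 0 := by
  induction n with
  | zero => simp [Pr_zero]
  | succ n ih => rw [Pr_succ_of_step (c' := ⟨[], σ⟩) (by simp [step]), ih]

theorem Pr_mono_succ (O : Oracle) (n : ℕ) (c : Config) (S : Set Data) :
    Pr O n c S ≤ Pr O (n + 1) c S := by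
  classical
  induction n generalizing c with
  | zero =>
    rw [Pr_zero]
    split_ifs with h
    · obtain ⟨k, σ⟩ := c
      obtain ⟨rfl, h⟩ := h
      simp [Pr_halted, h]
    · exact zero_le
  | succ n ih =>
    rw [Pr_succ, Pr_succ O (n + 1)]
    exact ENNReal.tsum_le_tsum fun c' => by gcongr; exact ih c'

theorem Pr_mono (O : Oracle) {n m : ℕ} (h : n ≤ m) (c : Config) (S : Set Data) :
    Pr O n c S ≤ Pr O m c S :=
  monotone_nat_of_le_succ (f := fun n => Pr O n c S) (fun n => Pr_mono_succ O n c S) h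

/-- Halting probabilities are monotone in time, so upper bounds on step counts can replace exact
counts everywhere. -/
theorem Reach.le_Pr {O : Oracle} {c c' : Config} {t : ℕ} (h : Reach O c c' t) {m N : ℕ}
    (hN : m + t ≤ N) (S : Set Data) : Pr O m c' S ≤ Pr O N c S := by
  obtain ⟨n, hn, h⟩ := h
  calc Pr O m c' S = Pr O (n + m) c S := by simp [Pr, run_add, h]
    _ ≤ Pr O N c S := Pr_mono O (by omega) c S

/-- Halting becomes a lower bound for a probability, so the same inequality serves for halting, for
certain NO and for likely YES. -/
theorem haltsWithin_of_Pr {O : Oracle} {A : Program} {x : Data} {T : ℕ}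
    (h : 1 ≤ Pr O T (LinearRL.start A x) Set.univ) : HaltsWithin O A x T := by
  have := (PMF.toOuterMeasure_apply_eq_one_iff _ _).1 (le_antisymm (Pr_le_one _ _ _ _) h)
  exact fun c hc => (this hc).1

theorem outputProb_eq (O : Oracle) (A : Program) (x : Data) (T : ℕ) (S : Set Data) :
    outputProb O A x T S = (Pr O T (LinearRL.start A x) S).toReal := rfl

/-! ### Substitution in expressions -/

/-- Replace the variable `n` by the expression `f n`. -/
def Expr.subst (f : ℕ → Expr) : Expr → Expr
  | .var n => f n
  | .nil => .nil
  | .cons a b => .cons (a.subst f) (b.subst f)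
  | .hd a => .hd (a.subst f)
  | .tl a => .tl (a.subst f)

theorem Expr.eval_subst (f : ℕ → Expr) (σ : Store) (e : Expr) :
    (e.subst f).eval σ = e.eval fun n => (f n).eval σ := by
  induction e <;> simp_all [Expr.subst, Expr.eval]

/-- The value of an expression in which all variables have the value `x`. -/
def Expr.ev (e : Expr) (x : Data) : Data := e.eval fun _ => x

/-! ### A functional language -/

/-- Left fold over the right spine of a tree. -/
def Data.fold (g : Data → Data → Data) : Data → Data → Data
  | .nil, acc => acc
  | .cons x xs, acc => Data.fold g xs (g x acc)

/-- Cost of a fold whose body costs `w`. -/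
def Data.foldCost (g : Data → Data → Data) (w : Data → Data → ℕ) : Data → Data → ℕ
  | .nil, _ => 1
  | .cons x xs, acc => w x acc + 8 + Data.foldCost g w xs (g x acc)

/-- The body of a fold satisfies `P` in each iteration. -/
def Data.FoldAll (g : Data → Data → Data) (P : Data → Data → Prop) : Data → Data → Prop
  | .nil, _ => True
  | .cons x xs, acc => P x acc ∧ Data.FoldAll g P xs (g x acc)

/-- Length of the right spine. -/
def Data.len : Data → ℕ
  | .nil => 0
  | .cons _ xs => xs.len + 1

/-- Functions from trees to trees, presented by terms. The argument of a function is an environment,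
the list of the values of its variables. -/
inductive Fn : Type
  | ex (e : Expr)
  | comp (f g : Fn)
  | lt (f g : Fn)
  | ite (c f g : Fn)
  | fold (l a g : Fn)

namespace Fn

/-- The function denoted by a term: `comp f g` is `g ∘ f`, `lt f g` evaluates `g` in the environment
extended by the value of `f`, and `fold l a g` folds over the list `l`, starting with `a`, with
step `g` in the environment extended by the element and the accumulator. -/
def eval : Fn → Data → Data
  | ex e, x => e.ev x
  | comp f g, x => g.eval (f.eval x)
  | lt f g, x => g.eval (.cons (f.eval x) x)
  | ite c f g, x => match c.eval x with
    | .nil => g.eval x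
    | .cons _ _ => f.eval x
  | fold l a g, x => Data.fold (fun y acc => g.eval (.cons y (.cons acc x))) (l.eval x) (a.eval x)

/-- A bound for the running time of the program that computes a term. -/
def cost : Fn → Data → ℕ
  | ex _, _ => 1
  | comp f g, x => f.cost x + g.cost (f.eval x) + 1
  | lt f g, x => f.cost x + g.cost (.cons (f.eval x) x) + 5
  | ite c f g, x => c.cost x + 5 + match c.eval x with
    | .nil => g.cost x
    | .cons _ _ => f.cost x
  | fold l a g, x => l.cost x + a.cost x + 10 +
      Data.foldCost (fun y acc => g.eval (.cons y (.cons acc x)))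
        (fun y acc => g.cost (.cons y (.cons acc x))) (l.eval x) (a.eval x)

/-- All folds in the evaluation of a term are over lists of length at most `L`. -/
def Ok (L : ℕ) : Fn → Data → Prop
  | ex _, _ => True
  | comp f g, x => f.Ok L x ∧ g.Ok L (f.eval x)
  | lt f g, x => f.Ok L x ∧ g.Ok L (.cons (f.eval x) x)
  | ite c f g, x => c.Ok L x ∧ match c.eval x with
    | .nil => g.Ok L x
    | .cons _ _ => f.Ok L x
  | fold l a g, x => l.Ok L x ∧ a.Ok L x ∧ (l.eval x).len ≤ L ∧
      Data.FoldAll (fun y acc => g.eval (.cons y (.cons acc x)))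
        (fun y acc => g.Ok L (.cons y (.cons acc x))) (l.eval x) (a.eval x)

/-- Coefficient of the cost bound. -/
def wt : Fn → ℕ
  | ex _ => 1
  | comp f g => f.wt + g.wt + 1
  | lt f g => f.wt + g.wt + 5
  | ite c f g => c.wt + f.wt + g.wt + 5
  | fold l a g => l.wt + a.wt + g.wt + 19

/-- Exponent of the cost bound. -/
def dep : Fn → ℕ
  | ex _ => 0
  | comp f g => f.dep + g.dep
  | lt f g => f.dep + g.dep
  | ite c f g => c.dep + f.dep + g.dep
  | fold l a g => l.dep + a.dep + g.dep + 1

theorem _root_.LinearRL.Data.foldCost_le {g : Data → Data → Data} {w : Data → Data → ℕ} {W : ℕ}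
    (l acc : Data) (h : Data.FoldAll g (fun x acc => w x acc ≤ W) l acc) :
    Data.foldCost g w l acc ≤ l.len * (W + 8) + 1 := by
  induction l generalizing acc with
  | nil => simp [Data.foldCost]
  | cons x xs _ ih =>
    have := ih _ h.2
    have := h.1
    simp only [Data.foldCost, Data.len]
    nlinarith

theorem _root_.LinearRL.Data.FoldAll.imp {g : Data → Data → Data} {P Q : Data → Data → Prop}
    (hPQ : ∀ x acc, P x acc → Q x acc) (l acc : Data) (h : Data.FoldAll g P l acc) :
    Data.FoldAll g Q l acc := by
  induction l generalizing acc with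
  | nil => trivial
  | cons x xs _ ih => exact ⟨hPQ _ _ h.1, ih _ h.2⟩

/-- Evaluating an expression takes one step however large the trees are, so only the lengths of
folded lists matter and each fold contributes one factor `L + 1`. Coefficient and exponent depend on
the term alone. -/
theorem cost_le {L : ℕ} (F : Fn) (x : Data) (h : F.Ok L x) : F.cost x ≤ F.wt * (L + 1) ^ F.dep := by
  have hp : ∀ n, 1 ≤ (L + 1) ^ n := fun n => Nat.one_le_pow _ _ (by omega)
  have mono : ∀ {a w m n : ℕ}, a ≤ w * (L + 1) ^ m → m ≤ n → a ≤ w * (L + 1) ^ n := fun h hmn =>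
    h.trans (Nat.mul_le_mul_left _ (Nat.pow_le_pow_right (by omega) hmn))
  induction F generalizing x with
  | ex e => simp [cost, wt, dep]
  | comp f g ihf ihg =>
    have h1 := mono (ihf _ h.1) (show f.dep ≤ (comp f g).dep by simp [dep])
    have h2 := mono (ihg _ h.2) (show g.dep ≤ (comp f g).dep by simp [dep])
    have := hp (comp f g).dep
    simp only [cost, wt]
    nlinarith
  | lt f g ihf ihg =>
    have h1 := mono (ihf _ h.1) (show f.dep ≤ (lt f g).dep by simp [dep])
    have h2 := mono (ihg _ h.2) (show g.dep ≤ (lt f g).dep by simp [dep])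
    have := hp (lt f g).dep
    simp only [cost, wt]
    nlinarith
  | ite c f g ihc ihf ihg =>
    obtain ⟨h1, h2⟩ := h
    have h1 := mono (ihc _ h1) (show c.dep ≤ (ite c f g).dep by simp [dep]; omega)
    have := hp (ite c f g).dep
    simp only [cost, wt]
    split at h2
    · have h2 := mono (ihg _ h2) (show g.dep ≤ (ite c f g).dep by simp [dep])
      nlinarith
    · have h2 := mono (ihf _ h2) (show f.dep ≤ (ite c f g).dep by simp [dep]; omega)
      nlinarith
  | fold l a g ihl iha ihg =>
    obtain ⟨h1, h2, h3, h4⟩ := h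
    have h1 := mono (ihl _ h1) (show l.dep ≤ (fold l a g).dep by simp [dep]; omega)
    have h2 := mono (iha _ h2) (show a.dep ≤ (fold l a g).dep by simp [dep]; omega)
    have h5 := Data.foldCost_le _ _ (h4.imp (fun y acc => ihg _))
    have h6 : (l.eval x).len * (g.wt * (L + 1) ^ g.dep + 8) ≤
        (g.wt + 8) * (L + 1) ^ (fold l a g).dep := by
      calc (l.eval x).len * (g.wt * (L + 1) ^ g.dep + 8)
          ≤ (L + 1) * (g.wt * (L + 1) ^ g.dep + 8 * (L + 1) ^ g.dep) := by
            have := hp g.dep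
            gcongr <;> omega
        _ = (g.wt + 8) * (L + 1) ^ (g.dep + 1) := by ring
        _ ≤ _ := by
            refine Nat.mul_le_mul_left _ (Nat.pow_le_pow_right (by omega) ?_)
            simp [dep]
    have := hp (fold l a g).dep
    simp only [cost, wt]
    nlinarith

/-- The program computing a term, with input and output in variable `2 * i`; variables `2 * j` with
`j > i` are used as auxiliary memory. -/
def compile : Fn → ℕ → Program
  | ex e, i => .assign (2 * i) (e.subst fun _ => .var (2 * i))
  | comp f g, i => .seq (f.compile i) (g.compile i)
  | lt f g, i =>
    .seq (.assign (2 * (i + 1)) (.var (2 * i))) <| .seq (f.compile (i + 1)) <|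
    .seq (.assign (2 * i) (.cons (.var (2 * (i + 1))) (.var (2 * i)))) (g.compile i)
  | ite c f g, i =>
    .seq (.assign (2 * (i + 1)) (.var (2 * i))) <| .seq (c.compile (i + 1)) <|
    .ite (.var (2 * (i + 1))) (f.compile i) (g.compile i)
  | fold l a g, i =>
    .seq (.assign (2 * (i + 1)) (.var (2 * i))) <| .seq (l.compile (i + 1)) <|
    .seq (.assign (2 * (i + 2)) (.var (2 * i))) <| .seq (a.compile (i + 2)) <|
    .seq (.loop (.var (2 * (i + 1)))
      (.seq (.assign (2 * (i + 3)) (.cons (.hd (.var (2 * (i + 1))))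
        (.cons (.var (2 * (i + 2))) (.var (2 * i))))) <| .seq (g.compile (i + 3)) <|
      .seq (.assign (2 * (i + 2)) (.var (2 * (i + 3))))
        (.assign (2 * (i + 1)) (.tl (.var (2 * (i + 1))))))) <|
    .assign (2 * i) (.var (2 * (i + 2)))

/-- The stores agree except at the variables `2 * j` with `j ≥ i`. -/
def Frame (i : ℕ) (σ σ' : Store) : Prop := ∀ j, (∀ i' ≥ i, j ≠ 2 * i') → σ' j = σ j

theorem Frame.refl (i : ℕ) (σ : Store) : Frame i σ σ := fun _ _ => rfl

theorem Frame.trans {i : ℕ} {σ σ' σ'' : Store} (h : Frame i σ σ') (h' : Frame i σ' σ'') :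
    Frame i σ σ'' := fun j hj => (h' j hj).trans (h j hj)

theorem Frame.mono {i i' : ℕ} {σ σ' : Store} (h : Frame i' σ σ') (hi : i ≤ i') : Frame i σ σ' :=
  fun j hj => h j fun a ha => hj a (hi.trans ha)

theorem Frame.update {i i' : ℕ} (σ : Store) (x : Data) (hi : i ≤ i') :
    Frame i σ (Function.update σ (2 * i') x) :=
  fun _ hj => Function.update_of_ne (hj i' hi) _ _

theorem Frame.eq {i i' : ℕ} {σ σ' : Store} (h : Frame i' σ σ') (hi : i < i') :
    σ' (2 * i) = σ (2 * i) := h _ fun a ha => by omega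

/-- Subterms whose value is needed beside the environment are computed in higher even variables, and
`Frame` keeps the environment in variable `2 * i` intact meanwhile. An arbitrary remaining stack `K`
makes the runs of the subterms composable. -/
theorem reach_compile (O : Oracle) (F : Fn) (i : ℕ) (σ : Store) (K : List Program) :
    ∃ σ', Reach O ⟨F.compile i :: K, σ⟩ ⟨K, σ'⟩ (F.cost (σ (2 * i))) ∧
      σ' (2 * i) = F.eval (σ (2 * i)) ∧ Frame i σ σ' := by
  induction F generalizing i σ K with
  | ex e =>
    refine ⟨_, .head (step_assign ..) (.refl _ _ 0) (by simp [cost]), ?_, .update _ _ le_rfl⟩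
    simp [Expr.eval_subst, eval, Expr.ev, Expr.eval]
  | comp f g ihf ihg =>
    obtain ⟨σ₁, h1, e1, f1⟩ := ihf i σ (g.compile i :: K)
    obtain ⟨σ₂, h2, e2, f2⟩ := ihg i σ₁ K
    refine ⟨σ₂, .head (step_seq ..) (h1.trans h2) (by simp [cost, e1]), ?_, f1.trans f2⟩
    rw [e2, e1]; rfl
  | lt f g ihf ihg =>
    set K' : List Program := .seq (.assign (2 * i) (.cons (.var (2 * (i + 1))) (.var (2 * i))))
      (g.compile i) :: K with hK'
    obtain ⟨σ₁, h1, e1, f1⟩ := ihf (i + 1) (Function.update σ (2 * (i + 1)) (σ (2 * i))) K'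
    rw [Function.update_self] at e1 h1
    have e1' : σ₁ (2 * i) = σ (2 * i) := by
      rw [f1.eq (by omega), Function.update_of_ne (by omega)]
    set σ₂ := Function.update σ₁ (2 * i) (Data.cons (σ₁ (2 * (i + 1))) (σ₁ (2 * i))) with hσ₂
    obtain ⟨σ₃, h3, e3, f3⟩ := ihg i σ₂ K
    have e2 : σ₂ (2 * i) = .cons (f.eval (σ (2 * i))) (σ (2 * i)) := by
      rw [hσ₂, Function.update_self, e1, e1']
    rw [e2] at h3 e3
    refine ⟨σ₃, ?_, e3, ?_⟩
    · refine .head (step_seq ..) (.head (step_assign ..) (.head (step_seq ..)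
        (h1.trans (.head (step_seq ..) (.head (step_assign ..) h3 le_rfl) le_rfl)) le_rfl) le_rfl)
        (by simp only [cost]; omega)
    · exact ((Frame.update σ _ (Nat.le_succ i)).trans (f1.mono (Nat.le_succ i))).trans
        ((Frame.update σ₁ _ le_rfl).trans f3)
  | ite c f g ihc ihf ihg =>
    set K' : List Program := .ite (.var (2 * (i + 1))) (f.compile i) (g.compile i) :: K with hK'
    obtain ⟨σ₁, h1, e1, f1⟩ := ihc (i + 1) (Function.update σ (2 * (i + 1)) (σ (2 * i))) K'
    rw [Function.update_self] at e1 h1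
    have e1' : σ₁ (2 * i) = σ (2 * i) := by
      rw [f1.eq (by omega), Function.update_of_ne (by omega)]
    have f1' : Frame i σ σ₁ := (Frame.update σ _ (Nat.le_succ i)).trans (f1.mono (Nat.le_succ i))
    have key : ∀ σ' T, Reach O ⟨K', σ₁⟩ ⟨K, σ'⟩ T →
        Reach O ⟨(ite c f g).compile i :: K, σ⟩ ⟨K, σ'⟩ (c.cost (σ (2 * i)) + 3 + T) :=
      fun σ' T h => .head (step_seq ..) (.head (step_assign ..) (.head (step_seq ..) (h1.trans h)
        le_rfl) le_rfl) (by omega)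
    cases hc : c.eval (σ (2 * i)) with
    | nil =>
      obtain ⟨σ₂, h2, e2, f2⟩ := ihg i σ₁ K
      rw [e1'] at e2 h2
      refine ⟨σ₂, (key _ _ (.head (step_ite_nil _ _ _ _ _ ?_) h2 le_rfl)).mono ?_, ?_, f1'.trans f2⟩
      · simp [Expr.eval, e1, hc]
      · simp only [cost, hc]; omega
      · simp only [eval, hc, e2]
    | cons a b =>
      obtain ⟨σ₂, h2, e2, f2⟩ := ihf i σ₁ K
      rw [e1'] at e2 h2
      refine ⟨σ₂, (key _ _ (.head (step_ite_ne _ _ _ _ _ ?_) h2 le_rfl)).mono ?_, ?_, f1'.trans f2⟩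
      · simp [Expr.eval, e1, hc]
      · simp only [cost, hc]; omega
      · simp only [eval, hc, e2]
  | fold l a g ihl iha ihg =>
    set body : Program := (.seq (.assign (2 * (i + 3)) (.cons (.hd (.var (2 * (i + 1))))
        (.cons (.var (2 * (i + 2))) (.var (2 * i))))) <| .seq (g.compile (i + 3)) <|
      .seq (.assign (2 * (i + 2)) (.var (2 * (i + 3))))
        (.assign (2 * (i + 1)) (.tl (.var (2 * (i + 1)))))) with hbody
    -- Loop invariant: variable `2 * (i + 1)` holds the rest of the list, `2 * (i + 2)` the
    -- accumulator, and `2 * i` the original environment.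
    have loop : ∀ (ls : Data) (τ : Store) (K : List Program), τ (2 * (i + 1)) = ls →
        τ (2 * i) = σ (2 * i) →
        ∃ τ', Reach O ⟨.loop (.var (2 * (i + 1))) body :: K, τ⟩ ⟨K, τ'⟩
          (Data.foldCost (fun y acc => g.eval (.cons y (.cons acc (σ (2 * i)))))
            (fun y acc => g.cost (.cons y (.cons acc (σ (2 * i))))) ls (τ (2 * (i + 2)))) ∧
          τ' (2 * (i + 2)) = Data.fold (fun y acc => g.eval (.cons y (.cons acc (σ (2 * i)))))
            ls (τ (2 * (i + 2))) ∧ Frame (i + 1) τ τ' := by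
      intro ls
      induction ls with
      | nil =>
        intro τ K h1 _
        exact ⟨τ, .head (step_loop_nil _ _ _ _ h1) (.refl _ _ 0) (by simp [Data.foldCost]), rfl,
          .refl _ _⟩
      | cons y ys _ ih =>
        intro τ K h1 h0
        set τ₁ := Function.update τ (2 * (i + 3)) (.cons y (.cons (τ (2 * (i + 2))) (σ (2 * i))))
          with hτ₁
        set K₁ : List Program := .seq (.assign (2 * (i + 2)) (.var (2 * (i + 3))))
          (.assign (2 * (i + 1)) (.tl (.var (2 * (i + 1))))) ::
            .loop (.var (2 * (i + 1))) body :: K with hK₁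
        obtain ⟨τ₂, h2, e2, f2⟩ := ihg (i + 3) τ₁ K₁
        have t1 : τ₁ (2 * (i + 3)) = .cons y (.cons (τ (2 * (i + 2))) (σ (2 * i))) := by simp [hτ₁]
        rw [t1] at h2 e2
        have t2 : τ₂ (2 * (i + 1)) = .cons y ys := by
          rw [f2.eq (by omega), hτ₁, Function.update_of_ne (by omega), h1]
        set τ₃ := Function.update τ₂ (2 * (i + 2)) (τ₂ (2 * (i + 3))) with hτ₃
        set τ₄ := Function.update τ₃ (2 * (i + 1)) (τ₃ (2 * (i + 1))).tl with hτ₄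
        have f4 : Frame (i + 1) τ τ₄ :=
          (((Frame.update τ _ (by omega)).trans (f2.mono (by omega))).trans
            (Frame.update τ₂ _ (by omega))).trans (Frame.update τ₃ _ (by omega))
        have t4 : τ₄ (2 * (i + 1)) = ys := by
          rw [hτ₄, Function.update_self, hτ₃, Function.update_of_ne (by omega), t2, Data.tl]
        have t4' : τ₄ (2 * (i + 2)) = g.eval (.cons y (.cons (τ (2 * (i + 2))) (σ (2 * i)))) := by
          rw [hτ₄, Function.update_of_ne (by omega), hτ₃, Function.update_self, e2]
        obtain ⟨τ', h5, e5, f5⟩ := ih τ₄ K t4 (by rw [f4.eq (by omega), h0])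
        rw [t4'] at h5 e5
        refine ⟨τ', ?_, e5, f4.trans f5⟩
        refine .head (step_loop_ne _ _ _ _ (by simp [Expr.eval, h1])) (.head (step_seq ..)
          (.head (c' := ⟨.seq (g.compile (i + 3)) _ :: _, τ₁⟩) ?_ (.head (step_seq ..)
          (h2.trans (.head (step_seq ..) (.head (step_assign ..) (.head (step_assign ..) h5 le_rfl)
          le_rfl) le_rfl)) le_rfl) le_rfl) le_rfl) ?_
        · rw [step_assign]
          simp [Expr.eval, h1, h0, hτ₁, Data.hd]
        · simp only [Data.foldCost]; omega
    set K₁ : List Program := .seq (.assign (2 * (i + 2)) (.var (2 * i))) (.seq (a.compile (i + 2))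
      (.seq (.loop (.var (2 * (i + 1))) body) (.assign (2 * i) (.var (2 * (i + 2)))))) :: K with hK₁
    obtain ⟨σ₁, h1, e1, f1⟩ := ihl (i + 1) (Function.update σ (2 * (i + 1)) (σ (2 * i))) K₁
    rw [Function.update_self] at e1 h1
    have g1 : Frame (i + 1) σ σ₁ := (Frame.update σ _ le_rfl).trans f1
    have q : σ₁ (2 * i) = σ (2 * i) := g1.eq (Nat.lt_succ_self i)
    obtain ⟨σ₂, h2, e2, f2⟩ := iha (i + 2) (Function.update σ₁ (2 * (i + 2)) (σ (2 * i)))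
      (.seq (.loop (.var (2 * (i + 1))) body) (.assign (2 * i) (.var (2 * (i + 2)))) :: K)
    rw [Function.update_self] at e2 h2
    have g2 : Frame (i + 2) σ₁ σ₂ := (Frame.update σ₁ _ le_rfl).trans f2
    obtain ⟨σ₃, h3, e3, f3⟩ := loop (l.eval (σ (2 * i))) σ₂ (.assign (2 * i) (.var (2 * (i + 2))) :: K)
      (by rw [g2.eq (by omega), e1]) (by rw [g2.eq (by omega), q])
    rw [e2] at h3 e3
    refine ⟨Function.update σ₃ (2 * i) (σ₃ (2 * (i + 2))), ?_, ?_, ?_⟩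
    · refine .head (step_seq ..) (.head (step_assign ..) (.head (step_seq ..)
        (h1.trans (.head (step_seq ..) (.head (by rw [step_assign, Expr.eval, q])
          (.head (step_seq ..) (h2.trans (.head (step_seq ..) (h3.trans (.head (step_assign ..)
            (.refl _ _ 0) le_rfl)) le_rfl)) le_rfl) le_rfl) le_rfl)) le_rfl) le_rfl) ?_
      simp only [cost]; omega
    · rw [Function.update_self, e3]; rfl
    · exact (((g1.mono (by omega)).trans (g2.mono (by omega))).trans (f3.mono (by omega))).trans
        (Frame.update σ₃ _ le_rfl)

end Fn

/-! ### Simulation of an oracle algorithm with a time limit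

The variable `x` of the simulated algorithm is kept in variable `2 * x + 1`. Variable `0` holds the
parameters of the simulated oracle, variable `2` the remaining time (in unary), variable `4` the
flag that stops the simulation, variable `6` the value of a test; variables `8, 10, …` are used
by the subroutine that answers the queries. -/

namespace Simulation

/-- Renaming of the variables of the simulated algorithm. -/
def ren (e : Expr) : Expr := e.subst fun n => .var (2 * n + 1)

/-- Count one step. -/
def tick : Program := .assign 2 (.tl (.var 2))

/-- Evaluate a test, as false if there is no time left. -/
def test (e : Expr) : Program := .ite (.var 2) (.assign 6 (ren e)) (.assign 6 .nil)

/-- Raise the flag and abort the simulation. -/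
def abort : Program := .seq (.assign 2 .nil) (.assign 4 (.cons .nil .nil))

variable (Qf W : Fn)

/-- The simulation of a program. The term `Qf` computes from a query and the parameters
the pair of `nil` and the answer, or a pair of which the first component is not `nil` in order to
abort the simulation. -/
def sim : Program → Program
  | .skip => .ite (.var 2) tick .skip
  | .assign x e => .ite (.var 2) (.seq tick (.assign (2 * x + 1) (ren e))) .skip
  | .flip x => .ite (.var 2) (.seq tick (.flip (2 * x + 1))) .skip
  | .query x e => .ite (.var 2) (.seq tick (.seq (.assign 8 (.cons (ren e) (.var 0)))
      (.seq (Qf.compile 4) (.ite (.hd (.var 8)) abort (.assign (2 * x + 1) (.tl (.var 8))))))) .skip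
  | .seq p q => .ite (.var 2) (.seq tick (.seq (sim p) (sim q))) .skip
  | .ite e p q => .ite (.var 2) (.seq tick (.ite (ren e) (sim p) (sim q))) .skip
  | .loop e p => .seq (.seq (test e) (.loop (.var 6) (.seq (.seq tick (sim p)) (test e)))) tick

/-- Program to be executed after the simulation: if the flag is raised, the output is `(nil . nil)`,
otherwise `W` computes it from the output of the simulated algorithm and the parameters. -/
def post : Program := .ite (.var 4) (.assign 0 (.cons .nil .nil))
  (.seq (.assign 0 (.cons (.var 1) (.var 0))) (W.compile 0))

/-- The stack of the simulation that corresponds to a stack of the simulated algorithm. -/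
inductive StackRel : List Program → List Program → Prop
  | done : StackRel [] [post W]
  | cons {k K : List Program} (p : Program) : StackRel k K → StackRel (p :: k) (sim Qf p :: K)
  | loop {k K : List Program} (e : Expr) (p : Program) : StackRel k K →
      StackRel (.loop e p :: k)
        (test e :: .loop (.var 6) (.seq (.seq tick (sim Qf p)) (test e)) :: tick :: K)

/-- The store of the simulation, with parameters `P` and remaining time `t`, that corresponds to a
store of the simulated algorithm. -/
structure StoreRel (P : Data) (t : ℕ) (σ τ : Store) : Prop where
  odd : ∀ x, τ (2 * x + 1) = σ x
  params : τ 0 = P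
  clock : τ 2 = Data.unary t
  flag : τ 4 = .nil

variable {Qf W} {P : Data}

theorem unary_succ (t : ℕ) : Data.unary (t + 1) = .cons .nil (Data.unary t) := rfl

theorem StoreRel.eval_ren {t : ℕ} {σ τ : Store} (h : StoreRel P t σ τ) (e : Expr) :
    (ren e).eval τ = e.eval σ := by
  rw [ren, Expr.eval_subst]
  congr 1
  funext n
  exact h.odd n

theorem StoreRel.tick {t : ℕ} {σ τ : Store} (h : StoreRel P (t + 1) σ τ) :
    StoreRel P t σ (Function.update τ 2 (τ 2).tl) where
  odd x := by rw [Function.update_of_ne (by omega), h.odd]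
  params := by rw [Function.update_of_ne (by omega), h.params]
  clock := by rw [Function.update_self, h.clock]; rfl
  flag := by rw [Function.update_of_ne (by omega), h.flag]

theorem StoreRel.update {t : ℕ} {σ τ : Store} (h : StoreRel P t σ τ) (x : ℕ) (y : Data) :
    StoreRel P t (Function.update σ x y) (Function.update τ (2 * x + 1) y) where
  odd z := by
    rcases eq_or_ne z x with rfl | hz
    · simp
    · rw [Function.update_of_ne hz, Function.update_of_ne (by omega), h.odd]
  params := by rw [Function.update_of_ne (by omega), h.params]
  clock := by rw [Function.update_of_ne (by omega), h.clock]
  flag := by rw [Function.update_of_ne (by omega), h.flag]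

theorem StoreRel.frame {t : ℕ} {σ τ τ' : Store} (h : StoreRel P t σ τ) (hf : Fn.Frame 3 τ τ') :
    StoreRel P t σ τ' where
  odd x := by rw [hf _ (by omega), h.odd]
  params := by rw [hf _ (by omega), h.params]
  clock := by rw [hf _ (by omega), h.clock]
  flag := by rw [hf _ (by omega), h.flag]

variable (O : Oracle)

theorem reach_test {t : ℕ} {σ τ : Store} (h : StoreRel P (t + 1) σ τ) (e : Expr)
    (K : List Program) :
    Reach O ⟨test e :: K, τ⟩ ⟨K, Function.update τ 6 (e.eval σ)⟩ 2 := by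
  refine .head (step_ite_ne _ _ _ _ _ ?_) (.head (step_assign ..) ?_ le_rfl) le_rfl
  · simp [Expr.eval, h.clock, unary_succ]
  · rw [h.eval_ren]; exact .refl _ _ _

theorem reach_test_dead {τ : Store} (h : τ 2 = .nil) (e : Expr) (K : List Program) :
    Reach O ⟨test e :: K, τ⟩ ⟨K, Function.update τ 6 .nil⟩ 2 :=
  .head (step_ite_nil _ _ _ _ _ h) (.head (step_assign ..) (.refl _ _ _) le_rfl) le_rfl

theorem reach_sim_alive {t : ℕ} {σ τ : Store} (h : StoreRel P (t + 1) σ τ) (p q : Program)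
    (K : List Program) :
    Reach O ⟨.ite (.var 2) (.seq tick p) q :: K, τ⟩
      ⟨p :: K, Function.update τ 2 (τ 2).tl⟩ 3 := by
  refine .head (step_ite_ne _ _ _ _ _ ?_) (.head (step_seq ..) (.head (step_assign ..)
    (.refl _ _ _) le_rfl) le_rfl) le_rfl
  simp [Expr.eval, h.clock, unary_succ]

theorem reach_loop_dead {τ : Store} (h : τ 2 = .nil) (e : Expr) (p : Program) (K : List Program) :
    ∃ τ', Reach O ⟨test e :: .loop (.var 6) p :: tick :: K, τ⟩ ⟨K, τ'⟩ 4 ∧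
      ∀ j, j ≠ 6 → τ' j = τ j := by
  refine ⟨_, (reach_test_dead O h e _).trans (t := 2) (.head (step_loop_nil _ _ _ _ ?_)
    (.head (step_assign ..) (.refl _ _ _) le_rfl) le_rfl), ?_⟩
  · simp [Expr.eval]
  · intro j hj
    -- The final `tick` leaves an empty clock empty, because `tl nil = nil`.
    rcases eq_or_ne j 2 with rfl | h2
    · simp [h, Expr.eval, Data.tl]
    · simp [h2, hj]

/-- With an empty clock every guarded piece is skipped and every loop test is false, so the pending
stack is cleared in at most 8 steps per piece. Only the scratch variable 6 may change, hence the
flag and the output survive. -/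
theorem reach_dead {k K : List Program} (hk : StackRel Qf W k K) (τ : Store) (h : τ 2 = .nil) :
    ∃ τ', Reach O ⟨K, τ⟩ ⟨[post W], τ'⟩ (k.length * 8) ∧ ∀ j, j ≠ 6 → τ' j = τ j := by
  induction hk generalizing τ with
  | done => exact ⟨τ, .refl _ _ _, fun _ _ => rfl⟩
  | @cons k K p hk ih =>
    by_cases hp : ∃ e q, p = .loop e q
    · obtain ⟨e, q, rfl⟩ := hp
      obtain ⟨τ₁, h1, f1⟩ := reach_loop_dead O h e (.seq (.seq tick (sim Qf q)) (test e)) K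
      obtain ⟨τ', h2, f2⟩ := ih τ₁ (by rw [f1 2 (by omega), h])
      refine ⟨τ', .head (step_seq ..) (.head (step_seq ..) (h1.trans h2) le_rfl) ?_, fun j hj => ?_⟩
      · simp only [List.length_cons]; omega
      · rw [f2 j hj, f1 j hj]
    · obtain ⟨τ', h1, f1⟩ := ih τ h
      have : ∃ q, sim Qf p = .ite (.var 2) q .skip := by
        cases p <;> first | exact ⟨_, rfl⟩ | exact absurd ⟨_, _, rfl⟩ hp
      obtain ⟨q, hq⟩ := this
      refine ⟨τ', hq ▸ .head (step_ite_nil _ _ _ _ _ h) (.head (step_skip ..) h1 le_rfl) ?_, f1⟩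
      simp only [List.length_cons]; omega
  -- A loop that is re-entered after its body sits on the stack already unfolded, without its two
  -- leading `seq`.
  | @loop k K e p hk ih =>
    obtain ⟨τ₁, h1, f1⟩ := reach_loop_dead O h e (.seq (.seq tick (sim Qf p)) (test e)) K
    obtain ⟨τ', h2, f2⟩ := ih τ₁ (by rw [f1 2 (by omega), h])
    refine ⟨τ', (h1.trans h2).mono ?_, fun j hj => ?_⟩
    · simp only [List.length_cons]; omega
    · rw [f2 j hj, f1 j hj]

open Classical in
theorem le_Pr_post {τ : Store} {y : Data} {N : ℕ} {Y : Set Data} (hflag : τ 4 = .nil)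
    (hy : τ 1 = y) (hP : τ 0 = P) (hN : W.cost (.cons y P) + 3 ≤ N) :
    (if W.eval (.cons y P) ∈ Y then 1 else 0) ≤ Pr O N ⟨[post W], τ⟩ Y := by
  set τ₁ := Function.update τ 0 (.cons y P) with hτ₁
  obtain ⟨τ₂, h1, e1, -⟩ := Fn.reach_compile O W 0 τ₁ []
  have e0 : τ₁ (2 * 0) = .cons y P := by simp [hτ₁]
  rw [e0] at h1 e1
  have h2 : Reach O ⟨[post W], τ⟩ ⟨[], τ₂⟩ (W.cost (.cons y P) + 3) := by
    refine .head (step_ite_nil _ _ _ _ _ hflag) (.head (step_seq ..) (.head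
      (c' := ⟨_, τ₁⟩) ?_ h1 le_rfl) le_rfl) le_rfl
    rw [step_assign]; simp [Expr.eval, hy, hP, hτ₁]
  refine le_trans (le_of_eq ?_) (h2.le_Pr (m := 0) (by omega) Y)
  rw [Pr_halted, ← e1]

open Classical in
theorem le_Pr_post_flag {τ : Store} {N : ℕ} {Y : Set Data} (hflag : τ 4 ≠ .nil) (hN : 2 ≤ N) :
    (if Data.cons .nil .nil ∈ Y then 1 else 0) ≤ Pr O N ⟨[post W], τ⟩ Y := by
  have h2 : Reach O ⟨[post W], τ⟩ ⟨[], Function.update τ 0 (.cons .nil .nil)⟩ 2 :=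
    .head (step_ite_ne _ _ _ _ _ hflag) (.head (step_assign ..) (.refl _ _ _) le_rfl) le_rfl
  refine le_trans (le_of_eq ?_) (h2.le_Pr (m := 0) (by omega) Y)
  rw [Pr_halted]; simp

open Classical in
/-- A quantity `Φ t k σ`, depending on the remaining time and the configuration of the simulated
algorithm, that is a lower bound for the probability of an output in `Y` at the end of the
simulation and does not decrease under a step. The answers to the queries are
given by `ans`, where `none` means that the simulation is stopped. -/
structure Potential (W : Fn) (P : Data) (ans : Data → Option Data) (Y : Set Data)
    (Φ : ℕ → List Program → Store → ℝ≥0∞) : Prop where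
  timeout : ∀ k σ, Φ 0 k σ ≤ if W.eval (.cons (σ 0) P) ∈ Y then 1 else 0
  done : ∀ t σ, Φ t [] σ ≤ if W.eval (.cons (σ 0) P) ∈ Y then 1 else 0
  skip : ∀ t k σ, Φ (t + 1) (.skip :: k) σ ≤ Φ t k σ
  assign : ∀ t x e k σ, Φ (t + 1) (.assign x e :: k) σ ≤ Φ t k (Function.update σ x (e.eval σ))
  flip : ∀ t x k σ, Φ (t + 1) (.flip x :: k) σ ≤
    2⁻¹ * Φ t k (Function.update σ x (Data.ofBool true)) +
      2⁻¹ * Φ t k (Function.update σ x (Data.ofBool false))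
  query : ∀ t x e k σ y, ans (e.eval σ) = some y →
    Φ (t + 1) (.query x e :: k) σ ≤ Φ t k (Function.update σ x y)
  query_abort : ∀ t x e k σ, ans (e.eval σ) = none →
    Φ (t + 1) (.query x e :: k) σ ≤ if Data.cons .nil .nil ∈ Y then 1 else 0
  seq : ∀ t p q k σ, Φ (t + 1) (.seq p q :: k) σ ≤ Φ t (p :: q :: k) σ
  ite_nil : ∀ t e p q k σ, e.eval σ = .nil → Φ (t + 1) (.ite e p q :: k) σ ≤ Φ t (q :: k) σ
  ite_ne : ∀ t e p q k σ, e.eval σ ≠ .nil → Φ (t + 1) (.ite e p q :: k) σ ≤ Φ t (p :: k) σ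
  loop_nil : ∀ t e p k σ, e.eval σ = .nil → Φ (t + 1) (.loop e p :: k) σ ≤ Φ t k σ
  loop_ne : ∀ t e p k σ, e.eval σ ≠ .nil →
    Φ (t + 1) (.loop e p :: k) σ ≤ Φ t (p :: .loop e p :: k) σ

/-- The simulated oracle, presented by `Qf`. -/
def answer (Qf : Fn) (P q : Data) : Option Data :=
  match Qf.eval (.cons q P) with
  | .cons .nil y => some y
  | .nil => some .nil
  | .cons (.cons _ _) _ => none

/-- Induction on the clock. A simulated step costs at most `S` steps and lengthens the simulated
stack by at most one piece; 8 steps per piece are reserved for clearing the stack when the clock is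
empty, and `Sp` for the postprocessing. -/
theorem Potential.le_Pr {Y : Set Data}
    {Φ : ℕ → List Program → Store → ℝ≥0∞} (hΦ : Potential W P (answer Qf P) Y Φ) {S Sp : ℕ}
    (hS : ∀ q, Qf.cost (.cons q P) + 20 ≤ S) (hSp : ∀ y, W.cost (.cons y P) + 3 ≤ Sp)
    (t : ℕ) (k K : List Program) (σ τ : Store) (hk : StackRel Qf W k K) (hσ : StoreRel P t σ τ) :
    Φ t k σ ≤ Pr O (t * S + (k.length + t) * 8 + Sp) ⟨K, τ⟩ Y := by
  have hS20 := hS .nil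
  have hSp3 := hSp .nil
  induction t generalizing k K σ τ with
  | zero =>
    obtain ⟨τ', h1, f1⟩ := reach_dead O hk τ hσ.clock
    refine (hΦ.timeout k σ).trans ((le_Pr_post O (N := Sp) ?_ ?_ ?_ (hSp _)).trans
      (h1.le_Pr (m := Sp) (by omega) Y))
    · rw [f1 4 (by omega), hσ.flag]
    · rw [f1 1 (by omega), ← hσ.odd 0]
    · rw [f1 0 (by omega), hσ.params]
  | succ t ih =>
    have close : ∀ {k' K' : List Program} {σ' τ' : Store} {T : ℕ}, StackRel Qf W k' K' →
        StoreRel P t σ' τ' → k'.length ≤ k.length + 1 → T ≤ S →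
        Reach O ⟨K, τ⟩ ⟨K', τ'⟩ T →
        Φ t k' σ' ≤ Pr O ((t + 1) * S + (k.length + (t + 1)) * 8 + Sp) ⟨K, τ⟩ Y := by
      intro k' K' σ' τ' T hk' hσ' hlen hT hr
      refine (ih k' K' σ' τ' hk' hσ').trans (hr.le_Pr ?_ Y)
      rw [Nat.succ_mul]; omega
    -- One argument for both shapes of a loop: a fresh one is two `seq` steps away from its test (`n
    -- = 2`), a re-entered one stands at the test (`n = 0`).
    have loop : ∀ {k₀ K₀ : List Program} (e : Expr) (p : Program) (n : ℕ), StackRel Qf W k₀ K₀ →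
        k = .loop e p :: k₀ → n ≤ 10 →
        Reach O ⟨K, τ⟩ ⟨test e :: .loop (.var 6) (.seq (.seq tick (sim Qf p)) (test e)) ::
          tick :: K₀, τ⟩ n →
        Φ (t + 1) k σ ≤ Pr O ((t + 1) * S + (k.length + (t + 1)) * 8 + Sp) ⟨K, τ⟩ Y := by
      intro k₀ K₀ e p n hk₀ hk' hn hr
      subst hk'
      have h1 := hr.trans (reach_test O hσ e _)
      have hσ1 : StoreRel P (t + 1) σ (Function.update τ 6 (e.eval σ)) :=
        hσ.frame (Fn.Frame.update (i' := 3) τ _ le_rfl)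
      by_cases he : e.eval σ = .nil
      · refine (hΦ.loop_nil _ _ _ _ _ he).trans ?_
        refine close hk₀ hσ1.tick (by simp; omega) ?_ (h1.trans (t := 2) (.head
          (step_loop_nil _ _ _ _ ?_) (.head (step_assign ..) (.refl _ _ _) le_rfl) le_rfl))
        · omega
        · simp [Expr.eval, he]
      · refine (hΦ.loop_ne _ _ _ _ _ he).trans ?_
        refine close (.cons p (.loop e p hk₀)) hσ1.tick (by simp) ?_ (h1.trans (t := 4)
          (.head (step_loop_ne _ _ _ _ ?_) (.head (step_seq ..) (.head (step_seq ..) (.head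
            (step_assign ..) (.refl _ _ _) le_rfl) le_rfl) le_rfl) le_rfl))
        · omega
        · simp [Expr.eval, he]
    cases hk with
    | done =>
      refine (hΦ.done _ σ).trans (le_Pr_post O hσ.flag (hσ.odd 0) hσ.params ?_)
      have := hSp (σ 0); omega
    | @loop k₀ K₀ e p hk => exact loop e p 0 hk rfl (by omega) (.refl _ _ _)
    | @cons k₀ K₀ p hk =>
      cases p with
      | skip =>
        refine (hΦ.skip _ _ _).trans (close (T := 2) hk hσ.tick (by simp; omega) (by omega) ?_)
        refine .head (step_ite_ne _ _ _ _ _ ?_) (.head (step_assign ..) (.refl _ _ _) le_rfl) le_rfl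
        simp [Expr.eval, hσ.clock, unary_succ]
      | assign x e =>
        refine (hΦ.assign _ _ _ _ _).trans (close (T := 3 + 1) hk (hσ.tick.update x _)
          (by simp; omega) (by omega) ((reach_sim_alive O hσ _ _ _).trans ?_))
        refine .head (step_assign ..) ?_ (s := 0) le_rfl
        rw [hσ.tick.eval_ren]
        exact .refl _ _ _
      | flip x =>
        have h1 : ∀ b : Bool, _ := fun b => ih k₀ K₀ _ _ hk (hσ.tick.update x (.ofBool b))
        refine (hΦ.flip _ _ _ _).trans (le_trans ?_ ((reach_sim_alive O hσ _ _ _).le_Pr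
          (m := (t * S + (k₀.length + t) * 8 + Sp) + 1) ?_ Y))
        · rw [Pr_succ_of_step_map (μ := PMF.uniformOfFintype Bool)
            (g := fun b => ⟨K₀, Function.update (Function.update τ 2 (τ 2).tl) (2 * x + 1) (Data.ofBool b)⟩)
            (by simp [step]),
            tsum_bool, add_comm]
          simp only [PMF.uniformOfFintype_apply, Fintype.card_bool, Nat.cast_ofNat]
          gcongr
          · exact h1 false
          · exact h1 true
        · simp only [List.length_cons]; rw [Nat.succ_mul]; omega
      | query x e =>
        set τ₁ := Function.update τ 2 (τ 2).tl with hτ₁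
        have hσ1 : StoreRel P t σ τ₁ := hσ.tick
        set τ₂ := Function.update τ₁ 8 (.cons (e.eval σ) P) with hτ₂
        have hσ2 : StoreRel P t σ τ₂ := hσ1.frame (Fn.Frame.update (i' := 4) τ₁ _ (by omega))
        set K₁ : List Program :=
          .ite (.hd (.var 8)) abort (.assign (2 * x + 1) (.tl (.var 8))) :: K₀ with hK₁
        obtain ⟨τ₃, h3, e3, f3⟩ := Fn.reach_compile O Qf 4 τ₂ K₁
        have hσ3 : StoreRel P t σ τ₃ := hσ2.frame (f3.mono (by omega))
        have e2 : τ₂ (2 * 4) = .cons (e.eval σ) P := by simp [hτ₂]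
        rw [e2] at h3 e3
        have h4 : Reach O ⟨sim Qf (.query x e) :: K₀, τ⟩ ⟨K₁, τ₃⟩
            (3 + (Qf.cost (.cons (e.eval σ) P) + 3)) := by
          refine (reach_sim_alive O hσ _ _ _).trans (.head (step_seq ..) (.head (c' := ⟨_, τ₂⟩) ?_
            (.head (step_seq ..) h3 le_rfl) le_rfl) le_rfl)
          rw [← hτ₁, step_assign, Expr.eval, hσ1.eval_ren, Expr.eval, hσ1.params]
        have hS' := hS (e.eval σ)
        have e3' : τ₃ 8 = Qf.eval (.cons (e.eval σ) P) := e3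
        have cont : ∀ y, (Qf.eval (.cons (e.eval σ) P)).hd = .nil →
            (Qf.eval (.cons (e.eval σ) P)).tl = y → answer Qf P (e.eval σ) = some y →
            Φ (t + 1) (.query x e :: k₀) σ ≤
              Pr O ((t + 1) * S + ((Program.query x e :: k₀).length + (t + 1)) * 8 + Sp)
                ⟨sim Qf (.query x e) :: K₀, τ⟩ Y := by
          intro y hh ht hy
          refine (hΦ.query _ _ _ _ _ _ hy).trans (close hk (hσ3.update x y)
            (by simp; omega) ?_ (h4.trans (t := 2) (.head (step_ite_nil _ _ _ _ _ ?_) (.head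
              (c' := ⟨_, Function.update τ₃ (2 * x + 1) y⟩) ?_ (.refl _ _ _) le_rfl) le_rfl)))
          · omega
          · simp [Expr.eval, e3', hh]
          · rw [step_assign]; simp [Expr.eval, e3', ht]
        rcases hq : Qf.eval (.cons (e.eval σ) P) with _ | ⟨_ | ⟨a, b⟩, y⟩
        · exact cont .nil (by rw [hq]; rfl) (by rw [hq]; rfl) (by rw [answer, hq])
        · exact cont y (by rw [hq]; rfl) (by rw [hq]; rfl) (by rw [answer, hq])
        · have hy : answer Qf P (e.eval σ) = none := by rw [answer, hq]
          -- Aborting empties the clock, so that the rest of the simulated program is cleared by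
          -- `reach_dead` before the flag is inspected.
          set τ₄ := Function.update (Function.update τ₃ 2 .nil) 4 (.cons .nil .nil) with hτ₄
          obtain ⟨τ', h5, f5⟩ := reach_dead O hk τ₄ (by simp [hτ₄])
          have h6 := h4.trans (t := 4 + k₀.length * 8) (.head (step_ite_ne _ _ _ _ _ (by
            simp [Expr.eval, e3', hq, Data.hd])) (.head (step_seq ..) (.head (step_assign ..)
              (.head (step_assign ..) h5 le_rfl) le_rfl) le_rfl) (by omega))
          refine (hΦ.query_abort _ _ _ _ _ hy).trans ((le_Pr_post_flag O (N := 2) ?_ le_rfl).trans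
            (h6.le_Pr ?_ Y))
          · rw [f5 4 (by omega)]; simp [hτ₄]
          · simp only [List.length_cons]; rw [Nat.succ_mul]; omega
      | seq p q =>
        refine (hΦ.seq _ _ _ _ _).trans (close (T := 3 + 1) (.cons p (.cons q hk)) hσ.tick
          (by simp) (by omega) ((reach_sim_alive O hσ _ _ _).trans
          (.head (step_seq ..) (.refl _ _ _) (s := 0) le_rfl)))
      | ite e p q =>
        by_cases he : e.eval σ = .nil
        · refine (hΦ.ite_nil _ _ _ _ _ _ he).trans (close (T := 3 + 1) (.cons q hk) hσ.tick
            (by simp) (by omega) ((reach_sim_alive O hσ _ _ _).trans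
            (.head (step_ite_nil _ _ _ _ _ ?_) (.refl _ _ _) (s := 0) le_rfl)))
          rw [hσ.tick.eval_ren, he]
        · refine (hΦ.ite_ne _ _ _ _ _ _ he).trans (close (T := 3 + 1) (.cons p hk) hσ.tick
            (by simp) (by omega) ((reach_sim_alive O hσ _ _ _).trans
            (.head (step_ite_ne _ _ _ _ _ ?_) (.refl _ _ _) (s := 0) le_rfl)))
          rwa [hσ.tick.eval_ren]
      | loop e p =>
        exact loop e p 2 hk rfl (by omega) (.head (step_seq ..) (.head (step_seq ..)
          (.refl _ _ _) (s := 0) le_rfl) (s := 1) le_rfl)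

end Simulation

/-! ### Tensor powers of lists -/

/-- Scalar product of a real vector and a vector of bits. -/
def dot : List ℝ → List Bool → ℝ
  | a :: as, b :: bs => (if b then a else 0) + dot as bs
  | _, _ => 0

theorem dot_append {as : List ℝ} {bs : List Bool} (h : as.length = bs.length) (as' : List ℝ)
    (bs' : List Bool) : dot (as ++ as') (bs ++ bs') = dot as bs + dot as' bs' := by
  induction as generalizing bs with
  | nil => cases bs <;> simp_all [dot]
  | cons a as ih => cases bs <;> simp_all [dot, add_assoc]

theorem dot_ofFn {n : ℕ} (f : Fin n → ℝ) (g : Fin n → Bool) :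
    dot (List.ofFn f) (List.ofFn g) = ∑ i, if g i then f i else 0 := by
  induction n with
  | zero => simp [dot]
  | succ n ih => simp [List.ofFn_succ, dot, ih, Fin.sum_univ_succ]

/-- Padding with zeros up to dimension `d` does not change the scalar product; this frees the
dimension from the exact length of the tensor power. -/
theorem sum_getD_mul {d : ℕ} {as : List ℝ} (bs : List Bool) (h : as.length ≤ d) :
    ∑ i : Fin d, as.getD i 0 * (if bs.getD i false then 1 else 0) = dot as bs := by
  induction as generalizing bs d with
  | nil => simp [dot]
  | cons a as ih =>
    cases d with
    | zero => simp at h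
    | succ d =>
      cases bs with
      | nil => simp [dot]
      | cons b bs =>
        rw [Fin.sum_univ_succ]
        simp only [Fin.val_zero, List.getD_cons_zero, Fin.val_succ, List.getD_cons_succ, dot]
        rw [ih bs (by simpa using h)]
        cases b <;> simp

/-- Tensor product of two vectors. -/
def tensor {α : Type*} (mul : α → α → α) (u w : List α) : List α :=
  u.foldl (fun acc x => w.foldl (fun acc y => mul x y :: acc) acc) []

/-- Tensor power. -/
def tpow {α : Type*} (mul : α → α → α) (one : α) (u : List α) (r : ℕ) : List α :=
  (tensor mul u)^[r] [one]

section Tensor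

variable {α : Type*} (mul : α → α → α)

theorem length_tensor (u w : List α) : (tensor mul u w).length = u.length * w.length := by
  have h2 : ∀ acc : List α,
      (u.foldl (fun acc x => w.foldl (fun acc y => mul x y :: acc) acc) acc).length =
        u.length * w.length + acc.length := by
    induction u with
    | nil => simp
    | cons x u ih =>
      intro acc
      rw [List.foldl_cons, ih, List.length_cons, List.foldl_flip_cons_eq_append]
      simp
      ring
  simpa [tensor, -List.foldl_flip_cons_eq_append] using h2 []

theorem length_tpow (one : α) (u : List α) (r : ℕ) :
    (tpow mul one u r).length = u.length ^ r := by
  induction r with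
  | zero => simp [tpow]
  | succ r ih =>
    rw [tpow, Function.iterate_succ_apply', length_tensor, ← tpow, ih, pow_succ']

end Tensor

/-- The accumulating folds list the products in reverse order, but in the same one for both
arguments, so matching entries stay matched. The inductions carry arbitrary accumulators `P` and
`Q`. -/
theorem dot_tensor {as cs : List ℝ} {bs ds : List Bool} (h : as.length = bs.length)
    (h' : cs.length = ds.length) :
    dot (tensor (· * ·) as cs) (tensor (· && ·) bs ds) = dot as bs * dot cs ds := by
  have h1 : ∀ (a : ℝ) (b : Bool) (P : List ℝ) (Q : List Bool),
      dot (cs.foldl (fun acc y => a * y :: acc) P) (ds.foldl (fun acc y => (b && y) :: acc) Q) =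
        (if b then a else 0) * dot cs ds + dot P Q := by
    intro a b
    induction cs generalizing ds with
    | nil => cases ds <;> simp_all [dot]
    | cons c cs ih =>
      cases ds with
      | nil => simp at h'
      | cons d ds =>
        intro P Q
        simp only [List.foldl_cons]
        rw [ih (by simpa using h')]
        cases b <;> cases d <;> simp [dot]; ring
  have h2 : ∀ (P : List ℝ) (Q : List Bool),
      dot (as.foldl (fun acc x => cs.foldl (fun acc y => x * y :: acc) acc) P)
        (bs.foldl (fun acc x => ds.foldl (fun acc y => (x && y) :: acc) acc) Q) =
        dot as bs * dot cs ds + dot P Q := by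
    induction as generalizing bs with
    | nil => cases bs <;> simp_all [dot]
    | cons a as ih =>
      cases bs with
      | nil => simp at h
      | cons b bs =>
        intro P Q
        simp only [List.foldl_cons]
        rw [ih (by simpa using h), h1]
        simp only [dot]; ring
  simpa [dot, tensor] using h2 [] []

/-- This is what makes the power of a linear form linear in the features: `⟨u^{⊗r}, x^{⊗r}⟩ = ⟨u, x⟩
^ r`. -/
theorem dot_tpow {as : List ℝ} {bs : List Bool} (h : as.length = bs.length) (r : ℕ) :
    dot (tpow (· * ·) 1 as r) (tpow (· && ·) true bs r) = dot as bs ^ r := by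
  induction r with
  | zero => simp [tpow, dot]
  | succ r ih =>
    have hl : (tpow (· * ·) 1 as r).length = (tpow (· && ·) true bs r).length := by
      rw [length_tpow, length_tpow, h]
    rw [tpow, tpow, Function.iterate_succ_apply', Function.iterate_succ_apply', ← tpow, ← tpow,
      dot_tensor h hl, ih, pow_succ']

/-! ### Binary counters -/

/-- The `m` lowest bits of a number, least significant bit first. -/
def bitList : ℕ → ℕ → List Bool
  | 0, _ => []
  | m + 1, l => decide (l % 2 = 1) :: bitList m (l / 2)

/-- The list `c, 2c, 4c, …` of length `m`. -/
def weights : ℕ → ℝ → List ℝ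
  | 0, _ => []
  | m + 1, c => c :: weights m (2 * c)

theorem length_bitList (m l : ℕ) : (bitList m l).length = m := by
  induction m generalizing l <;> simp_all [bitList]

theorem length_weights (m : ℕ) (c : ℝ) : (weights m c).length = m := by
  induction m generalizing c <;> simp_all [weights]

/-- The counter is a linear function of its binary digits, so `m` feature bits suffice for `2 ^ m`
time steps. -/
theorem dot_weights {m l : ℕ} (c : ℝ) (hl : l < 2 ^ m) :
    dot (weights m c) (bitList m l) = c * l := by
  induction m generalizing c l with
  | zero => simp_all [dot, weights, bitList]
  | succ m ih =>
    rw [weights, bitList, dot, ih _ (by omega)]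
    have h : (l : ℝ) = (l % 2 : ℕ) + 2 * (l / 2 : ℕ) := by exact_mod_cast (Nat.mod_add_div l 2).symm
    rcases Nat.mod_two_eq_zero_or_one l with h2 | h2
    · rw [h, h2]; simp; ring
    · rw [h, h2]; simp; ring

theorem bitList_injOn {m l l' : ℕ} (hl : l < 2 ^ m) (hl' : l' < 2 ^ m)
    (h : bitList m l = bitList m l') : l = l' := by
  have := dot_weights 1 hl
  rw [h, dot_weights 1 hl'] at this
  simpa using this.symm

/-! ### Bernoulli rewards -/

/-- The distribution on `{0, 1}` with the probability `x` of `1`, for `x ≤ 1`. -/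
noncomputable def bern (x : ℝ≥0∞) : PMF ℚ :=
  PMF.ofFinset (fun q => if q = 1 then min x 1 else if q = 0 then 1 - min x 1 else 0) {0, 1}
    (by simp [tsub_add_cancel_of_le (min_le_right x 1)])
    (by intro q hq; simp at hq; simp [hq.1, hq.2])

theorem bern_apply (x : ℝ≥0∞) (q : ℚ) :
    bern x q = if q = 1 then min x 1 else if q = 0 then 1 - min x 1 else 0 := rfl

theorem mem_support_bern {x : ℝ≥0∞} {q : ℚ} (h : q ∈ (bern x).support) : q = 0 ∨ q = 1 := by
  rw [PMF.mem_support_iff, bern_apply] at h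
  by_contra! h'
  simp [h'.1, h'.2] at h

theorem expect_bern {x : ℝ} (h0 : 0 ≤ x) (h1 : x ≤ 1) : expect (bern (ENNReal.ofReal x)) = x := by
  rw [expect, tsum_eq_single 1]
  · simp [bern_apply, h1, h0]
  · intro q hq
    by_cases h : q = 0 <;> simp [bern_apply, hq, h]

namespace MDP

variable {k : ℕ} {M : MDP k} {π : M.Policy}

theorem returnDist_none (n : ℕ) : M.returnDist π n none = PMF.pure 0 := by cases n <;> rfl

theorem returnDist_of_none {n : ℕ} {s : M.State} (h : M.trans s (π s) = none) :
    M.returnDist π (n + 1) (some s) = M.reward s (π s) := by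
  rw [returnDist, h]
  simp [returnDist_none, PMF.pure_map]

theorem returnDist_of_some {n : ℕ} {s s' : M.State} (h : M.trans s (π s) = some s')
    (h' : M.reward s (π s) = PMF.pure 0) :
    M.returnDist π (n + 1) (some s) = M.returnDist π n (some s') := by
  rw [returnDist, h, h', PMF.pure_bind]
  simp only [zero_add]
  exact PMF.map_id _

theorem Q_of_none {s : M.State} {a : Fin k} (h : M.trans s a = none) :
    M.Q π s a = expect (M.reward s a) := by
  rw [Q, h]
  simp [returnDist_none, PMF.pure_map]

theorem Q_of_some {s s' : M.State} {a : Fin k} (h : M.trans s a = some s')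
    (h' : M.reward s a = PMF.pure 0) : M.Q π s a = M.V π s' := by
  rw [Q, h, h', PMF.pure_bind]
  simp only [zero_add]
  exact congrArg expect (PMF.map_id _)

end MDP

/-! ### The decision process of a formula -/

namespace Game

variable {v : ℕ} (φ : Formula v) (m r d : ℕ) (w₀ : Fin v → Bool)

/-- States: a counter below `2 ^ m`, and an assignment. -/
abbrev State (m v : ℕ) : Type := Fin (2 ^ m) × (Fin v → Bool)

/-- The first clause that is false under `w`. -/
def firstUnsat (w : Fin v → Bool) : Option (Clause v) :=
  φ.find? fun c => decide (∀ i, w (c i).1 ≠ (c i).2)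

/-- Change the value of the variable `i`. -/
def flipAt (w : Fin v → Bool) (i : Fin v) : Fin v → Bool := Function.update w i (!w i)

/-- In the state `(l, w)`, the action `a` flips the variable of the `a`-th literal of the first
clause violated by `w`. The game ends if there is no such clause, or no time left. -/
def next (s : State m v) (a : Fin 3) : Option (State m v) :=
  match firstUnsat φ s.2 with
  | none => none
  | some c => if h : (s.1 : ℕ) + 1 < 2 ^ m then
      some (⟨(s.1 : ℕ) + 1, h⟩, flipAt s.2 (c a).1) else none

/-- The base of the power `value`. -/
noncomputable def base (s : State m v) : ℝ :=
  (2 ^ m + v - (s.1 : ℕ) - hammingDist s.2 w₀) / (2 ^ m + v)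

/-- The optimal value of a state, if `w₀` satisfies the formula. -/
noncomputable def value (s : State m v) : ℝ := base m w₀ s ^ r

/-- The name of a state. -/
def name (s : State m v) : List Bool := bitList m s.1 ++ List.ofFn s.2

/-- The features of a state. -/
def feat (s : State m v) (i : Fin d) : ℚ :=
  if (tpow (· && ·) true (true :: name m s) r).getD i false then 1 else 0

variable {m}

theorem firstUnsat_eq_none {w : Fin v → Bool} : firstUnsat φ w = none ↔ Satisfies w φ := by
  simp [firstUnsat, List.find?_eq_none, Satisfies]

variable {φ}

theorem firstUnsat_eq_some {w : Fin v → Bool} {c : Clause v} (h : firstUnsat φ w = some c) :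
    c ∈ φ ∧ ∀ i, w (c i).1 ≠ (c i).2 :=
  ⟨List.mem_of_find?_eq_some h, by simpa using List.find?_some h⟩

theorem next_eq_some {s s' : State m v} {a : Fin 3} (h : next φ m s a = some s') :
    ∃ c, firstUnsat φ s.2 = some c ∧ (s'.1 : ℕ) = s.1 + 1 ∧ s'.2 = flipAt s.2 (c a).1 := by
  unfold next at h
  split at h
  · simp at h
  · rename_i c hc
    split at h
    · simp only [Option.some.injEq] at h
      subst h
      exact ⟨c, hc, rfl, rfl⟩
    · simp at h

theorem next_eq_none {s : State m v} {a : Fin 3} :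
    next φ m s a = none ↔ Satisfies s.2 φ ∨ (s.1 : ℕ) + 1 = 2 ^ m := by
  have hs := s.1.2
  unfold next
  split
  · rename_i h; simp [(firstUnsat_eq_none φ).1 h]
  · rename_i c h
    have : ¬ Satisfies s.2 φ := fun h' => by simp [(firstUnsat_eq_none φ).2 h'] at h
    split <;> simp [this] <;> omega

/-- The counter measures elapsed time, which gives the horizon `2 ^ m`. -/
theorem iterate_next {π : State m v → Fin 3} (t : ℕ) (s s' : State m v)
    (h : (fun o : Option (State m v) => o.bind fun s => next φ m s (π s))^[t] (some s) = some s') :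
    (s'.1 : ℕ) = s.1 + t := by
  induction t generalizing s' with
  | zero => simp at h; simp [h]
  | succ t ih =>
    rw [Function.iterate_succ_apply'] at h
    obtain ⟨s₁, h1, h2⟩ := Option.bind_eq_some_iff.1 h
    obtain ⟨c, -, h3, -⟩ := next_eq_some h2
    rw [h3, ih s₁ h1, add_assoc]

theorem name_injective : Function.Injective (name m (v := v)) := by
  rintro ⟨l, w⟩ ⟨l', w'⟩ h
  obtain ⟨h1, h2⟩ := List.append_inj h (by simp [length_bitList])
  exact Prod.ext (Fin.ext (bitList_injOn l.2 l'.2 h1)) (List.ofFn_injective h2)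

theorem length_name (s : State m v) : (name m s).length = m + v := by
  simp [name, length_bitList]

variable (φ m)

/-- The decision process of a formula. -/
noncomputable def mdp : FeaturedMDP 3 d where
  State := State m v
  start := (⟨0, by positivity⟩, fun _ => false)
  trans := next φ m
  reward s a := if next φ m s a = none then bern (ENNReal.ofReal (value m r w₀ s)) else PMF.pure 0
  reward_mem s a x hx := by
    split_ifs at hx
    · rcases mem_support_bern hx with rfl | rfl <;> simp
    · simp at hx; simp [hx]
  horizon := 2 ^ m
  ends π s := by
    by_contra h
    obtain ⟨s', h'⟩ := Option.ne_none_iff_exists'.1 h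
    have := iterate_next _ _ _ h'
    have := s'.1.2
    omega
  featS := feat m r d
  featSA s a := match next φ m s a with
    | none => feat m r d s
    | some s' => feat m r d s'
  code := name m
  code_injective := name_injective

/-! ### Optimal values of the game. -/

variable {φ m}

theorem hammingDist_flipAt_le (w : Fin v → Bool) (i : Fin v) :
    hammingDist w w₀ ≤ hammingDist (flipAt w i) w₀ + 1 := by
  have h : hammingDist w (flipAt w i) ≤ 1 := by
    refine (Finset.card_le_card (t := {i}) fun j hj => ?_).trans (by simp)
    by_contra hji
    rw [Finset.mem_singleton] at hji
    rw [Finset.mem_filter, flipAt, Function.update_of_ne hji] at hj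
    exact hj.2 rfl
  have := hammingDist_triangle w (flipAt w i) w₀
  omega

theorem hammingDist_flipAt {w : Fin v → Bool} {i : Fin v} (hi : w i ≠ w₀ i) :
    hammingDist w w₀ = hammingDist (flipAt w i) w₀ + 1 := by
  have h : (Finset.univ.filter fun j => flipAt w i j ≠ w₀ j) =
      (Finset.univ.filter fun j => w j ≠ w₀ j).erase i := by
    ext j
    rw [Finset.mem_erase, Finset.mem_filter, Finset.mem_filter, flipAt]
    rcases eq_or_ne j i with rfl | hj
    · rw [Function.update_self]
      revert hi
      cases w j <;> cases w₀ j <;> simp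
    · rw [Function.update_of_ne hj]
      simp [hj]
  rw [hammingDist, hammingDist, h, Finset.card_erase_of_mem (by simp [hi])]
  have : 0 < (Finset.univ.filter fun j => w j ≠ w₀ j).card := Finset.card_pos.2 ⟨i, by simp [hi]⟩
  omega

theorem base_mem (s : State m v) : 0 ≤ base m w₀ s ∧ base m w₀ s ≤ 1 := by
  have h1 : ((s.1 : ℕ) : ℝ) ≤ 2 ^ m := by exact_mod_cast s.1.2.le
  have h2 : (hammingDist s.2 w₀ : ℝ) ≤ v := by
    exact_mod_cast (hammingDist_le_card_fintype).trans_eq (Fintype.card_fin v)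
  have h3 : (0 : ℝ) < 2 ^ m + v := by positivity
  constructor
  · exact div_nonneg (by linarith) h3.le
  · rw [base, div_le_one h3]
    have : (0 : ℝ) ≤ (s.1 : ℕ) := Nat.cast_nonneg _
    have : (0 : ℝ) ≤ hammingDist s.2 w₀ := Nat.cast_nonneg _
    linarith

theorem value_nonneg (s : State m v) : 0 ≤ value m r w₀ s := pow_nonneg (base_mem w₀ s).1 _

theorem value_le_one (s : State m v) : value m r w₀ s ≤ 1 :=
  pow_le_one₀ (base_mem w₀ s).1 (base_mem w₀ s).2

/-- The counter grows by one and a single flip lowers the distance to `w₀` by at most one. -/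
theorem value_next_le {s s' : State m v} {a : Fin 3} (h : next φ m s a = some s') :
    value m r w₀ s' ≤ value m r w₀ s := by
  obtain ⟨c, -, h1, h2⟩ := next_eq_some h
  refine pow_le_pow_left₀ (base_mem w₀ s').1 ?_ _
  have := hammingDist_flipAt_le w₀ s.2 (c a).1
  rw [← h2] at this
  rw [base, base, h1]
  have : (hammingDist s.2 w₀ : ℝ) ≤ hammingDist s'.2 w₀ + 1 := by exact_mod_cast this
  refine div_le_div_of_nonneg_right ?_ (by positivity)
  push_cast
  linarith

/-- In a violated clause all three literals are false under `w`, and one of them is true under `w₀`;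
its variable is one where `w` and `w₀` differ. Flipping it lowers the distance by exactly the amount
by which the counter grows. -/
theorem exists_value_next_eq (hw₀ : Satisfies w₀ φ) (s : State m v) :
    ∃ a, ∀ s', next φ m s a = some s' → value m r w₀ s' = value m r w₀ s := by
  rcases hc : firstUnsat φ s.2 with _ | c
  · exact ⟨0, fun s' h => by simp [next, hc] at h⟩
  · obtain ⟨hcφ, hcu⟩ := firstUnsat_eq_some hc
    obtain ⟨a, ha⟩ := hw₀ c hcφ
    refine ⟨a, fun s' h => ?_⟩
    obtain ⟨c', hc', h1, h2⟩ := next_eq_some h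
    obtain rfl : c = c' := by simpa [hc] using hc'
    have h3 := hammingDist_flipAt w₀ (w := s.2) (i := (c a).1) (ha ▸ hcu a)
    rw [← h2] at h3
    rw [value, value, base, base, h1, h3]
    push_cast
    congr 2
    ring

theorem expect_returnDist_none {π : State m v → Fin 3} (n : ℕ) {s : State m v}
    (h : next φ m s (π s) = none) :
    expect ((mdp φ m r d w₀).returnDist π (n + 1) (some s)) = value m r w₀ s := by
  have h2 : (mdp φ m r d w₀).reward s (π s) = bern (ENNReal.ofReal (value m r w₀ s)) := by
    simp [mdp, h]
  refine (congrArg expect ((MDP.returnDist_of_none h).trans h2)).trans ?_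
  exact expect_bern (value_nonneg ..) (value_le_one ..)

theorem returnDist_some {π : State m v → Fin 3} (n : ℕ) {s s' : State m v}
    (h : next φ m s (π s) = some s') :
    (mdp φ m r d w₀).returnDist π (n + 1) (some s) = (mdp φ m r d w₀).returnDist π n (some s') :=
  MDP.returnDist_of_some h (by simp [mdp, h])

/-- The hypothesis on `n` says that the allotted actions last until the counter runs out, so the
final reward is always reached and the truncated return zero never occurs. -/
theorem expect_returnDist_le (π : State m v → Fin 3) (n : ℕ) (s : State m v)
    (hn : 2 ^ m ≤ (s.1 : ℕ) + n) :
    expect ((mdp φ m r d w₀).returnDist π n (some s)) ≤ value m r w₀ s := by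
  induction n generalizing s with
  | zero => have := s.1.2; omega
  | succ n ih =>
    rcases h : next φ m s (π s) with _ | s'
    · rw [expect_returnDist_none r d w₀ n h]
    · rw [returnDist_some r d w₀ n h]
      obtain ⟨-, -, h1, -⟩ := next_eq_some h
      exact (ih s' (by omega)).trans (value_next_le r w₀ h)

/-- Choosing in each state the action of `exists_value_next_eq` is a stationary policy along which
the value is constant, so the upper bound `expect_returnDist_le` is attained in all states at once.
-/
theorem exists_policy (hw₀ : Satisfies w₀ φ) : ∃ π : State m v → Fin 3,
    ∀ (n : ℕ) (s : State m v), 2 ^ m ≤ (s.1 : ℕ) + n →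
      expect ((mdp φ m r d w₀).returnDist π n (some s)) = value m r w₀ s := by
  choose π hπ using exists_value_next_eq (m := m) r w₀ hw₀
  refine ⟨π, fun n => ?_⟩
  induction n with
  | zero => intro s hn; have := s.1.2; omega
  | succ n ih =>
    intro s hn
    rcases h : next φ m s (π s) with _ | s'
    · rw [expect_returnDist_none r d w₀ n h]
    · rw [returnDist_some r d w₀ n h]
      obtain ⟨-, -, h1, -⟩ := next_eq_some h
      rw [ih s' (by omega), hπ s s' h]

theorem Vstar_eq (hw₀ : Satisfies w₀ φ) (s : State m v) :
    (mdp φ m r d w₀).Vstar s = value m r w₀ s := by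
  have hle : ∀ π : State m v → Fin 3, (mdp φ m r d w₀).V π s ≤ value m r w₀ s := fun π =>
    expect_returnDist_le r d w₀ π _ s (Nat.le_add_left _ _)
  obtain ⟨π, hπ⟩ := exists_policy (m := m) r d w₀ hw₀
  have : Nonempty (mdp φ m r d w₀).Policy := ⟨π⟩
  refine le_antisymm (ciSup_le hle) ((hπ _ s (Nat.le_add_left _ _)).ge.trans ?_)
  refine le_ciSup (f := fun π => (mdp φ m r d w₀).V π s) ⟨value m r w₀ s, ?_⟩ π
  rintro _ ⟨π, rfl⟩
  exact hle π

/-- Intermediate rewards vanish, so an action is worth as much as its successor; a terminating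
action pays the mean of the Bernoulli reward. Accordingly the features of a pair are those of the
successor, or of the state itself. -/
theorem Qstar_eq (hw₀ : Satisfies w₀ φ) (s : State m v) (a : Fin 3) :
    (mdp φ m r d w₀).Qstar s a = match next φ m s a with
      | none => value m r w₀ s
      | some s' => value m r w₀ s' := by
  have : Nonempty (mdp φ m r d w₀).Policy := ⟨fun _ => 0⟩
  rcases h : next φ m s a with _ | s'
  · have h2 : (mdp φ m r d w₀).reward s a = bern (ENNReal.ofReal (value m r w₀ s)) := by
      simp [mdp, h]
    have : ∀ π, (mdp φ m r d w₀).Q π s a = value m r w₀ s := fun π =>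
      (MDP.Q_of_none h).trans ((congrArg expect h2).trans
        (expect_bern (value_nonneg ..) (value_le_one ..)))
    simp [MDP.Qstar, this]
  · have : ∀ π, (mdp φ m r d w₀).Q π s a = (mdp φ m r d w₀).V π s' := fun π =>
      MDP.Q_of_some h (by simp [mdp, h])
    simp only [MDP.Qstar, this]
    exact Vstar_eq r d w₀ hw₀ s'

/-! ### Linearity in the tensor features, encoding sizes, and values at the two ends of the counter.
-/

/-- The linear form with value `base`. -/
noncomputable def coeff (m : ℕ) (w₀ : Fin v → Bool) : List ℝ :=
  ((2 ^ m + v - ∑ i, if w₀ i then 1 else 0) / (2 ^ m + v)) ::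
    (weights m (-1 / (2 ^ m + v)) ++
      List.ofFn fun i => (if w₀ i then 1 else -1) / (2 ^ m + v : ℝ))

/-- The distance to a fixed point is affine in the bits of `w`: a coordinate contributes the bit
itself where `w₀` is false, and one minus the bit where `w₀` is true. -/
theorem hammingDist_eq_sum (w : Fin v → Bool) : (hammingDist w w₀ : ℝ) =
    (∑ i, if w₀ i then 1 else 0) - ∑ i, if w i then (if w₀ i then 1 else -1) else 0 := by
  rw [hammingDist, Finset.card_filter, ← Finset.sum_sub_distrib]
  push_cast
  refine Finset.sum_congr rfl fun i _ => ?_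
  cases w i <;> cases w₀ i <;> simp

theorem dot_coeff (s : State m v) : dot (coeff m w₀) (true :: name m s) = base m w₀ s := by
  rw [coeff, dot, name, dot_append (by simp [length_weights, length_bitList]),
    dot_weights _ s.1.2, dot_ofFn, base, hammingDist_eq_sum]
  have : (∑ i, if s.2 i then (if w₀ i then (1 : ℝ) else -1) / (2 ^ m + v) else 0) =
      (∑ i, if s.2 i then (if w₀ i then (1 : ℝ) else -1) else 0) / (2 ^ m + v) := by
    rw [Finset.sum_div]
    refine Finset.sum_congr rfl fun i _ => ?_
    split <;> simp
  rw [this]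
  simp only [if_true]
  ring

theorem sum_feat (hd : (1 + m + v) ^ r ≤ d) (s : State m v) :
    ∑ i : Fin d, (tpow (· * ·) 1 (coeff m w₀) r).getD i 0 * (feat m r d s i : ℝ) = value m r w₀ s := by
  have hlen : (coeff m w₀).length = (true :: name m s).length := by
    simp [coeff, length_weights, length_name]
  rw [value, ← dot_coeff, ← dot_tpow hlen, ← sum_getD_mul (d := d)]
  · refine Finset.sum_congr rfl fun i _ => ?_
    congr 1
    rw [feat]
    split <;> simp
  · rw [length_tpow, hlen, List.length_cons, length_name]
    convert hd using 2; omega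

/-- The unknown `w₀` enters only through the coefficient vector, the tensor power of `coeff m w₀`,
which the algorithm never sees. -/
theorem isLinear (hd : (1 + m + v) ^ r ≤ d) (hw₀ : Satisfies w₀ φ) :
    (mdp φ m r d w₀).IsLinear := by
  refine ⟨fun i => (tpow (· * ·) 1 (coeff m w₀) r).getD i 0, fun s => ?_, fun s a => ?_⟩
  · exact (Vstar_eq r d w₀ hw₀ s).trans (sum_feat r d w₀ hd s).symm
  · refine (Qstar_eq r d w₀ hw₀ s a).trans ?_
    have h : (mdp φ m r d w₀).featSA s a = match next φ m s a with
      | none => feat m r d s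
      | some s' => feat m r d s' := rfl
    rw [h]
    cases next φ m s a with
    | none => exact (sum_feat r d w₀ hd s).symm
    | some s' => exact (sum_feat r d w₀ hd s').symm

theorem sizeBound {B : ℕ} (hB : 2 ≤ B) (hB' : m + v ≤ B) : (mdp φ m r d w₀).SizeBound B := by
  have h0 : bitSize 0 ≤ B := by
    have : bitSize 0 = 1 := by simp [bitSize]
    omega
  have h1 : bitSize 1 ≤ B := by
    have : bitSize 1 = 2 := by simp [bitSize]
    omega
  have hf : ∀ s i, bitSize (feat m r d (v := v) s i) ≤ B := by
    intro s i
    rw [feat]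
    split <;> assumption
  refine ⟨fun s => (length_name s).trans_le hB', fun s a x hx => ?_, hf, fun s a i => ?_⟩
  · simp only [mdp] at hx
    split_ifs at hx
    · rcases mem_support_bern hx with rfl | rfl <;> assumption
    · simp at hx; rwa [hx]
  · simp only [mdp]
    cases next φ m s a <;> exact hf _ _

/-- Used twice: it bounds the reward that the simulation replaces by zero, and the return of a
policy that meets no satisfying assignment. -/
theorem value_last_le {s : State m v} (h : (s.1 : ℕ) + 1 = 2 ^ m) :
    value m r w₀ s ≤ ((1 + v) / 2 ^ m) ^ r := by
  refine pow_le_pow_left₀ (base_mem w₀ s).1 ?_ _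
  have h' : ((s.1 : ℕ) : ℝ) + 1 = 2 ^ m := by exact_mod_cast h
  have h2 : (0 : ℝ) ≤ hammingDist s.2 w₀ := Nat.cast_nonneg _
  have h3 : (0 : ℝ) ≤ v := Nat.cast_nonneg _
  rw [base]
  gcongr <;> linarith

theorem value_start_ge : 1 - r * v / 2 ^ m ≤ value m r w₀ (mdp φ m r d w₀).start := by
  have h2 : (hammingDist (fun _ => false) w₀ : ℝ) ≤ v := by
    exact_mod_cast (hammingDist_le_card_fintype).trans_eq (Fintype.card_fin v)
  have h3 : (0 : ℝ) ≤ v := Nat.cast_nonneg _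
  have hb : 1 - v / 2 ^ m ≤ base m w₀ (mdp φ m r d w₀).start := by
    simp only [base, mdp]
    rw [le_div_iff₀ (by positivity), sub_mul, div_mul_eq_mul_div, one_mul]
    have : (v : ℝ) ≤ v * (2 ^ m + v) / 2 ^ m := by
      rw [le_div_iff₀ (by positivity)]; nlinarith
    push_cast
    linarith
  have h1 := base_mem w₀ (mdp φ m r d w₀).start
  -- Bernoulli's inequality, applied to a base of at least `1 - v / 2 ^ m`.
  have := one_add_mul_le_pow (a := base m w₀ (mdp φ m r d w₀).start - 1) (by linarith) r
  rw [add_sub_cancel] at this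
  refine le_trans ?_ this
  have : (r : ℝ) * (base m w₀ (mdp φ m r d w₀).start - 1) ≥ r * (- (v / 2 ^ m)) := by
    gcongr; linarith
  rw [mul_div_assoc]
  linarith

end Game

/-! ### Folds over encoded lists -/

namespace Data

theorem fold_ofList (g : Data → Data → Data) (l : List Data) (acc : Data) :
    fold g (ofList l) acc = l.foldl (fun a x => g x a) acc := by
  induction l generalizing acc <;> simp_all [ofList, fold]

theorem fold_ofBits (g : Data → Data → Data) (l : List Bool) (acc : Data) :
    fold g (ofBits l) acc = l.foldl (fun a x => g (ofBool x) a) acc := by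
  rw [ofBits, fold_ofList, List.foldl_map]

theorem fold_unary (g : Data → Data → Data) (n : ℕ) (acc : Data) :
    fold g (unary n) acc = (g nil)^[n] acc := by
  induction n generalizing acc with
  | zero => rfl
  | succ n ih => exact ih _

theorem len_ofList (l : List Data) : (ofList l).len = l.length := by
  induction l <;> simp_all [ofList, len]

theorem len_ofBits (l : List Bool) : (ofBits l).len = l.length := by simp [ofBits, len_ofList]

theorem len_unary (n : ℕ) : (unary n).len = n := by simp [unary, len_ofList]

theorem FoldAll.of_forall {g : Data → Data → Data} {P : Data → Data → Prop}
    (h : ∀ x acc, P x acc) (l acc : Data) : FoldAll g P l acc := by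
  induction l generalizing acc with
  | nil => trivial
  | cons x xs _ ih => exact ⟨h _ _, ih _⟩

theorem FoldAll.ofList {g : Data → Data → Data} {P : Data → Data → Prop} {l : List Data}
    (h : ∀ x ∈ l, ∀ acc, P x acc) (acc : Data) : FoldAll g P (ofList l) acc := by
  induction l generalizing acc with
  | nil => trivial
  | cons x xs ih =>
    exact ⟨h x (by simp) _, ih (fun y hy => h y (by simp [hy])) _⟩

theorem FoldAll.unary {g : Data → Data → Data} {P : Data → Data → Prop} {n : ℕ} {acc : Data}
    (h : ∀ i < n, P nil ((g nil)^[i] acc)) : FoldAll g P (unary n) acc := by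
  induction n generalizing acc with
  | zero => trivial
  | succ n ih => exact ⟨h 0 (by omega), ih fun i hi => h (i + 1) (by omega)⟩

theorem ofBits_cons (b : Bool) (l : List Bool) : ofBits (b :: l) = cons (ofBool b) (ofBits l) := rfl

theorem ofBits_nil : ofBits [] = nil := rfl

theorem unary_eq_ofBits (n : ℕ) : unary n = ofBits (List.replicate n false) := by
  simp [unary, ofBits, ofBool]

theorem iterate_tl_nil (n : ℕ) : tl^[n] nil = nil := by
  induction n <;> simp_all [tl]

theorem iterate_tl_ofBits (n : ℕ) (l : List Bool) : tl^[n] (ofBits l) = ofBits (l.drop n) := by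
  induction n generalizing l with
  | zero => rfl
  | succ n ih =>
    cases l with
    | nil => simp [ofBits_nil, iterate_tl_nil]
    | cons b l => simp [ofBits_cons, tl, ih]

theorem hd_ofBits (l : List Bool) : (ofBits l).hd = ofBool (l.headD false) := by
  cases l <;> rfl

end Data

open Data

/-! ### Library of terms -/

namespace Fn

/-- The `n`-th tail of the environment. -/
def tlE : ℕ → Expr
  | 0 => .var 0
  | n + 1 => .tl (tlE n)

/-- The `n`-th variable of the environment. -/
def V (n : ℕ) : Expr := .hd (tlE n)

/-- The bit `true`. -/
def tt : Expr := .cons .nil .nil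

theorem ev_V_zero (a x : Data) : (V 0).ev (.cons a x) = a := rfl

theorem ev_tlE_succ (n : ℕ) (a x : Data) : (tlE (n + 1)).ev (.cons a x) = (tlE n).ev x := by
  induction n with
  | zero => rfl
  | succ n ih => exact congrArg Data.tl ih

theorem ev_tlE_zero (x : Data) : (tlE 0).ev x = x := rfl

theorem ev_V_succ (n : ℕ) (a x : Data) : (V (n + 1)).ev (.cons a x) = (V n).ev x :=
  congrArg Data.hd (ev_tlE_succ n a x)

theorem ev_cons (a b : Expr) (x : Data) : (Expr.cons a b).ev x = .cons (a.ev x) (b.ev x) := rfl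

theorem ev_hd (a : Expr) (x : Data) : (Expr.hd a).ev x = (a.ev x).hd := rfl

theorem ev_tl (a : Expr) (x : Data) : (Expr.tl a).ev x = (a.ev x).tl := rfl

theorem ev_nil (x : Data) : Expr.nil.ev x = .nil := rfl

theorem ev_tt (x : Data) : tt.ev x = ofBool true := rfl

theorem ev_var (n : ℕ) (x : Data) : (Expr.var n).ev x = x := rfl

theorem hd_cons (a b : Data) : (Data.cons a b).hd = a := rfl

theorem tl_cons (a b : Data) : (Data.cons a b).tl = b := rfl

theorem eval_ite (c f g : Fn) (x : Data) [Decidable (c.eval x = .nil)] :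
    (ite c f g).eval x = if c.eval x = .nil then g.eval x else f.eval x := by
  by_cases h : c.eval x = .nil
  · simp [eval, h]
  · rw [if_neg h]
    obtain ⟨a, b, h'⟩ : ∃ a b, c.eval x = .cons a b := by
      cases h' : c.eval x with
      | nil => exact absurd h' h
      | cons a b => exact ⟨a, b, rfl⟩
    simp [eval, h']

theorem ok_ite (L : ℕ) (c f g : Fn) (x : Data) : (ite c f g).Ok L x ↔
    c.Ok L x ∧ (c.eval x = .nil → g.Ok L x) ∧ (c.eval x ≠ .nil → f.Ok L x) := by
  cases h : c.eval x <;> simp [Ok, h]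

theorem ofBool_eq_nil (b : Bool) : ofBool b = .nil ↔ b = false := by cases b <;> simp [ofBool]

/-- Rest of a list after its first elements; the number of these is given in unary. -/
def dropF : Fn := fold (ex (V 0)) (ex (V 1)) (ex (.tl (V 1)))

theorem eval_dropF (n : ℕ) (l z : Data) :
    dropF.eval (.cons (unary n) (.cons l z)) = Data.tl^[n] l := by
  simp only [dropF, eval, fold_unary, ev_V_zero, ev_V_succ, ev_tl]

/-- Concatenation of the reversal of a list with another list. -/
def revAppF : Fn := fold (ex (V 0)) (ex (V 1)) (ex (.cons (V 0) (V 1)))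

theorem eval_revAppF (l l' : List Data) (z : Data) :
    revAppF.eval (.cons (ofList l) (.cons (ofList l') z)) = ofList (l.reverse ++ l') := by
  simp only [revAppF, eval, fold_ofList, ev_V_zero, ev_V_succ, ev_cons]
  induction l generalizing l' with
  | nil => rfl
  | cons x l ih => simpa [ofList] using ih (x :: l')

theorem eval_revAppF_bits (l l' : List Bool) (z : Data) :
    revAppF.eval (.cons (ofBits l) (.cons (ofBits l') z)) = ofBits (l.reverse ++ l') := by
  simp [ofBits, eval_revAppF]

theorem eval_revAppF_unary (m n : ℕ) (z : Data) :
    revAppF.eval (.cons (unary m) (.cons (unary n) z)) = unary (m + n) := by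
  simp [unary_eq_ofBits, eval_revAppF_bits]

/-- Value of a literal. -/
def litF : Fn := lt (comp (ex (.cons (.tl (V 1)) (.cons (V 0) .nil))) dropF)
  (ite (ex (.hd (V 0))) (ite (ex (.hd (V 2))) (ex tt) (ex .nil))
    (ite (ex (.hd (V 2))) (ex .nil) (ex tt)))

theorem getD_ofFn {v : ℕ} (w : Fin v → Bool) (i : Fin v) :
    ((List.ofFn w).drop i).headD false = w i := by
  rw [List.headD_eq_head?_getD, List.head?_drop]
  simp

theorem eval_litF {v : ℕ} (w : Fin v → Bool) (l : Literal v) (z : Data) :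
    litF.eval (.cons (ofBits (List.ofFn w)) (.cons (literalData l) z)) =
      ofBool (decide (w l.1 = l.2)) := by
  have : (Data.tl^[(l.1 : ℕ)] (ofBits (List.ofFn w))).hd = ofBool (w l.1) := by
    rw [iterate_tl_ofBits, hd_ofBits, getD_ofFn]
  simp only [litF, eval, literalData, ev_V_zero, ev_V_succ, ev_cons, ev_tl, ev_hd, ev_nil, hd_cons,
    tl_cons, eval_dropF, this, ev_tt]
  cases w l.1 <;> cases l.2 <;> rfl

/-- A clause as a tree. -/
def clauseData {v : ℕ} (c : Clause v) : Data := ofList (List.ofFn fun i => literalData (c i))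

theorem clauseData_eq {v : ℕ} (c : Clause v) : clauseData c = .cons (literalData (c 0))
    (.cons (literalData (c 1)) (.cons (literalData (c 2)) .nil)) := by
  simp [clauseData, List.ofFn_succ, ofList]

/-- Value of a clause. -/
def clauseF : Fn := fold (ex (V 1)) (ex .nil)
  (ite (ex (V 1)) (ex tt) (comp (ex (.cons (V 2) (.cons (V 0) .nil))) litF))

theorem eval_clauseF {v : ℕ} (w : Fin v → Bool) (c : Clause v) (z : Data) :
    clauseF.eval (.cons (ofBits (List.ofFn w)) (.cons (clauseData c) z)) =
      ofBool (!decide (∀ i, w (c i).1 ≠ (c i).2)) := by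
  simp only [clauseF, eval, clauseData_eq, Data.fold, ev_V_zero, ev_V_succ, ev_cons, ev_nil,
    eval_litF, ev_tt]
  by_cases h0 : w (c 0).1 = (c 0).2 <;> by_cases h1 : w (c 1).1 = (c 1).2 <;>
    by_cases h2 : w (c 2).1 = (c 2).2 <;> simp [h0, h1, h2, ofBool, Fin.forall_fin_succ]

/-- The clauses of a formula as a tree. -/
def clausesData {v : ℕ} (φ : Formula v) : Data := ofList (φ.map clauseData)

/-- The first violated clause of a formula, or `nil`. -/
def unsatF : Fn := fold (ex (V 1)) (ex .nil) (ite (ex (V 1)) (ex (V 1))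
  (ite (comp (ex (.cons (V 2) (.cons (V 0) .nil))) clauseF) (ex .nil) (ex (V 0))))

theorem eval_unsatF {v : ℕ} (w : Fin v → Bool) (φ : Formula v) (z : Data) :
    unsatF.eval (.cons (ofBits (List.ofFn w)) (.cons (clausesData φ) z)) =
      match Game.firstUnsat φ w with
      | none => .nil
      | some c => clauseData c := by
  simp only [unsatF, eval, clausesData, fold_ofList, ev_V_zero, ev_V_succ, ev_cons, ev_nil,
    List.foldl_map, eval_clauseF]
  -- Once the accumulator holds a violated clause, the fold never changes it, so the first one wins.
  have h : ∀ (φ : Formula v) (a : Data), a ≠ .nil → List.foldl (fun a (c : Clause v) =>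
      match a with
      | nil => match ofBool (!decide (∀ i, w (c i).1 ≠ (c i).2)) with
        | nil => clauseData c
        | cons _ _ => nil
      | cons _ _ => a) a φ = a := by
    intro φ a ha
    induction φ with
    | nil => rfl
    | cons c φ ih =>
      cases a with
      | nil => exact absurd rfl ha
      | cons a b => simpa using ih
  induction φ with
  | nil => rfl
  | cons c φ ih =>
    rw [List.foldl_cons]
    by_cases hc : ∀ i, w (c i).1 ≠ (c i).2
    · have h1 : Game.firstUnsat (c :: φ) w = some c := by
        rw [Game.firstUnsat, List.find?_cons_of_pos (by simpa using hc)]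
      rw [h1]
      have hb : decide (∀ i, w (c i).1 ≠ (c i).2) = true := by simpa using hc
      rw [hb]
      exact h φ _ (by simp [clauseData_eq, ofBool])
    · have h1 : Game.firstUnsat (c :: φ) w = Game.firstUnsat φ w := by
        rw [Game.firstUnsat, List.find?_cons_of_neg (by simpa using hc)]; rfl
      rw [h1]
      simpa only [hc, decide_false, Bool.not_false, ofBool] using ih

/-- Test whether the first bits of a list are all `true`. -/
def lastF : Fn := comp (fold (ex (V 0)) (ex (.cons (V 1) tt))
  (ite (ex (.hd (.hd (V 1)))) (ex (.cons (.tl (.hd (V 1))) (.tl (V 1))))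
    (ex (.cons (.tl (.hd (V 1))) .nil)))) (ex (.tl (.var 0)))

/-- The counter stands at its last value exactly when its `m` bits are all true; the flag
accumulates their conjunction and the bits in `rest` are not inspected. -/
theorem eval_lastF {m l : ℕ} (hl : l < 2 ^ m) (rest : List Bool) (z : Data) :
    lastF.eval (.cons (unary m) (.cons (ofBits (bitList m l ++ rest)) z)) =
      ofBool (decide (l + 1 = 2 ^ m)) := by
  simp only [lastF, eval, fold_unary, ev_V_zero, ev_V_succ, ev_cons, ev_nil, ev_tl, ev_hd, ev_tt,
    ev_var]
  generalize hg : (fun acc : Data => match acc.hd.hd with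
    | .nil => Data.cons acc.hd.tl .nil
    | .cons _ _ => Data.cons acc.hd.tl acc.tl) = g
  have hgt : ∀ b l f, g (.cons (ofBits (b :: l)) f) =
      .cons (ofBits l) (if b then f else .nil) := by
    intro b l f
    subst hg
    cases b <;> rfl
  suffices ∀ b : Bool, g^[m] (.cons (ofBits (bitList m l ++ rest)) (ofBool b)) =
      .cons (ofBits rest) (ofBool (b && decide (l + 1 = 2 ^ m))) by rw [this]; simp [tl_cons]
  induction m generalizing l with
  | zero =>
    obtain rfl : l = 0 := by simpa using hl
    simp [bitList]
  | succ m ih =>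
    intro b
    have h1 : (if decide (l % 2 = 1) then ofBool b else .nil) = ofBool (b && decide (l % 2 = 1)) := by
      by_cases h : l % 2 = 1 <;> simp [h, ofBool]
    rw [Function.iterate_succ_apply, bitList, List.cons_append, hgt, h1, ih (by omega)]
    congr 2
    cases b
    · rfl
    · simp only [Bool.true_and, ← Bool.decide_and]
      congr 1
      rw [pow_succ]
      apply propext
      omega

/-- Negate the bit at a given position. -/
def flipF : Fn := lt (fold (ex (V 0)) (ex (.cons .nil (V 1)))
    (ex (.cons (.cons (.hd (.tl (V 1))) (.hd (V 1))) (.tl (.tl (V 1))))))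
  (ite (ex (.hd (.tl (V 0))))
    (comp (ex (.cons (.hd (V 0)) (.cons (.cons .nil (.tl (.tl (V 0)))) .nil))) revAppF)
    (comp (ex (.cons (.hd (V 0)) (.cons (.cons tt (.tl (.tl (V 0)))) .nil))) revAppF))

theorem eval_flipF (l l' : List Bool) (b : Bool) (z : Data) :
    flipF.eval (.cons (unary l.length) (.cons (ofBits (l ++ b :: l')) z)) =
      ofBits (l ++ (!b) :: l') := by
  simp only [flipF, eval, fold_unary, ev_V_zero, ev_V_succ, ev_cons, ev_nil, ev_tl, ev_hd, ev_tt]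
  -- The fold moves along the list like a zipper: a reversed prefix and the remaining bits, of which
  -- the first is the one to be negated.
  have h : ∀ (l pre rest : List Bool),
      (fun acc : Data => Data.cons (.cons acc.tl.hd acc.hd) acc.tl.tl)^[l.length]
        (.cons (ofBits pre) (ofBits (l ++ rest))) = .cons (ofBits (l.reverse ++ pre)) (ofBits rest) := by
    intro l
    induction l with
    | nil => intro pre rest; rfl
    | cons b l ih =>
      intro pre rest
      rw [List.length_cons, Function.iterate_succ_apply]
      exact (ih (b :: pre) rest).trans (by simp)
  have h1 := h l [] (b :: l')
  rw [ofBits_nil] at h1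
  rw [h1]
  simp only [ofBits_cons, hd_cons, tl_cons, List.append_nil]
  have h2 := fun b' => eval_revAppF_bits l.reverse (b' :: l') .nil
  simp only [ofBits_cons, List.reverse_reverse] at h2
  cases b
  · exact h2 true
  · exact h2 false

/-- Add one to a binary number. -/
def incF : Fn := comp (comp (fold (ex (V 0)) (ex (.cons tt .nil))
  (ite (ex (.hd (V 1)))
    (ite (ex (V 0)) (ex (.cons tt (.cons .nil (.tl (V 1)))))
      (ex (.cons .nil (.cons tt (.tl (V 1))))))
    (ex (.cons .nil (.cons (V 0) (.tl (V 1))))))) (ex (.cons (.tl (.var 0)) (.cons .nil .nil))))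
  revAppF

theorem eval_incF {m l : ℕ} (hl : l + 1 < 2 ^ m) (rest : List Bool) (z : Data) :
    incF.eval (.cons (ofBits (bitList m l ++ rest)) z) = ofBits (bitList m (l + 1) ++ rest) := by
  simp only [incF, eval, fold_ofBits, ev_V_zero, ev_V_succ, ev_cons, ev_nil, ev_tl, ev_hd, ev_tt,
    ev_var]
  generalize hg : (fun (a : Data) (x : Bool) => match a.hd with
    | .nil => Data.cons .nil (.cons (ofBool x) a.tl)
    | .cons _ _ => match ofBool x with
      | .nil => .cons .nil (.cons (ofBool true) a.tl)
      | .cons _ _ => .cons (ofBool true) (.cons .nil a.tl)) = g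
  -- The head of the accumulator is the carry. Without a carry bits are copied (`h0`). With a carry
  -- the counter is incremented and the carry is used up inside the first `m` bits, as `l + 1 < 2 ^
  -- m` (`h1`), so `rest` is copied.
  have h0 : ∀ (l out : List Bool), l.foldl g (.cons .nil (ofBits out)) =
      .cons .nil (ofBits (l.reverse ++ out)) := by
    intro l
    induction l with
    | nil => intro out; rfl
    | cons b l ih =>
      intro out
      have : g (.cons .nil (ofBits out)) b = .cons .nil (ofBits (b :: out)) := by subst hg; rfl
      rw [List.foldl_cons, this, ih]
      simp
  have h1 : ∀ (m l : ℕ) (out : List Bool), l + 1 < 2 ^ m →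
      (bitList m l).foldl g (.cons (ofBool true) (ofBits out)) =
        .cons .nil (ofBits ((bitList m (l + 1)).reverse ++ out)) := by
    intro m
    induction m with
    | zero => intro l out h; simp at h
    | succ m ih =>
      intro l out h
      rw [bitList, bitList, List.foldl_cons]
      rcases Nat.mod_two_eq_zero_or_one l with h2 | h2
      · have e1 : (l + 1) % 2 = 1 := by omega
        have e2 : (l + 1) / 2 = l / 2 := by omega
        have : g (.cons (ofBool true) (ofBits out)) (decide (l % 2 = 1)) =
            .cons .nil (ofBits (true :: out)) := by subst hg; rw [h2]; rfl
        rw [this, h0, e1, e2]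
        simp
      · have e1 : (l + 1) % 2 = 0 := by omega
        have e2 : (l + 1) / 2 = l / 2 + 1 := by omega
        have : g (.cons (ofBool true) (ofBits out)) (decide (l % 2 = 1)) =
            .cons (ofBool true) (ofBits (false :: out)) := by subst hg; rw [h2]; rfl
        rw [this, ih _ _ (by rw [pow_succ] at h; omega), e1, e2]
        simp
  have h2 := h1 m l [] hl
  rw [ofBits_nil] at h2
  rw [List.foldl_append, h2, h0]
  have h3 := eval_revAppF_bits (rest.reverse ++ (bitList m (l + 1)).reverse) [] .nil
  simpa [tl_cons, ofBits_nil] using h3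

/-- Flip the variable of a literal and increase the counter, from the literal, the state, two
arbitrary trees, and the length of the counter (in unary). -/
def moveF : Fn :=
  lt (comp (ex (.cons (.tl (V 0)) (.cons (V 4) .nil))) revAppF) <|
  lt (comp (ex (.cons (V 0) (.cons (V 2) .nil))) flipF) <|
  comp (ex (.cons (V 0) .nil)) incF

/-- The next state of the game, from the state, the violated clause, the action (in unary), and the
length of the counter (in unary). -/
def nextF : Fn :=
  lt (ite (ex (V 2)) (ite (ex (.tl (V 2))) (ex (.hd (.tl (.tl (V 1))))) (ex (.hd (.tl (V 1)))))
    (ex (.hd (V 1)))) moveF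

/-- Interpretation of a tree as an action. -/
def action : Data → Fin 3
  | .nil => 0
  | .cons _ .nil => 1
  | .cons _ (.cons _ _) => 2

theorem action_unary (a : Fin 3) : action (unary a) = a := by
  fin_cases a <;> rfl

theorem ofFn_flipAt {v : ℕ} (w : Fin v → Bool) (i : Fin v) : ∃ l l' : List Bool, l.length = i ∧
    List.ofFn w = l ++ w i :: l' ∧ List.ofFn (Game.flipAt w i) = l ++ (!w i) :: l' := by
  have hi : (i : ℕ) < (List.ofFn w).length := by simp
  refine ⟨(List.ofFn w).take i, (List.ofFn w).drop (i + 1), by simp, ?_, ?_⟩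
  · conv_lhs => rw [← List.take_append_drop i (List.ofFn w), List.drop_eq_getElem_cons hi]
    simp
  · have h := List.set_eq_take_append_cons_drop (l := List.ofFn w) (i := i) (a := !w i)
    rw [if_pos hi] at h
    rw [← h]
    refine List.ext_getElem (by simp) fun j h1 h2 => ?_
    rw [List.getElem_set]
    simp only [List.getElem_ofFn, Game.flipAt]
    split_ifs with h
    · subst h; simp
    · rw [Function.update_of_ne]
      intro h'
      exact h (by rw [← h'])

/-- The tree `a` is arbitrary because the walk also reads actions off an output that may be
malformed. -/
theorem eval_nextF {m v : ℕ} {s : Game.State m v} (hs : (s.1 : ℕ) + 1 < 2 ^ m) (c : Clause v)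
    (a z : Data) :
    nextF.eval (.cons (ofBits (Game.name m s)) (.cons (clauseData c) (.cons a (.cons (unary m) z)))) =
      ofBits (Game.name m (⟨(s.1 : ℕ) + 1, hs⟩, Game.flipAt s.2 (c (action a)).1)) := by
  have h1 : ∀ x y z', x = literalData (c (action a)) →
      moveF.eval (.cons x (.cons (ofBits (Game.name m s)) (.cons y (.cons z' (.cons (unary m) z))))) =
        ofBits (Game.name m (⟨(s.1 : ℕ) + 1, hs⟩, Game.flipAt s.2 (c (action a)).1)) := by
    rintro x y z' rfl
    obtain ⟨l, l', hl, e1, e2⟩ := ofFn_flipAt s.2 (c (action a)).1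
    have h2 : (literalData (c (action a))).tl = unary (c (action a)).1 := rfl
    have h3 : l.length + m = (bitList m s.1 ++ l).length := by simp [length_bitList, add_comm]
    simp only [moveF, eval, ev_V_zero, ev_V_succ, ev_cons, ev_nil, ev_tl]
    rw [h2, eval_revAppF_unary, Game.name, e1, ← hl, ← List.append_assoc, h3, eval_flipF,
      List.append_assoc, eval_incF hs, Game.name, e2]
  rcases a with _ | ⟨a, _ | ⟨b, b'⟩⟩
  all_goals
    simp only [nextF, eval, ev_V_zero, ev_V_succ, ev_tl, ev_hd, clauseData_eq, hd_cons, tl_cons]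
    exact h1 _ _ _ rfl

/-- The tree of the rational number zero. -/
def zeroE : Expr := .cons .nil (.cons .nil (.cons tt .nil))

/-- The tree of the rational number one. -/
def oneE : Expr := .cons .nil (.cons (.cons tt .nil) (.cons tt .nil))

theorem ev_zeroE (x : Data) : zeroE.ev x = ofRat 0 := by
  simp [zeroE, ofRat, ev_cons, ev_nil, ev_tt, ofNat, ofBits, ofList, ofBool]

theorem ev_oneE (x : Data) : oneE.ev x = ofRat 1 := by
  have : decide ((1 : ℚ) < 0) = false := by norm_num
  simp [oneE, ofRat, ev_cons, ev_nil, ev_tt, ofNat, ofBits, ofList, this]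
  simp [ofBool]

/-- Tensor power of a vector of bits, from the vector and the exponent in unary. -/
def tpowF : Fn := fold (ex (V 1)) (ex (.cons tt .nil))
  (fold (ex (V 2)) (ex .nil)
    (fold (ex (V 3)) (ex (V 1)) (ite (ex (V 2)) (ex (.cons (V 0) (V 1))) (ex (.cons .nil (V 1))))))

theorem foldl_bits_cons {α : Type*} (l : List α) (f : α → Bool) (acc : List Bool) :
    l.foldl (fun a x => Data.cons (ofBool (f x)) a) (ofBits acc) =
      ofBits (l.foldl (fun a x => f x :: a) acc) := by
  induction l generalizing acc with
  | nil => rfl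
  | cons x l ih => exact ih (f x :: acc)

theorem eval_tensor (u w : List Bool) : List.foldl (fun a x => List.foldl (fun a y =>
      match ofBool x with
      | .nil => Data.cons .nil a
      | .cons _ _ => .cons (ofBool y) a) a w) .nil u = ofBits (tensor (· && ·) u w) := by
  have h : ∀ (x : Bool) (a : List Bool), List.foldl (fun a y =>
      match ofBool x with
      | .nil => Data.cons .nil a
      | .cons _ _ => .cons (ofBool y) a) (ofBits a) w =
        ofBits (w.foldl (fun a y => (x && y) :: a) a) := by
    intro x a
    rw [← foldl_bits_cons]
    cases x <;> rfl
  have h' : ∀ acc : List Bool, List.foldl (fun a x => List.foldl (fun a y =>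
      match ofBool x with
      | .nil => Data.cons .nil a
      | .cons _ _ => .cons (ofBool y) a) a w) (ofBits acc) u =
        ofBits (u.foldl (fun acc x => w.foldl (fun a y => (x && y) :: a) acc) acc) := by
    induction u with
    | nil => intro acc; rfl
    | cons x u ih => intro acc; rw [List.foldl_cons, h, ih, List.foldl_cons]
  exact h' []

theorem eval_tpowF (u : List Bool) (r : ℕ) (z : Data) :
    tpowF.eval (.cons (ofBits u) (.cons (unary r) z)) = ofBits (tpow (· && ·) true u r) := by
  simp only [tpowF, eval, fold_unary, ev_V_zero, ev_V_succ, ev_cons, ev_nil, ev_tt, fold_ofBits]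
  induction r with
  | zero => rfl
  | succ r ih =>
    have e : tpow (· && ·) true u (r + 1) = tensor (· && ·) u (tpow (· && ·) true u r) :=
      Function.iterate_succ_apply' ..
    rw [Function.iterate_succ_apply', ih, e]
    simp only [fold_ofBits]
    exact eval_tensor u _

/-- The vector with the given bits as coordinates, extended by zeros to a given length. -/
def vecF : Fn := lt (fold (ex (V 1)) (ex (.cons (V 0) .nil))
    (ite (ex (.hd (.hd (V 1)))) (ex (.cons (.tl (.hd (V 1))) (.cons oneE (.tl (V 1)))))
      (ex (.cons (.tl (.hd (V 1))) (.cons zeroE (.tl (V 1)))))))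
  (comp (ex (.cons (.tl (V 0)) (.cons .nil .nil))) revAppF)

theorem eval_vecF (u : List Bool) (d : ℕ) (z : Data) :
    vecF.eval (.cons (ofBits u) (.cons (unary d) z)) =
      ofVec fun i : Fin d => if u.getD i false then 1 else 0 := by
  simp only [vecF, eval, fold_unary, ev_V_zero, ev_V_succ, ev_cons, ev_nil, ev_tl, ev_hd, ev_zeroE,
    ev_oneE]
  generalize hg : (fun acc : Data => match acc.hd.hd with
    | .nil => Data.cons acc.hd.tl (.cons (ofRat 0) acc.tl)
    | .cons _ _ => .cons acc.hd.tl (.cons (ofRat 1) acc.tl)) = g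
  -- Past the end of the list `hd` and `tl` of `nil` are `nil`, that is, the bit `false`; this
  -- produces the zero padding.
  have hgt : ∀ (l : List Bool) (out : List Data), g (.cons (ofBits l) (ofList out)) =
      .cons (ofBits l.tail) (ofList (ofRat (if l.headD false then 1 else 0) :: out)) := by
    intro l out
    subst hg
    rcases l with _ | ⟨_ | _, l⟩ <;> rfl
  have h : ∀ (d : ℕ) (u : List Bool) (out : List Data), g^[d] (.cons (ofBits u) (ofList out)) =
      .cons (ofBits (u.drop d)) (ofList ((List.ofFn fun i : Fin d =>
        ofRat (if u.getD i false then 1 else 0)).reverse ++ out)) := by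
    intro d
    induction d with
    | zero => intro u out; simp
    | succ d ih =>
      intro u out
      rw [Function.iterate_succ_apply, hgt, ih]
      cases u <;> simp [List.ofFn_succ]
  have h1 := h d u []
  rw [ofList] at h1
  rw [h1, tl_cons]
  have h2 := eval_revAppF ((List.ofFn fun i : Fin d =>
        ofRat (if u.getD i false then 1 else 0)).reverse ++ []) [] .nil
  rw [ofList] at h2
  rw [h2, ofVec]
  simp

/-- Features of a state, from the state, the exponent, and the dimension. -/
def featF : Fn := lt (comp (ex (.cons (.cons tt (V 0)) (.cons (V 1) .nil))) tpowF)
  (comp (ex (.cons (V 0) (.cons (V 3) .nil))) vecF)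

theorem eval_featF {m v : ℕ} (s : Game.State m v) (r d : ℕ) (z : Data) :
    featF.eval (.cons (ofBits (Game.name m s)) (.cons (unary r) (.cons (unary d) z))) =
      ofVec (Game.feat m r d s) := by
  simp only [featF, eval, ev_V_zero, ev_V_succ, ev_cons, ev_nil, ev_tt, ← ofBits_cons, eval_tpowF,
    eval_vecF]
  rfl

/-- Test whether a tree is a list of bits of a given length. -/
def validF : Fn := lt (fold (ex (V 1)) (ex (.cons (V 0) tt))
    (ite (ex (.hd (V 1)))
      (ite (ex (.hd (.hd (V 1))))
        (ite (ex (.hd (.hd (.hd (V 1))))) (ex (.cons .nil .nil))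
          (ite (ex (.tl (.hd (.hd (V 1))))) (ex (.cons .nil .nil))
            (ex (.cons (.tl (.hd (V 1))) (.tl (V 1))))))
        (ex (.cons (.tl (.hd (V 1))) (.tl (V 1)))))
      (ex (.cons .nil .nil))))
  (ite (ex (.tl (V 0))) (ite (ex (.hd (V 0))) (ex .nil) (ex tt)) (ex .nil))

open Classical in
theorem eval_validF (x : Data) (n : ℕ) (z : Data) :
    validF.eval (.cons x (.cons (unary n) z)) =
      ofBool (decide (∃ l : List Bool, l.length = n ∧ x = ofBits l)) := by
  simp only [validF, eval, fold_unary, ev_V_zero, ev_V_succ, ev_cons, ev_nil, ev_tl, ev_hd, ev_tt]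
  generalize hg : (fun acc : Data => match acc.hd with
    | .nil => Data.cons .nil .nil
    | .cons _ _ => match acc.hd.hd with
      | .nil => .cons acc.hd.tl acc.tl
      | .cons _ _ => match acc.hd.hd.hd with
        | .nil => match acc.hd.hd.tl with
          | .nil => .cons acc.hd.tl acc.tl
          | .cons _ _ => .cons .nil .nil
        | .cons _ _ => .cons .nil .nil) = g
  -- `cons nil nil` is an absorbing rejecting state: it is entered at a component that is not a bit
  -- or when the list ends too early.
  have h0 : ∀ (n : ℕ), g^[n] (.cons .nil .nil) = .cons .nil .nil := by
    intro n
    induction n with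
    | zero => rfl
    | succ n ih => rw [Function.iterate_succ_apply', ih]; subst hg; rfl
  have h1 : ∀ (n : ℕ) (x : Data), (∃ l : List Bool, l.length = n ∧ x = ofBits l) →
      g^[n] (.cons x (ofBool true)) = .cons .nil (ofBool true) := by
    rintro n x ⟨l, rfl, rfl⟩
    induction l with
    | nil => rfl
    | cons b l ih =>
      rw [List.length_cons, Function.iterate_succ_apply, ← ih]
      congr 1
      subst hg
      cases b <;> rfl
  -- A bad input is either left over after `n` steps or already rejected; the final test refuses
  -- both.
  have h2 : ∀ (n : ℕ) (x : Data), (¬ ∃ l : List Bool, l.length = n ∧ x = ofBits l) →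
      ∃ y, (g^[n] (.cons x (ofBool true)) = .cons y (ofBool true) ∧ y ≠ .nil) ∨
        g^[n] (.cons x (ofBool true)) = .cons .nil .nil := by
    intro n
    induction n with
    | zero =>
      intro x hx
      exact ⟨x, .inl ⟨rfl, fun h => hx ⟨[], rfl, h⟩⟩⟩
    | succ n ih =>
      intro x hx
      have hgood : ∀ (b : Bool) y, x = .cons (ofBool b) y →
          ¬ ∃ l : List Bool, l.length = n ∧ y = ofBits l := by
        rintro b y rfl ⟨l, hl, rfl⟩
        exact hx ⟨b :: l, by simp [hl], rfl⟩
      rw [Function.iterate_succ_apply]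
      rcases x with _ | ⟨_ | ⟨_ | ⟨_, _⟩, _ | ⟨_, _⟩⟩, y⟩
      · refine ⟨.nil, .inr ?_⟩
        rw [← h0 n]; subst hg; rfl
      · have := ih y (hgood false y rfl)
        have e : g (.cons (.cons .nil y) (ofBool true)) = .cons y (ofBool true) := by
          subst hg; rfl
        rwa [e]
      · have := ih y (hgood true y rfl)
        have e : g (.cons (.cons (.cons .nil .nil) y) (ofBool true)) = .cons y (ofBool true) := by
          subst hg; rfl
        rwa [e]
      all_goals
        refine ⟨.nil, .inr ?_⟩
        rw [← h0 n]; subst hg; rfl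
  by_cases hx : ∃ l : List Bool, l.length = n ∧ x = ofBits l
  · rw [h1 n x hx]
    simp only [hx, decide_true]
    rfl
  · simp only [hx, decide_false]
    obtain ⟨y, ⟨hy, hy'⟩ | hy⟩ := h2 n x hx
    · rw [hy]
      cases y with
      | nil => exact absurd rfl hy'
      | cons a b => rfl
    · rw [hy]; rfl

/-- Case distinction on a number in unary: the term `fs[n]` if the value of `e` is `n`, and `bad` if
it is not a number below the length of `fs`. -/
def caseUnary (bad : Fn) : Expr → List Fn → Fn
  | _, [] => bad
  | e, f :: fs => ite (ex e) (ite (ex (.hd e)) bad (caseUnary bad (.tl e) fs)) f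

theorem eval_caseUnary (bad : Fn) (e : Expr) (fs : List Fn) (x : Data) (n : ℕ)
    (he : e.ev x = unary n) (hn : n < fs.length) :
    (caseUnary bad e fs).eval x = fs[n].eval x := by
  induction fs generalizing e n with
  | nil => simp at hn
  | cons f fs ih =>
    cases n with
    | zero => simp only [caseUnary, eval, he]; rfl
    | succ n =>
      simp only [caseUnary, eval, he, ev_hd]
      exact ih _ _ (by rw [ev_tl, he]; rfl) (by simpa using hn)

theorem eval_caseUnary_bad (bad : Fn) (e : Expr) (fs : List Fn) (x : Data)
    (he : ∀ n < fs.length, e.ev x ≠ unary n) :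
    (caseUnary bad e fs).eval x = bad.eval x := by
  induction fs generalizing e with
  | nil => rfl
  | cons f fs ih =>
    simp only [caseUnary, eval, ev_hd]
    rcases h : e.ev x with _ | ⟨_ | ⟨_, _⟩, b⟩
    · exact absurd h (he 0 (by simp))
    · refine ih _ fun n hn h' => he (n + 1) (by simpa using hn) ?_
      rw [ev_tl, h] at h'
      rw [h, show b = unary n from h']; rfl
    · rfl

end Fn

open Data

namespace Fn

/-! ### Lengths of the lists in the evaluation of terms -/

/-- Controls a list built inside an accumulator, which is then itself the list of a later fold (the
reversals in `flipF`, `incF`, `vecF`). -/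
theorem len_fold {g : Data → Data → Data} (μ : Data → ℕ) (h : ∀ x acc, μ (g x acc) = μ acc + 1)
    (l acc : Data) : μ (Data.fold g l acc) = μ acc + l.len := by
  induction l generalizing acc with
  | nil => rfl
  | cons x xs _ ih => simp only [Data.fold, Data.len, ih, h]; omega

variable {L : ℕ}

theorem ok_ex (e : Expr) (x : Data) : (ex e).Ok L x ↔ True := Iff.rfl

theorem ok_comp (f g : Fn) (x : Data) : (comp f g).Ok L x ↔ f.Ok L x ∧ g.Ok L (f.eval x) := Iff.rfl

theorem ok_lt (f g : Fn) (x : Data) :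
    (lt f g).Ok L x ↔ f.Ok L x ∧ g.Ok L (.cons (f.eval x) x) := Iff.rfl

theorem ok_dropF {a l z : Data} (h : a.len ≤ L) : dropF.Ok L (.cons a (.cons l z)) :=
  ⟨trivial, trivial, h, .of_forall (fun _ _ => trivial) _ _⟩

theorem ok_revAppF {a l z : Data} (h : a.len ≤ L) : revAppF.Ok L (.cons a (.cons l z)) :=
  ⟨trivial, trivial, h, .of_forall (fun _ _ => trivial) _ _⟩

theorem ok_litF {w a z : Data} (h : a.tl.len ≤ L) : litF.Ok L (.cons w (.cons a z)) := by
  simp only [litF, ok_ite, ok_ex, ok_comp, ok_lt, implies_true, and_true, true_and]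
  exact ok_dropF h

theorem ok_clauseF {v : ℕ} {w z : Data} (c : Clause v) (h3 : 3 ≤ L) (hv : v ≤ L) :
    clauseF.Ok L (.cons w (.cons (clauseData c) z)) := by
  refine ⟨trivial, trivial, ?_, ?_⟩
  · simpa only [eval, ev_V_zero, ev_V_succ, clauseData, len_ofList, List.length_ofFn] using h3
  · refine FoldAll.ofList (fun x hx acc => ?_) _
    obtain ⟨i, rfl⟩ := (List.mem_ofFn' _ _).1 hx
    simp only [ok_ite, ok_ex, ok_comp, implies_true, and_true, true_and]
    intro _
    refine ok_litF (?_ : (unary _).len ≤ L)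
    rw [len_unary]
    exact (c i).1.2.le.trans hv

theorem ok_unsatF {v : ℕ} {w z : Data} (φ : Formula v) (h3 : 3 ≤ L) (hv : v ≤ L)
    (hφ : φ.length ≤ L) : unsatF.Ok L (.cons w (.cons (clausesData φ) z)) := by
  refine ⟨trivial, trivial, ?_, ?_⟩
  · simpa only [eval, ev_V_zero, ev_V_succ, clausesData, len_ofList, List.length_map] using hφ
  · refine FoldAll.ofList (fun x hx acc => ?_) _
    obtain ⟨c, -, rfl⟩ := List.mem_map.1 hx
    simp only [ok_ite, ok_ex, ok_comp, implies_true, and_true, true_and]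
    exact fun _ => ok_clauseF c h3 hv

theorem ok_lastF {a l z : Data} (h : a.len ≤ L) : lastF.Ok L (.cons a (.cons l z)) :=
  ⟨⟨trivial, trivial, h, .of_forall (fun _ _ => by
    simp only [ok_ite, ok_ex, implies_true, and_true]) _ _⟩, trivial⟩

theorem ok_flipF {a l z : Data} (h : a.len ≤ L) : flipF.Ok L (.cons a (.cons l z)) := by
  have h2 := len_fold (g := fun _ acc => Data.cons (.cons acc.tl.hd acc.hd) acc.tl.tl)
    (fun acc => acc.hd.len) (fun _ _ => rfl) a (.cons .nil l)
  refine ⟨⟨trivial, trivial, h, .of_forall (fun _ _ => trivial) _ _⟩, ?_⟩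
  simp only [ok_ite, ok_ex, ok_comp, true_and]
  refine ⟨fun _ => ok_revAppF ?_, fun _ => ok_revAppF ?_⟩
  all_goals
    refine le_trans (le_of_eq ?_) h
    simp only [eval, ev_V_zero, ev_V_succ, ev_cons, ev_nil, ev_tl, ev_hd]
    exact h2.trans (Nat.zero_add _)

theorem ok_incF {a z : Data} (h : a.len ≤ L) : incF.Ok L (.cons a z) := by
  refine ⟨⟨⟨trivial, trivial, h, .of_forall (fun _ _ => by
    simp only [ok_ite, ok_ex, implies_true, and_true]) _ _⟩, trivial⟩, ?_⟩
  refine ok_revAppF (le_trans (le_of_eq ?_) h)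
  simp only [eval, ev_V_zero, ev_V_succ, ev_cons, ev_nil, ev_tl, ev_hd, ev_tt]
  refine (len_fold (fun acc => acc.tl.len) (fun x acc => ?_) a _).trans (Nat.zero_add _)
  split
  · rfl
  · split <;> rfl

theorem ok_nextF {m v : ℕ} {s : Game.State m v} (c : Clause v) {a z : Data} (hL : m + v ≤ L) :
    nextF.Ok L (.cons (ofBits (Game.name m s)) (.cons (clauseData c)
      (.cons a (.cons (unary m) z)))) := by
  have h1 : ∀ y z', moveF.Ok L (.cons (literalData (c (action a))) (.cons (ofBits (Game.name m s))
      (.cons y (.cons z' (.cons (unary m) z))))) := by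
    intro y z'
    obtain ⟨l, l', hl, e1, e2⟩ := ofFn_flipAt s.2 (c (action a)).1
    have h2 : (literalData (c (action a))).tl = unary (c (action a)).1 := rfl
    have h3 : l.length + m = (bitList m s.1 ++ l).length := by simp [length_bitList, add_comm]
    have h4 : (ofBits (Game.name m s)).len ≤ L := by rwa [len_ofBits, Game.length_name]
    have hv := (c (action a)).1.2
    simp only [moveF, ok_ex, ok_comp, ok_lt, eval, ev_V_zero, ev_V_succ, ev_cons, ev_nil, ev_tl, true_and]
    rw [h2, eval_revAppF_unary]
    refine ⟨ok_revAppF (by rw [len_unary]; omega), ok_flipF (by rw [len_unary]; omega), ok_incF ?_⟩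
    rw [Game.name, e1, ← hl, ← List.append_assoc, h3, eval_flipF]
    rw [Game.name, e1, len_ofBits] at h4
    rw [len_ofBits]
    simpa using h4
  rcases a with _ | ⟨a, _ | ⟨b, b'⟩⟩
  all_goals
    refine ⟨by simp only [ok_ite, ok_ex, implies_true, and_true], ?_⟩
    simp only [eval, ev_V_zero, ev_V_succ, ev_tl, ev_hd, clauseData_eq, hd_cons, tl_cons]
    rw [← clauseData_eq]
    exact h1 _ _

theorem ok_tpowF {u : List Bool} {r : ℕ} {z : Data} (hr : r ≤ L) (hu : u.length ≤ L)
    (h : u.length ^ r ≤ L) : tpowF.Ok L (.cons (ofBits u) (.cons (unary r) z)) := by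
  refine ⟨trivial, trivial, by simpa only [eval, ev_V_zero, ev_V_succ, len_unary] using hr, ?_⟩
  refine FoldAll.unary fun i hi => ?_
  refine ⟨trivial, trivial, by simpa only [eval, ev_V_zero, ev_V_succ, len_ofBits] using hu, ?_⟩
  refine .of_forall (fun x acc => ?_) _ _
  refine ⟨trivial, trivial, ?_, .of_forall (fun _ _ => by
    simp only [ok_ite, ok_ex, implies_true, and_true]) _ _⟩
  have e := eval_tpowF u i z
  simp only [tpowF, eval, fold_unary, ev_V_zero, ev_V_succ, ev_cons, ev_nil, ev_tt] at e
  simp only [eval, ev_V_zero, ev_V_succ, ev_cons, ev_nil, ev_tt]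
  rw [e, len_ofBits, length_tpow]
  -- Intermediate tensor powers are no longer than the final one, except that `0 ^ 0 = 1` spoils
  -- monotonicity for an empty vector.
  rcases Nat.eq_zero_or_pos u.length with h0 | h0
  · rw [h0] at h ⊢
    rcases Nat.eq_zero_or_pos i with rfl | hi'
    · simp; omega
    · rw [zero_pow hi'.ne']; omega
  · exact (Nat.pow_le_pow_right h0 hi.le).trans h

theorem ok_vecF {a u z : Data} (h : a.len ≤ L) : vecF.Ok L (.cons u (.cons a z)) := by
  refine ⟨⟨trivial, trivial, h, .of_forall (fun _ _ => by
    simp only [ok_ite, ok_ex, implies_true, and_true]) _ _⟩, trivial, ?_⟩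
  refine ok_revAppF (le_trans (le_of_eq ?_) h)
  simp only [eval, ev_V_zero, ev_V_succ, ev_cons, ev_nil, ev_tl, ev_hd]
  refine (len_fold (fun acc => acc.tl.len) (fun x acc => ?_) a _).trans (Nat.zero_add _)
  split <;> rfl

theorem ok_featF {m v : ℕ} (s : Game.State m v) {r d : ℕ} (z : Data) (hr : r ≤ L) (hd : d ≤ L)
    (hu : 1 + m + v ≤ L) (h : (1 + m + v) ^ r ≤ L) :
    featF.Ok L (.cons (ofBits (Game.name m s)) (.cons (unary r) (.cons (unary d) z))) := by
  have hlen : (true :: Game.name m s).length = 1 + m + v := by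
    rw [List.length_cons, Game.length_name]; omega
  refine ⟨⟨trivial, ?_⟩, trivial, ok_vecF ?_⟩
  · exact ok_tpowF (u := true :: Game.name m s) hr (by rwa [hlen]) (by rwa [hlen])
  · exact (len_unary d).trans_le hd

theorem ok_validF {a x z : Data} (h : a.len ≤ L) : validF.Ok L (.cons x (.cons a z)) :=
  ⟨⟨trivial, trivial, h, .of_forall (fun _ _ => by
    simp only [ok_ite, ok_ex, implies_true, and_true]) _ _⟩,
    by simp only [ok_ite, ok_ex, implies_true, and_true]⟩

theorem ok_caseUnary {bad : Fn} {e : Expr} {fs : List Fn} {x : Data} (hb : bad.Ok L x)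
    (hf : ∀ f ∈ fs, f.Ok L x) : (caseUnary bad e fs).Ok L x := by
  induction fs generalizing e with
  | nil => exact hb
  | cons f fs ih =>
    simp only [caseUnary, ok_ite, ok_ex, true_and]
    exact ⟨fun _ => hf f (by simp), fun _ => ⟨fun _ => ih fun g hg => hf g (by simp [hg]),
      fun _ => hb⟩⟩

/-! ### The simulated oracle -/

section Query

variable {v : ℕ} (φ : Formula v) (m r d : ℕ)

/-- The parameters of the simulated oracle. -/
def paramsData : Data :=
  .cons (unary m) (.cons (unary r) (.cons (unary d) (.cons (unary (m + v))
    (.cons (unary (2 ^ m)) (.cons (clausesData φ) .nil)))))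

/-- Parameters for which all lists that occur have length at most `L`. -/
structure Fits (L : ℕ) : Prop where
  three_le : 3 ≤ L
  clauses : φ.length ≤ L
  name : 1 + m + v ≤ L
  exponent : r ≤ L
  dim : d ≤ L
  steps : 2 ^ m ≤ L
  tensor : (1 + m + v) ^ r ≤ L

/-- Answer `nil`. -/
def badF : Fn := ex (.cons .nil .nil)

/-- If the value of `e` is the name of a state, look for the first violated clause and continue with
`f`, or abort if there is none. -/
def guardF (e : Expr) (f : Fn) : Fn :=
  ite (comp (ex (.cons e (.cons (V 4) .nil))) validF)
    (lt (comp (ex (.cons (V 1) (.cons e .nil))) dropF) <|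
      lt (comp (ex (.cons (V 0) (.cons (V 7) .nil))) unsatF) <|
        ite (ex (V 0)) f (ex (.cons tt .nil))) badF

/-- Answer to a query of a reward. -/
def rewardF : Fn := ex (.cons .nil zeroE)

/-- Answer to a query of a transition. -/
def transF : Fn :=
  ite (comp (ex (.cons (V 3) (.cons (.hd (.tl (V 2))) .nil))) lastF) (ex (.cons .nil .nil)) <|
    lt (comp (ex (.cons (.hd (.tl (V 2))) (.cons (V 0) (.cons (.tl (.tl (V 2)))
      (.cons (V 3) .nil))))) nextF) (ex (.cons .nil (.cons .nil (V 0))))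

/-- Answer to a query of the features of the state with name `e`. -/
def featSF (e : Expr) : Fn :=
  lt (comp (ex (.cons e (.cons (V 4) (.cons (V 5) .nil)))) featF) (ex (.cons .nil (V 0)))

/-- Answer to a query of the features of a state and an action. -/
def featSAF : Fn :=
  ite (comp (ex (.cons (V 3) (.cons (.hd (.tl (V 2))) .nil))) lastF) (featSF (.hd (.tl (V 2)))) <|
    lt (comp (ex (.cons (.hd (.tl (V 2))) (.cons (V 0) (.cons (.tl (.tl (V 2)))
      (.cons (V 3) .nil))))) nextF) <|
    lt (comp (ex (.cons (V 0) (.cons (V 5) (.cons (V 6) .nil)))) featF) (ex (.cons .nil (V 0)))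

/-- A query with an action. -/
def withActionF (f : Fn) : Fn :=
  caseUnary badF (.tl (.tl (V 0))) (List.replicate 3 (guardF (.hd (.tl (V 0))) f))

/-- The answer to a query. -/
def queryF : Fn :=
  caseUnary badF (.hd (V 0)) [withActionF rewardF, withActionF transF,
    guardF (.tl (V 0)) (featSF (.tl (V 2))), withActionF featSAF]

variable {φ m r d}

/-- Since every bit string of this length names a state, testing for such a string recognizes
exactly the names. -/
theorem exists_name {l : List Bool} (h : l.length = m + v) :
    ∃ s : Game.State m v, Game.name m s = l := by
  have hbits : ∀ (m : ℕ) (l : List Bool), l.length = m → ∃ k < 2 ^ m, bitList m k = l := by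
    intro m
    induction m with
    | zero => intro l hl; exact ⟨0, by simp, by simp [bitList, List.length_eq_zero_iff.1 hl]⟩
    | succ m ih =>
      intro l hl
      cases l with
      | nil => simp at hl
      | cons b l =>
        obtain ⟨k, hk, rfl⟩ := ih l (by simpa using hl)
        refine ⟨2 * k + b.toNat, ?_, ?_⟩
        · have := b.toNat_lt; omega
        · cases b
          · simp [bitList]
          · simp only [bitList, Bool.toNat_true, List.cons.injEq, decide_eq_true_eq]
            exact ⟨by omega, by congr 1; omega⟩
  obtain ⟨k, hk, hkl⟩ := hbits m (l.take m) (by simp; omega)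
  refine ⟨(⟨k, hk⟩, fun i => (l.drop m)[(i : ℕ)]'(by simp; omega)), ?_⟩
  rw [Game.name, hkl]
  conv_rhs => rw [← List.take_append_drop m l]
  congr 1
  refine List.ext_getElem (by simp; omega) fun i h1 h2 => by simp

theorem eval_guardF {e : Expr} {f : Fn} {q : Data} {s : Game.State m v}
    (he : e.ev (.cons q (paramsData φ m r d)) = ofBits (Game.name m s)) :
    (guardF e f).eval (.cons q (paramsData φ m r d)) = match Game.firstUnsat φ s.2 with
      | none => .cons (ofBool true) .nil
      | some c => f.eval (.cons (clauseData c) (.cons (ofBits (List.ofFn s.2))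
          (.cons q (paramsData φ m r d)))) := by
  have h1 : ∃ l : List Bool, l.length = m + v ∧ ofBits (Game.name m s) = ofBits l :=
    ⟨_, Game.length_name s, rfl⟩
  have h2 : (Game.name m s).drop m = List.ofFn s.2 := by
    rw [Game.name, List.drop_left' (length_bitList _ _)]
  simp only [guardF, eval, ev_cons, he, ev_nil]
  simp only [paramsData, ev_V_zero, ev_V_succ, eval_validF, h1, eval_dropF, iterate_tl_ofBits, h2,
    eval_unsatF, decide_true]
  cases Game.firstUnsat φ s.2 with
  | none => rfl
  | some c => simp only [clauseData_eq]; rfl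

theorem eval_guardF_bad {e : Expr} {f : Fn} {q : Data}
    (he : ∀ s : Game.State m v, e.ev (.cons q (paramsData φ m r d)) ≠ ofBits (Game.name m s)) :
    (guardF e f).eval (.cons q (paramsData φ m r d)) = .cons .nil .nil := by
  have h1 : ¬ ∃ l : List Bool, l.length = m + v ∧
      e.ev (.cons q (paramsData φ m r d)) = ofBits l := by
    rintro ⟨l, hl, h⟩
    obtain ⟨s, rfl⟩ := exists_name hl
    exact he s h
  have h2 : (V 4).ev (.cons q (paramsData φ m r d)) = unary (m + v) := rfl
  simp only [guardF, eval, ev_cons, ev_nil, h2, eval_validF, h1, decide_false]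
  rfl

theorem ok_guardF {L : ℕ} (hL : Fits φ m r d L) {e : Expr} {f : Fn} {q : Data}
    (hf : ∀ (s : Game.State m v) (c : Clause v), e.ev (.cons q (paramsData φ m r d)) = ofBits (Game.name m s) →
      f.Ok L (.cons (clauseData c) (.cons (ofBits (List.ofFn s.2))
          (.cons q (paramsData φ m r d))))) :
    (guardF e f).Ok L (.cons q (paramsData φ m r d)) := by
  have h4 : (V 4).ev (.cons q (paramsData φ m r d)) = unary (m + v) := rfl
  have h1 : (V 1).ev (.cons q (paramsData φ m r d)) = unary m := rfl
  have hm : m + v ≤ L := by have := hL.name; omega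
  rw [guardF, ok_ite]
  simp only [eval, ev_cons, ev_nil, h4, eval_validF]
  refine ⟨⟨trivial, ?_⟩, fun _ => trivial, fun h => ?_⟩
  · simp only [eval, ev_cons, h4]
    exact ok_validF (by rwa [len_unary])
  obtain ⟨l, hl, hel⟩ : ∃ l : List Bool, l.length = m + v ∧
      e.ev (.cons q (paramsData φ m r d)) = ofBits l := by
    by_contra h'
    exact h (by simp only [h', decide_false]; rfl)
  obtain ⟨s, rfl⟩ := exists_name hl
  have h2 : (Game.name m s).drop m = List.ofFn s.2 := by
    rw [Game.name, List.drop_left' (length_bitList _ _)]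
  have h7 : ∀ x, (V 7).ev (.cons x (.cons q (paramsData φ m r d))) = clausesData φ := fun _ => rfl
  simp only [ok_ite, ok_ex, ok_comp, ok_lt, eval, ev_cons, ev_nil, h1, h7, hel, eval_dropF, iterate_tl_ofBits, h2,
    ev_V_zero, eval_unsatF, true_and, implies_true]
  refine ⟨ok_dropF (by rw [len_unary]; omega), ok_unsatF φ hL.three_le (by omega) hL.clauses,
    fun hc => ?_⟩
  split at hc
  · exact absurd rfl hc
  · exact hf s _ hel

theorem ok_transF {L : ℕ} (hL : Fits φ m r d L) {q : Data} {s : Game.State m v} {c : Clause v}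
    {z : Data} (hs : q.tl.hd = ofBits (Game.name m s)) :
    transF.Ok L (.cons (clauseData c) (.cons z (.cons q (paramsData φ m r d)))) := by
  have := hL.name
  simp only [transF, paramsData, ok_ite, ok_ex, ok_comp, ok_lt, eval, ev_cons, ev_nil, ev_hd, ev_tl, ev_V_zero,
    ev_V_succ, hs, true_and, implies_true, and_true]
  exact ⟨ok_lastF (by rw [len_unary]; omega), fun _ => ok_nextF c (by omega)⟩

theorem ok_featSF {L : ℕ} (hL : Fits φ m r d L) {q : Data} {s : Game.State m v}
    {z z' : Data} {e : Expr} (hs : e.ev (.cons z' (.cons z (.cons q (paramsData φ m r d)))) =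
      ofBits (Game.name m s)) :
    (featSF e).Ok L (.cons z' (.cons z (.cons q (paramsData φ m r d)))) := by
  simp only [featSF, ok_ex, ok_comp, ok_lt, eval, ev_cons, ev_nil, hs, true_and, and_true]
  exact ok_featF s _ hL.exponent hL.dim hL.name hL.tensor

theorem eval_featSF {q : Data} {s : Game.State m v}
    {z z' : Data} {e : Expr} (hs : e.ev (.cons z' (.cons z (.cons q (paramsData φ m r d)))) =
      ofBits (Game.name m s)) :
    (featSF e).eval (.cons z' (.cons z (.cons q (paramsData φ m r d)))) =
      .cons .nil (ofVec (Game.feat m r d s)) := by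
  simp only [featSF, eval, ev_cons, ev_nil, hs]
  simp only [paramsData, ev_V_succ, ev_V_zero, eval_featF]

theorem ok_featSAF {L : ℕ} (hL : Fits φ m r d L) {q : Data} {s : Game.State m v} {c : Clause v}
    {z : Data} (hs : q.tl.hd = ofBits (Game.name m s)) :
    featSAF.Ok L (.cons (clauseData c) (.cons z (.cons q (paramsData φ m r d)))) := by
  have := hL.name
  have hs' : (Expr.hd (.tl (V 2))).ev (.cons (clauseData c) (.cons z (.cons q
    (paramsData φ m r d)))) = ofBits (Game.name m s) := hs
  rw [featSAF, ok_ite]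
  refine ⟨?_, fun h0 => ?_, fun _ => ok_featSF hL hs'⟩
  · simp only [paramsData, ok_ex, ok_comp, eval, ev_cons, ev_nil, ev_hd, ev_tl, ev_V_zero,
      ev_V_succ, true_and]
    exact ok_lastF (by rw [len_unary]; omega)
  · simp only [paramsData, eval, ev_cons, ev_nil, ev_hd, ev_tl, ev_V_zero, ev_V_succ, hs] at h0
    rw [Game.name, eval_lastF s.1.2, ofBool_eq_nil] at h0
    have hlt : (s.1 : ℕ) + 1 < 2 ^ m := by
      have := s.1.2
      have := of_decide_eq_false h0
      omega
    simp only [paramsData, ok_ex, ok_comp, ok_lt, eval, ev_cons, ev_nil, ev_hd, ev_tl, ev_V_zero, ev_V_succ,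
      true_and, and_true, hs, eval_nextF hlt]
    exact ⟨ok_nextF c (by omega), ok_featF _ _ hL.exponent hL.dim hL.name hL.tensor⟩

theorem ok_queryF {L : ℕ} (hL : Fits φ m r d L) (q : Data) :
    queryF.Ok L (.cons q (paramsData φ m r d)) := by
  have hw : ∀ f : Fn, (∀ (s : Game.State m v) (c : Clause v) z, q.tl.hd = ofBits (Game.name m s) →
      f.Ok L (.cons (clauseData c) (.cons z (.cons q (paramsData φ m r d))))) →
      (withActionF f).Ok L (.cons q (paramsData φ m r d)) := by
    intro f hf
    refine ok_caseUnary trivial fun g hg => ?_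
    rw [List.eq_of_mem_replicate hg]
    exact ok_guardF hL fun s c hs => hf s c _ hs
  refine ok_caseUnary trivial fun g hg => ?_
  simp only [List.mem_cons, List.not_mem_nil, or_false] at hg
  rcases hg with rfl | rfl | rfl | rfl
  · exact hw _ fun _ _ _ _ => trivial
  · exact hw _ fun s c z hs => ok_transF hL hs
  · exact ok_guardF hL fun s c hs => ok_featSF hL hs
  · exact hw _ fun s c z hs => ok_featSAF hL hs

variable (w₀ : Fin v → Bool)

/-- The state of a call. -/
def callState : (Game.mdp φ m r d w₀).Call → Game.State m v
  | .reward s _ => s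
  | .trans s _ => s
  | .featS s => s
  | .featSA s _ => s

/-- The answer to a call if all rewards are zero. -/
noncomputable def callAnswer : (Game.mdp φ m r d w₀).Call → Data
  | .reward _ _ => ofRat 0
  | .trans s a => match Game.next φ m s a with
      | none => .nil
      | some s' => .cons .nil (ofBits (Game.name m s'))
  | .featS s => ofVec (Game.feat m r d s)
  | .featSA s a => ofVec ((Game.mdp φ m r d w₀).featSA s a)

theorem eval_lastF_name (s : Game.State m v) (z : Data) :
    lastF.eval (.cons (unary m) (.cons (ofBits (Game.name m s)) z)) =
      ofBool (decide ((s.1 : ℕ) + 1 = 2 ^ m)) := by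
  rw [Game.name, eval_lastF s.1.2]

theorem next_of_firstUnsat {s : Game.State m v} {c : Clause v}
    (hc : Game.firstUnsat φ s.2 = some c) (a : Fin 3) (h : (s.1 : ℕ) + 1 < 2 ^ m) :
    Game.next φ m s a = some (⟨(s.1 : ℕ) + 1, h⟩, Game.flipAt s.2 (c a).1) := by
  simp [Game.next, hc, h]

theorem eval_transF {q : Data} {s : Game.State m v} {c : Clause v} {z : Data} {a : Fin 3}
    (hc : Game.firstUnsat φ s.2 = some c) (hs : q.tl.hd = ofBits (Game.name m s))
    (ha : q.tl.tl = unary a) :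
    transF.eval (.cons (clauseData c) (.cons z (.cons q (paramsData φ m r d)))) =
      .cons .nil (match Game.next φ m s a with
        | none => .nil
        | some s' => .cons .nil (ofBits (Game.name m s'))) := by
  simp only [transF, paramsData, eval, ev_cons, ev_nil, ev_hd, ev_tl, ev_V_zero, ev_V_succ, hs,
    eval_lastF_name]
  by_cases h : (s.1 : ℕ) + 1 = 2 ^ m
  · rw [Game.next_eq_none.2 (.inr h)]
    simp only [h, decide_true]; rfl
  · have hlt : (s.1 : ℕ) + 1 < 2 ^ m := by have := s.1.2; omega
    simp only [h, decide_false, ofBool]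
    rw [next_of_firstUnsat hc a hlt, ha, eval_nextF hlt, action_unary]

theorem eval_featSAF {q : Data} {s : Game.State m v} {c : Clause v} {z : Data} {a : Fin 3}
    (hc : Game.firstUnsat φ s.2 = some c) (hs : q.tl.hd = ofBits (Game.name m s))
    (ha : q.tl.tl = unary a) :
    featSAF.eval (.cons (clauseData c) (.cons z (.cons q (paramsData φ m r d)))) =
      .cons .nil (ofVec ((Game.mdp φ m r d w₀).featSA s a)) := by
  classical
  have hs' : (Expr.hd (.tl (V 2))).ev (.cons (clauseData c) (.cons z (.cons q
    (paramsData φ m r d)))) = ofBits (Game.name m s) := hs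
  have hf : (Game.mdp φ m r d w₀).featSA s a = match Game.next φ m s a with
    | none => Game.feat m r d s
    | some s' => Game.feat m r d s' := rfl
  rw [hf]
  by_cases h : (s.1 : ℕ) + 1 = 2 ^ m
  · rw [Game.next_eq_none.2 (.inr h)]
    rw [featSAF, eval_ite, if_neg, eval_featSF hs']
    simp only [paramsData, eval, ev_cons, ev_nil, ev_hd, ev_tl, ev_V_zero, ev_V_succ, hs,
      eval_lastF_name, h, decide_true]
    simp [ofBool]
  · have hlt : (s.1 : ℕ) + 1 < 2 ^ m := by have := s.1.2; omega
    rw [next_of_firstUnsat hc a hlt, featSAF, eval_ite, if_pos]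
    · simp only [paramsData, eval, ev_cons, ev_nil, ev_hd, ev_tl, ev_V_zero, ev_V_succ, hs, ha]
      rw [eval_nextF hlt, action_unary, eval_featF]
    · simp only [paramsData, eval, ev_cons, ev_nil, ev_hd, ev_tl, ev_V_zero, ev_V_succ, hs,
        eval_lastF_name, h, decide_false]
      rfl

-- `queryF` does not know `w₀`: transitions and features do not depend on it, the reward is answered
-- by zero, and the states where the true reward could be large make the simulation abort.
open Classical in
theorem eval_queryF_call (c : (Game.mdp φ m r d w₀).Call) :
    queryF.eval (.cons c.toData (paramsData φ m r d)) =
      if Satisfies (callState w₀ c).2 φ then .cons (ofBool true) .nil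
      else .cons .nil (callAnswer w₀ c) := by
  have key : ∀ (f : Fn) (e : Expr) (q : Data) (s : Game.State m v) (y : Data),
      e.ev (.cons q (paramsData φ m r d)) = ofBits (Game.name m s) →
      (∀ cl, Game.firstUnsat φ s.2 = some cl → f.eval (.cons (clauseData cl)
        (.cons (ofBits (List.ofFn s.2)) (.cons q (paramsData φ m r d)))) = .cons .nil y) →
      (guardF e f).eval (.cons q (paramsData φ m r d)) =
        if Satisfies s.2 φ then .cons (ofBool true) .nil else .cons .nil y := by
    intro f e q s y he hf
    rw [eval_guardF he]
    rcases h : Game.firstUnsat φ s.2 with _ | cl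
    · rw [if_pos ((Game.firstUnsat_eq_none φ).1 h)]
    · rw [if_neg (fun h' => by simp [(Game.firstUnsat_eq_none φ).2 h'] at h)]
      exact hf cl h
  have hact : ∀ (f : Fn) (q : Data) (a : Fin 3), q.tl.tl = unary a →
      (withActionF f).eval (.cons q (paramsData φ m r d)) =
        (guardF (.hd (.tl (V 0))) f).eval (.cons q (paramsData φ m r d)) := by
    intro f q a ha
    refine (eval_caseUnary badF (.tl (.tl (V 0))) (List.replicate 3 _) (.cons q (paramsData φ m r d)) (a : ℕ) ha
      (by simp)).trans ?_
    rw [List.getElem_replicate]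
  cases c with
  | reward s a =>
    rw [queryF, eval_caseUnary _ _ _ _ 0 rfl (by simp)]
    refine (hact _ _ a rfl).trans (key _ _ _ s _ rfl fun cl hcl => ?_)
    simp only [rewardF, eval, ev_cons, ev_nil, ev_zeroE, callAnswer]
  | trans s a =>
    rw [queryF, eval_caseUnary _ _ _ _ 1 rfl (by simp)]
    exact (hact _ _ a rfl).trans (key _ _ _ s _ rfl fun cl hcl => eval_transF hcl rfl rfl)
  | featS s =>
    rw [queryF, eval_caseUnary _ _ _ _ 2 rfl (by simp)]
    exact key _ _ _ s _ rfl fun cl hcl => eval_featSF rfl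
  | featSA s a =>
    rw [queryF, eval_caseUnary _ _ _ _ 3 rfl (by simp)]
    exact (hact _ _ a rfl).trans (key _ _ _ s _ rfl fun cl hcl => eval_featSAF w₀ hcl rfl rfl)

theorem eval_queryF_of_not_call (hm : 0 < m) {q : Data}
    (hq : ∀ c : (Game.mdp φ m r d w₀).Call, c.toData ≠ q) :
    queryF.eval (.cons q (paramsData φ m r d)) = .cons .nil .nil := by
  -- Components of `nil` are `nil`, so a malformed query could pass for a call if the empty string
  -- were a name; `0 < m` excludes this.
  have hname : ∀ s : Game.State m v, ofBits (Game.name m s) ≠ .nil := by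
    intro s h
    have := congrArg Data.len h
    rw [len_ofBits, Game.length_name, Data.len] at this
    omega
  have hact : ∀ (f : Fn) (t : ℕ), q.hd = unary t →
      (∀ (s : Game.State m v) (a : Fin 3),
        .cons (unary t) (.cons (ofBits (Game.name m s)) (unary a)) ≠ q) →
      (withActionF f).eval (.cons q (paramsData φ m r d)) = .cons .nil .nil := by
    intro f t ht hq'
    by_cases ha : ∃ n < 3, q.tl.tl = unary n
    · obtain ⟨n, hn, ha⟩ := ha
      refine (eval_caseUnary badF (.tl (.tl (V 0))) (List.replicate 3 _) (.cons q (paramsData φ m r d)) n ha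
        (by simpa using hn)).trans ?_
      rw [List.getElem_replicate]
      refine eval_guardF_bad fun s hs => ?_
      have hs : q.tl.hd = ofBits (Game.name m s) := hs
      refine hq' s ⟨n, hn⟩ ?_
      rcases q with _ | ⟨x, _ | ⟨y, z⟩⟩
      · exact absurd hs.symm (hname s)
      · exact absurd hs.symm (hname s)
      · simp only [hd_cons, tl_cons] at ht hs ha
        rw [ht, hs, ha]
    · rw [withActionF, eval_caseUnary_bad]
      · rfl
      · intro n hn h
        exact ha ⟨n, by simpa using hn, h⟩
  by_cases ht : ∃ n < 4, q.hd = unary n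
  · obtain ⟨n, hn, ht⟩ := ht
    refine (eval_caseUnary badF (.hd (V 0)) [_, _, _, _] (.cons q (paramsData φ m r d)) n ht
      (by simpa using hn)).trans ?_
    interval_cases n
    · exact hact _ _ ht fun s a => hq (.reward s a)
    · exact hact _ _ ht fun s a => hq (.trans s a)
    · refine eval_guardF_bad fun s hs => ?_
      have hs : q.tl = ofBits (Game.name m s) := hs
      rcases q with _ | ⟨x, y⟩
      · exact hname s hs.symm
      · refine hq (.featS s) ?_
        simp only [hd_cons, tl_cons] at ht hs
        rw [ht, hs]; rfl
    · exact hact _ _ ht fun s a => hq (.featSA s a)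
  · rw [queryF, eval_caseUnary_bad]
    · rfl
    · intro n hn h
      exact ht ⟨n, by simpa using hn, h⟩

end Query

end Fn

open Data

namespace Fn

/-! ### Walking along a list of actions -/

section Walk

variable {v : ℕ} (φ : Formula v) (m r d : ℕ)

/-- One step of the walk along a list of actions; `none` means that a satisfying assignment has been
found. -/
def walkStep : Option (Game.State m v × Data) → Option (Game.State m v × Data)
  | none => none
  | some (s, y) => match Game.firstUnsat φ s.2 with
    | none => none
    | some _ => match Game.next φ m s (action y.hd) with
      | none => some (s, y)
      | some s' => some (s', y.tl)

/-- Term for a step of the walk. -/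
def walkStepF : Fn :=
  ite (ex (V 1))
    (lt (comp (ex (.cons (V 3) (.cons (.hd (V 1)) .nil))) dropF) <|
      lt (comp (ex (.cons (V 0) (.cons (V 9) .nil))) unsatF) <|
        ite (ex (V 0))
          (ite (comp (ex (.cons (V 5) (.cons (.hd (V 3)) .nil))) lastF) (ex (V 3)) <|
            lt (comp (ex (.cons (.hd (V 3)) (.cons (V 0) (.cons (.hd (.tl (V 3)))
              (.cons (V 5) .nil))))) nextF) (ex (.cons (V 0) (.tl (.tl (V 4)))))) (ex .nil))
    (ex .nil)

/-- Test whether the walk along a list of actions finds a satisfying assignment. -/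
def walkF : Fn := ite (fold (ex (V 5)) (ex (.cons (V 4) (V 0))) walkStepF) (ex .nil) (ex tt)

variable {φ m r d}

/-- State of the walk as a tree. -/
def walkData : Option (Game.State m v × Data) → Data
  | none => .nil
  | some (s, y) => .cons (ofBits (Game.name m s)) y

theorem eval_walkStepF (o : Option (Game.State m v × Data)) (y z : Data) :
    walkStepF.eval (.cons z (.cons (walkData o) (.cons y (paramsData φ m r d)))) =
      walkData (walkStep φ m o) := by
  classical
  rcases o with _ | ⟨s, y'⟩
  · rfl
  have h2 : (Game.name m s).drop m = List.ofFn s.2 := by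
    rw [Game.name, List.drop_left' (length_bitList _ _)]
  rw [walkStepF, eval_ite, if_neg (by simp [walkData, eval, ev_V_zero, ev_V_succ])]
  simp only [walkData, paramsData, eval, ev_cons, ev_nil, ev_hd, ev_tl, ev_V_zero, ev_V_succ,
    eval_dropF, iterate_tl_ofBits, h2, eval_unsatF, hd_cons, tl_cons, eval_lastF_name]
  rcases hc : Game.firstUnsat φ s.2 with _ | c
  · simp [walkStep, hc]
  · have hstep : walkStep φ m (some (s, y')) = match Game.next φ m s (action y'.hd) with
      | none => some (s, y')
      | some s' => some (s', y'.tl) := by simp [walkStep, hc]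
    rw [hstep]
    by_cases h : (s.1 : ℕ) + 1 = 2 ^ m
    · rw [Game.next_eq_none.2 (.inr h)]
      simp only [h, decide_true, clauseData_eq]
      rfl
    · have hlt : (s.1 : ℕ) + 1 < 2 ^ m := by have := s.1.2; omega
      rw [next_of_firstUnsat hc _ hlt]
      simp only [h, decide_false, eval_nextF hlt]
      simp only [clauseData_eq]
      rfl

theorem ofBits_name_start (w₀ : Fin v → Bool) :
    ofBits (Game.name m (Game.mdp φ m r d w₀).start) = unary (m + v) := by
  have h : ∀ m, bitList m 0 = List.replicate m false := by
    intro m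
    induction m with
    | zero => rfl
    | succ m ih => simp [bitList, ih, List.replicate_succ]
  rw [unary_eq_ofBits, List.replicate_add, ← h]
  simp only [Game.name, Game.mdp]
  congr 2
  simp

theorem fold_walk (w₀ : Fin v → Bool) (y : Data) (n : ℕ) :
    (fun acc => walkStepF.eval (.cons .nil (.cons acc (.cons y (paramsData φ m r d)))))^[n]
      (.cons (unary (m + v)) y) =
      walkData ((walkStep φ m)^[n] (some ((Game.mdp φ m r d w₀).start, y))) := by
  induction n with
  | zero => rw [Function.iterate_zero_apply, Function.iterate_zero_apply, ← ofBits_name_start w₀]; rfl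
  | succ n ih => rw [Function.iterate_succ_apply', Function.iterate_succ_apply', ih, eval_walkStepF]

theorem eval_walkF (w₀ : Fin v → Bool) (y : Data) :
    walkF.eval (.cons y (paramsData φ m r d)) = ofBool
      ((walkStep φ m)^[2 ^ m] (some ((Game.mdp φ m r d w₀).start, y))).isNone := by
  have h5 : (V 5).ev (.cons y (paramsData φ m r d)) = unary (2 ^ m) := rfl
  have h4 : (V 4).ev (.cons y (paramsData φ m r d)) = unary (m + v) := rfl
  simp only [walkF, eval, h5, h4, ev_cons, ev_V_zero, fold_unary]
  rw [fold_walk w₀ y]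
  cases (walkStep φ m)^[2 ^ m] (some ((Game.mdp φ m r d w₀).start, y)) <;> rfl

theorem ok_walkF {L : ℕ} (hL : Fits φ m r d L) (y : Data) :
    walkF.Ok L (.cons y (paramsData φ m r d)) := by
  have hn := hL.name
  have h5 : (V 5).ev (.cons y (paramsData φ m r d)) = unary (2 ^ m) := rfl
  have h4 : (V 4).ev (.cons y (paramsData φ m r d)) = unary (m + v) := rfl
  simp only [walkF, ok_ite, ok_ex, implies_true, and_true]
  refine ⟨trivial, trivial, ?_, ?_⟩
  · rw [eval, h5, len_unary]; exact hL.steps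
  simp only [eval, h5, h4, ev_cons, ev_V_zero]
  refine FoldAll.unary fun i _ => ?_
  -- The starting state does not depend on the assignment that defines the rewards, so any
  -- assignment may be inserted.
  rw [fold_walk (fun _ => false)]
  generalize (walkStep φ m)^[i] _ = o
  rcases o with _ | ⟨s, y'⟩
  · rw [walkStepF, ok_ite]
    exact ⟨trivial, fun _ => trivial, fun h => absurd rfl h⟩
  have h2 : (Game.name m s).drop m = List.ofFn s.2 := by
    rw [Game.name, List.drop_left' (length_bitList _ _)]
  simp only [walkStepF, walkData, paramsData, ok_ite, ok_ex, ok_lt, ok_comp, eval, ev_cons, ev_nil,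
    ev_hd, ev_tl, ev_V_zero, ev_V_succ, eval_dropF, iterate_tl_ofBits, h2, eval_unsatF, hd_cons,
    tl_cons, true_and, implies_true, and_true]
  refine fun _ => ⟨ok_dropF (by rw [len_unary]; omega),
    ok_unsatF φ hL.three_le (by omega) hL.clauses, fun hc => ?_⟩
  split at hc
  · exact absurd rfl hc
  · exact ⟨ok_lastF (by rw [len_unary]; omega), fun _ => ok_nextF _ (by omega)⟩

theorem walk_of_unsat (hφ : ¬ ∃ w, Satisfies w φ) (n : ℕ) (s : Game.State m v) (y : Data) :
    ((walkStep φ m)^[n] (some (s, y))).isNone = false := by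
  induction n generalizing s y with
  | zero => rfl
  | succ n ih =>
    have : ∃ c, Game.firstUnsat φ s.2 = some c := by
      rw [← Option.ne_none_iff_exists', Ne, Game.firstUnsat_eq_none]
      exact fun h => hφ ⟨_, h⟩
    obtain ⟨c, hc⟩ := this
    rw [Function.iterate_succ_apply]
    cases h : Game.next φ m s (action y.hd) <;> simp [walkStep, hc, h, ih]

/-- A walk that misses all satisfying assignments runs until the counter is exhausted, where the
return is at most `((1 + v) / 2 ^ m) ^ r`. The optimum at the start is at least `1 - r * v / 2 ^ m`,
so by `hval` such a policy loses at least `1 / 4`. -/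
theorem walk_of_good {w₀ : Fin v → Bool} (hw₀ : Satisfies w₀ φ)
    (hval : (r : ℝ) * v / 2 ^ m + ((1 + v) / 2 ^ m) ^ r ≤ 3 / 4)
    {y : Data} (hy : y ∈ (Game.mdp φ m r d w₀).goodOutputs) :
    ((walkStep φ m)^[2 ^ m] (some ((Game.mdp φ m r d w₀).start, y))).isNone = true := by
  set M := Game.mdp φ m r d w₀ with hM
  obtain ⟨as, π, hy, hdesc, hV⟩ := hy
  set f : Fin 3 → Data := fun a => unary a with hf
  -- In `goodOutputs` the list of actions is coerced to a list of naturals before `unary` is mapped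
  -- over it; here the two maps are fused.
  obtain rfl : y = ofList (as.map f) := by
    have e : ∀ l : List (Fin 3),
        List.map (fun a : ℕ => unary a) (l >>= fun a => pure a.val) = List.map f l := by
      intro l
      induction l with
      | nil => rfl
      | cons a l ih => simpa [hf] using ih
    rw [hy]
    exact congrArg ofList (e as)
  by_contra hne
  have hstay : ∀ n, (walkStep φ m)^[n] none = none := by
    intro n
    induction n with
    | zero => rfl
    | succ n ih => rw [Function.iterate_succ_apply', ih]; rfl
  -- `none` is absorbing, so a walk that has not succeeded at the end did not succeed earlier.
  have hsome : ∀ n ≤ 2 ^ m, (walkStep φ m)^[n] (some (M.start, ofList (as.map f))) ≠ none := by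
    intro n hn h
    obtain ⟨j, hj⟩ := Nat.exists_eq_add_of_le' hn
    rw [hj, Function.iterate_add_apply, h, hstay] at hne
    exact hne rfl
  -- Without success the walk replays the trajectory of `π`, with `as.drop t` as the unread actions;
  -- as no reward is paid on the way, the return from the start is the return from the current
  -- state.
  have key : ∀ t, t < 2 ^ m → ∃ s : Game.State m v, (s.1 : ℕ) = t ∧
      M.traj π M.start t = some s ∧
      (walkStep φ m)^[t] (some (M.start, ofList (as.map f))) =
        some (s, ofList ((as.drop t).map f)) ∧
      M.returnDist π (2 ^ m) (some M.start) = M.returnDist π (2 ^ m - t) (some s) := by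
    intro t
    induction t with
    | zero => exact fun _ => ⟨M.start, rfl, rfl, rfl, rfl⟩
    | succ t ih =>
      intro ht
      obtain ⟨s, hs, htr, hw, hr⟩ := ih (by omega)
      have ha := hdesc t s htr
      have hdrop : as.drop t = π s :: as.drop (t + 1) := by
        obtain ⟨hlt, ha⟩ := List.getElem?_eq_some_iff.1 ha
        rw [List.drop_eq_getElem_cons hlt, ha]
      have hc : ∃ c, Game.firstUnsat φ s.2 = some c := by
        rw [← Option.ne_none_iff_exists']
        intro h
        refine hsome (t + 1) ht.le ?_
        rw [Function.iterate_succ_apply', hw]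
        simp [walkStep, h]
      obtain ⟨c, hc⟩ := hc
      have hnext := next_of_firstUnsat hc (π s) (by omega)
      refine ⟨(⟨s.1 + 1, by omega⟩, Game.flipAt s.2 (c (π s)).1), congrArg (· + 1) hs, ?_, ?_, ?_⟩
      · rw [MDP.traj, Function.iterate_succ_apply']
        rw [MDP.traj] at htr
        rw [htr]
        exact hnext
      · rw [Function.iterate_succ_apply', hw, hdrop]
        have hact : action (ofList (((π s :: as.drop (t + 1))).map f)).hd = π s :=
          action_unary (π s)
        have : walkStep φ m (some (s, ofList ((π s :: as.drop (t + 1)).map f))) =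
            match Game.next φ m s (action (ofList (((π s :: as.drop (t + 1))).map f)).hd) with
            | none => some (s, ofList ((π s :: as.drop (t + 1)).map f))
            | some s' => some (s', (ofList ((π s :: as.drop (t + 1)).map f)).tl) := by
          simp only [walkStep, hc]
        rw [this, hact, hnext]
        rfl
      · rw [hr, show 2 ^ m - t = (2 ^ m - (t + 1)) + 1 by omega]
        exact Game.returnDist_some r d w₀ _ hnext
  have h1 : 1 ≤ 2 ^ m := Nat.one_le_two_pow
  obtain ⟨s, hs, -, -, hr⟩ := key (2 ^ m - 1) (by omega)
  have hlast : (s.1 : ℕ) + 1 = 2 ^ m := by omega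
  have hVle : M.V π M.start ≤ ((1 + v) / 2 ^ m) ^ r := by
    have : M.V π M.start = Game.value m r w₀ s := by
      rw [MDP.V]
      have e : M.horizon = 2 ^ m := rfl
      rw [e, hr, show 2 ^ m - (2 ^ m - 1) = 0 + 1 by omega]
      exact Game.expect_returnDist_none r d w₀ 0 (Game.next_eq_none.2 (.inr hlast))
    rw [this]
    exact Game.value_last_le r w₀ hlast
  have hVs : M.Vstar M.start = Game.value m r w₀ M.start := Game.Vstar_eq r d w₀ hw₀ _
  have hge : 1 - r * v / 2 ^ m ≤ Game.value m r w₀ M.start := Game.value_start_ge (φ := φ) r d w₀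
  rw [hVs] at hV
  linarith

end Walk

/-! ### Arithmetic in unary -/

/-- A number in unary, as an expression. -/
def constE : ℕ → Expr
  | 0 => .nil
  | n + 1 => .cons .nil (constE n)

theorem ev_constE (n : ℕ) (x : Data) : (constE n).ev x = unary n := by
  induction n with
  | zero => rfl
  | succ n ih => rw [constE, ev_cons, ih]; rfl

/-- Multiplication. -/
def mulF : Fn := fold (ex (V 0)) (ex .nil) (fold (ex (V 3)) (ex (V 1)) (ex (.cons .nil (V 1))))

theorem fold_cons_nil (n k : ℕ) :
    Data.fold (fun _ acc => .cons .nil acc) (unary n) (unary k) = unary (k + n) := by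
  induction n generalizing k with
  | zero => rfl
  | succ n ih => exact (ih (k + 1)).trans (by congr 1; omega)

theorem eval_mulF (a b : ℕ) (z : Data) :
    mulF.eval (.cons (unary a) (.cons (unary b) z)) = unary (a * b) := by
  simp only [mulF, eval, ev_V_zero, ev_V_succ, ev_nil, ev_cons]
  rw [fold_unary]
  induction a with
  | zero => simp [unary, ofList]
  | succ a ih => rw [Function.iterate_succ_apply', ih, fold_cons_nil, Nat.succ_mul]

theorem ok_mulF {L a b : ℕ} {z : Data} (ha : a ≤ L) (hb : b ≤ L) :
    mulF.Ok L (.cons (unary a) (.cons (unary b) z)) := by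
  refine ⟨trivial, trivial, (len_unary a).trans_le ha, .of_forall (fun _ _ => ?_) _ _⟩
  exact ⟨trivial, trivial, (len_unary b).trans_le hb, .of_forall (fun _ _ => trivial) _ _⟩

/-- Power of two. -/
def powF : Fn := fold (ex (V 0)) (ex tt) (fold (ex (V 1)) (ex (V 1)) (ex (.cons .nil (V 1))))

theorem iterate_powF (a : ℕ) (x : Data) :
    (fun acc => (fold (ex (V 1)) (ex (V 1)) (ex (.cons .nil (V 1)))).eval
      (.cons .nil (.cons acc x)))^[a] (unary 1) = unary (2 ^ a) := by
  induction a with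
  | zero => rfl
  | succ a ih =>
    rw [Function.iterate_succ_apply', ih]
    simp only [eval, ev_V_zero, ev_V_succ, ev_nil, ev_cons]
    rw [fold_cons_nil, pow_succ, mul_two]

theorem eval_powF (a : ℕ) (z : Data) : powF.eval (.cons (unary a) z) = unary (2 ^ a) := by
  rw [powF, eval]
  simp only [eval.eq_1, ev_V_zero]
  rw [fold_unary]
  exact iterate_powF a _

theorem ok_powF {L a : ℕ} {z : Data} (ha : 2 ^ a ≤ L) : powF.Ok L (.cons (unary a) z) := by
  refine ⟨trivial, trivial, (len_unary a).trans_le (Nat.lt_two_pow_self.le.trans ha), ?_⟩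
  refine FoldAll.unary fun i hi => ⟨trivial, trivial, ?_, .of_forall (fun _ _ => trivial) _ _⟩
  have e := iterate_powF i (.cons (unary a) z)
  change ((fun acc => (fold (ex (V 1)) (ex (V 1)) (ex (.cons .nil (V 1)))).eval
      (.cons .nil (.cons acc (.cons (unary a) z))))^[i] (unary 1)).len ≤ L
  rw [e, len_unary]
  exact (Nat.pow_le_pow_right (by norm_num) hi.le).trans ha

/-- Replace `(k, p)` by `(k + 1, 8 p)` if `p ≤ v`. -/
def logStep (v : ℕ) (x : ℕ × ℕ) : ℕ × ℕ := if x.2 ≤ v then (x.1 + 1, 8 * x.2) else x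

/-- The least `k` such that `v < 8 ^ k`. -/
def log8 (v : ℕ) : ℕ := ((logStep v)^[v] (0, 1)).1

/-- Either the power has exceeded `v` and the iteration is stationary, or every step so far
multiplied by 8. The last alternative says that the power overshoots `v` by at most a factor 8. -/
theorem iterate_logStep (v n : ℕ) : ∃ k, (logStep v)^[n] (0, 1) = (k, 8 ^ k) ∧
    (v < 8 ^ k ∨ k = n) ∧ (k = 0 ∨ 8 ^ (k - 1) ≤ v) := by
  induction n with
  | zero => exact ⟨0, rfl, .inr rfl, .inl rfl⟩
  | succ n ih =>
    obtain ⟨k, h1, h2, h3⟩ := ih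
    rw [Function.iterate_succ_apply', h1]
    by_cases h : 8 ^ k ≤ v
    · refine ⟨k + 1, by simp [logStep, h, pow_succ'], .inr ?_, .inr (by simpa using h)⟩
      rcases h2 with h2 | h2 <;> omega
    · exact ⟨k, by simp [logStep, h], .inl (by omega), h3⟩

theorem lt_pow_log8 (v : ℕ) : v < 8 ^ log8 v := by
  obtain ⟨k, h1, h2, -⟩ := iterate_logStep v v
  have : log8 v = k := by rw [log8, h1]
  rw [this]
  rcases h2 with h2 | rfl
  · exact h2
  · exact Nat.lt_pow_self (by norm_num)

theorem pow_log8_le (v : ℕ) : 8 ^ log8 v ≤ 8 * v + 1 := by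
  obtain ⟨k, h1, -, h3⟩ := iterate_logStep v v
  have : log8 v = k := by rw [log8, h1]
  rw [this]
  rcases h3 with rfl | h3
  · simp
  · cases k with
    | zero => simp
    | succ k => rw [pow_succ']; simp at h3; omega

/-- Term for `logStep`. -/
def logStepF : Fn :=
  ite (comp (ex (.cons (V 2) (.cons (.tl (V 1)) .nil))) dropF) (ex (V 1)) <|
    lt (comp (ex (.cons (constE 8) (.cons (.tl (V 1)) .nil))) mulF)
      (ex (.cons (.cons .nil (.hd (V 2))) (V 0)))

/-- Term for `log8`. -/
def logF : Fn := comp (fold (ex (V 0)) (ex (.cons .nil tt)) logStepF) (ex (.hd (.var 0)))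

/-- A pair of numbers in unary. -/
def pairData (x : ℕ × ℕ) : Data := .cons (unary x.1) (unary x.2)

theorem iterate_tl_unary (n k : ℕ) : Data.tl^[n] (unary k) = unary (k - n) := by
  rw [unary_eq_ofBits, iterate_tl_ofBits, List.drop_replicate, ← unary_eq_ofBits]

theorem eval_logStepF (v : ℕ) (x : ℕ × ℕ) (y z : Data) :
    logStepF.eval (.cons y (.cons (pairData x) (.cons (unary v) z))) = pairData (logStep v x) := by
  classical
  rw [logStepF, eval_ite]
  simp only [pairData, eval, ev_cons, ev_nil, ev_hd, ev_tl, ev_V_zero, ev_V_succ, hd_cons, tl_cons,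
    eval_dropF, iterate_tl_unary, ev_constE, eval_mulF]
  by_cases h : x.2 ≤ v
  · rw [if_pos (by rw [Nat.sub_eq_zero_of_le h]; rfl), logStep, if_pos h]; rfl
  · rw [if_neg, logStep, if_neg h]
    intro h'
    have := congrArg Data.len h'
    rw [len_unary, Data.len] at this
    omega

theorem fold_log (v n : ℕ) (z : Data) :
    (fun acc => logStepF.eval (.cons .nil (.cons acc (.cons (unary v) z))))^[n]
      (pairData (0, 1)) = pairData ((logStep v)^[n] (0, 1)) := by
  induction n with
  | zero => rfl
  | succ n ih => rw [Function.iterate_succ_apply', Function.iterate_succ_apply', ih, eval_logStepF]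

theorem eval_logF (v : ℕ) (z : Data) : logF.eval (.cons (unary v) z) = unary (log8 v) := by
  have h := fold_log v v z
  refine congrArg Data.hd (?_ : Data.fold (fun y acc => logStepF.eval (.cons y (.cons acc
    (.cons (unary v) z)))) (unary v) (pairData (0, 1)) = pairData ((logStep v)^[v] (0, 1)))
  rw [fold_unary]
  exact h

theorem ok_logF {L v : ℕ} {z : Data} (h8 : 8 ≤ L) (hv : 8 * v + 1 ≤ L) :
    logF.Ok L (.cons (unary v) z) := by
  refine ⟨⟨trivial, trivial, (len_unary v).trans_le (by omega), ?_⟩, trivial⟩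
  refine FoldAll.unary fun i hi => ?_
  have e := fold_log v i z
  change logStepF.Ok L (.cons .nil (.cons ((fun acc => logStepF.eval (.cons .nil (.cons acc
    (.cons (unary v) z))))^[i] (pairData (0, 1))) (.cons (unary v) z)))
  rw [e]
  obtain ⟨k, hk, -, hk'⟩ := iterate_logStep v i
  rw [hk]
  simp only [logStepF, pairData, ok_ite, ok_ex, ok_lt, ok_comp, eval, ev_cons, ev_nil, ev_tl,
    ev_V_zero, ev_V_succ, tl_cons, ev_constE, true_and, implies_true, and_true]
  refine ⟨ok_dropF (by rw [len_unary]; omega), fun _ => ok_mulF h8 (le_trans ?_ hv)⟩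
  rcases hk' with rfl | hk'
  · simp
  · cases k with
    | zero => simp
    | succ k => rw [pow_succ']; simp at hk'; omega

/-! ### Parameters of the reduction -/

section Setup

variable (N c₀ v : ℕ)

/-- The scale of the reduction. -/
def scale : ℕ := log8 v + N

/-- The degree of the value function. -/
def degree : ℕ := 2 ^ scale N v

/-- The length of the counter. -/
def counter : ℕ := 4 * scale N v * degree N v

/-- Logarithm of the feature dimension. -/
def logDim : ℕ := counter N v + c₀

/-- The feature dimension. -/
def dim : ℕ := 2 ^ logDim N c₀ v

/-- The time limit of the simulation. -/
def limit : ℕ := 2 ^ (logDim N c₀ v * logDim N c₀ v)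

/-- Computation of the parameters: the time limit, the input of the simulated algorithm, and the
parameters of the oracle. -/
def setupF : Fn :=
  lt (comp (ex (.cons (V 0) .nil)) logF) <|
  lt (comp (ex (.cons (V 0) (.cons (constE N) .nil))) revAppF) <|
  lt (comp (ex (.cons (V 0) .nil)) powF) <|
  lt (comp (ex (.cons (constE 4) (.cons (V 1) .nil))) mulF) <|
  lt (comp (ex (.cons (V 0) (.cons (V 1) .nil))) mulF) <|
  lt (comp (ex (.cons (V 0) (.cons (constE c₀) .nil))) revAppF) <|
  lt (comp (ex (.cons (V 0) .nil)) powF) <|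
  lt (comp (ex (.cons (V 2) .nil)) powF) <|
  lt (comp (ex (.cons (V 3) (.cons (V 8) .nil))) revAppF) <|
  lt (comp (ex (.cons (V 3) (.cons (V 3) .nil))) mulF) <|
  lt (comp (ex (.cons (V 0) .nil)) powF) <|
  ex (.cons (V 0) (.cons (.cons (V 4) (.cons (V 3) (V 2))) (.cons (V 6) (.cons (V 8)
    (.cons (V 4) (.cons (V 2) (.cons (V 3) (.cons (tlE 12) .nil))))))))

variable {v}

theorem eval_setupF (φ : Formula v) (w₀ : Fin v → Bool) :
    (setupF N c₀).eval (formulaData φ) = .cons (unary (limit N c₀ v))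
      (.cons (Game.mdp φ (counter N v) (degree N v) (dim N c₀ v) w₀).input
        (paramsData φ (counter N v) (degree N v) (dim N c₀ v))) := by
  have h1 : (Game.mdp φ (counter N v) (degree N v) (dim N c₀ v) w₀).input =
      .cons (unary (dim N c₀ v)) (.cons (unary (2 ^ counter N v)) (unary (counter N v + v))) := by
    rw [← ofBits_name_start (φ := φ) (r := degree N v) (d := dim N c₀ v) w₀]; rfl
  -- After eleven pushed values the environment continues with `unary v`, so `tlE 12` in `setupF` is
  -- the list of clauses.
  have h2 : formulaData φ = .cons (unary v) (clausesData φ) := rfl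
  rw [h1, h2]
  simp only [setupF, eval, ev_cons, ev_nil, ev_V_zero, ev_V_succ, ev_constE, eval_logF,
    eval_revAppF_unary, eval_powF, eval_mulF, ev_tlE_succ, ev_tlE_zero]
  rfl

theorem ok_setupF {L : ℕ} (φ : Formula v) (h8 : 8 * v + 8 ≤ L)
    (hL : limit N c₀ v + (dim N c₀ v) + (counter N v) + N + c₀ + v + logDim N c₀ v ^ 2 ≤ L) :
    (setupF N c₀).Ok L (formulaData φ) := by
  have h2 : formulaData φ = .cons (unary v) (clausesData φ) := rfl
  have hs : scale N v ≤ counter N v := by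
    have : 1 ≤ degree N v := Nat.one_le_two_pow
    rw [counter]; nlinarith
  have hl : log8 v ≤ scale N v := Nat.le_add_right _ _
  have h4 : 4 * scale N v ≤ counter N v := Nat.le_mul_of_pos_right _ Nat.one_le_two_pow
  have hc : counter N v ≤ logDim N c₀ v := Nat.le_add_right _ _
  have hd : 2 ^ counter N v ≤ dim N c₀ v := Nat.pow_le_pow_right (by norm_num) hc
  have hr : degree N v ≤ dim N c₀ v := Nat.pow_le_pow_right (by norm_num) (hs.trans hc)
  have hsq : logDim N c₀ v ≤ logDim N c₀ v ^ 2 := Nat.le_self_pow (by norm_num) _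
  rw [h2]
  simp only [setupF, ok_lt, ok_comp, ok_ex, eval, ev_cons, ev_nil, ev_V_zero, ev_V_succ, ev_constE,
    eval_logF, eval_revAppF_unary, eval_powF, eval_mulF, true_and, and_true]
  refine ⟨ok_logF (by omega) (by omega), ok_revAppF (by rw [len_unary]; omega), ok_powF ?_,
    ok_mulF (by omega) ?_, ok_mulF ?_ ?_, ok_revAppF ?_, ok_powF ?_, ok_powF ?_, ok_revAppF ?_,
    ok_mulF ?_ ?_, ok_powF ?_⟩
  · change degree N v ≤ L; omega
  · change scale N v ≤ L; omega
  · change 4 * scale N v ≤ L; omega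
  · change degree N v ≤ L; omega
  · rw [len_unary]; change counter N v ≤ L; omega
  · change dim N c₀ v ≤ L; omega
  · change 2 ^ counter N v ≤ L; omega
  · rw [len_unary]; change counter N v ≤ L; omega
  · change logDim N c₀ v ≤ L; omega
  · change logDim N c₀ v ≤ L; omega
  · change limit N c₀ v ≤ L; omega

end Setup

end Fn

/-! ### The complete simulating program, and two potentials. -/

namespace Simulation

/-- Compute the parameters, then simulate. The value of `F` consists of the time limit (in unary),
the input of the simulated algorithm, and the parameters of the oracle. -/
def driver (F Qf W : Fn) (A : Program) : Program :=
  .seq (F.compile 0) <| .seq (.assign 2 (.hd (.var 0))) <| .seq (.assign 1 (.hd (.tl (.var 0)))) <|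
  .seq (.assign 0 (.tl (.tl (.var 0)))) <| .seq (.assign 4 .nil) <| .seq (sim Qf A) (post W)

theorem Potential.le_Pr_driver {F Qf W : Fn} {A : Program} {x x' P : Data} {t : ℕ} {Y : Set Data}
    {Φ : ℕ → List Program → Store → ℝ≥0∞} (O : Oracle)
    (hF : F.eval x = .cons (Data.unary t) (.cons x' P))
    (hΦ : Potential W P (answer Qf P) Y Φ) {S Sp N : ℕ}
    (hS : ∀ q, Qf.cost (.cons q P) + 20 ≤ S) (hSp : ∀ y, W.cost (.cons y P) + 3 ≤ Sp)
    (hN : F.cost x + 12 + (t * S + (1 + t) * 8 + Sp) ≤ N) :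
    Φ t [A] (start A x').store ≤ Pr O N (start (driver F Qf W A) x) Y := by
  set K : List Program := [.seq (.assign 2 (.hd (.var 0))) <|
    .seq (.assign 1 (.hd (.tl (.var 0)))) <| .seq (.assign 0 (.tl (.tl (.var 0)))) <|
    .seq (.assign 4 .nil) <| .seq (sim Qf A) (post W)] with hK
  obtain ⟨σ, h1, e1, f1⟩ := Fn.reach_compile O F 0 (start A x).store K
  have e0 : (start A x).store (2 * 0) = x := rfl
  rw [e0] at h1 e1
  replace e1 : σ 0 = .cons (Data.unary t) (.cons x' P) := e1.trans hF
  -- Variable 0 holds the value of `F` and is overwritten only after its other parts have been read.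
  -- Variable 4 is reset because the compiled `F` may have used it; the odd variables are untouched
  -- by compiled code.
  set τ := Function.update (Function.update (Function.update (Function.update σ 2 (Data.unary t))
    1 x') 0 P) 4 .nil with hτ
  have h2 : Reach O (start (driver F Qf W A) x) ⟨[sim Qf A, post W], τ⟩ (F.cost x + 12) := by
    refine .head (step_seq ..) (h1.trans (t := 11) (.head (step_seq ..) (.head (step_assign ..)
      (.head (step_seq ..) (.head (step_assign ..) (.head (step_seq ..) (.head (step_assign ..)
      (.head (step_seq ..) (.head (step_assign ..) (.head (step_seq ..) (s := 0) ?_ le_rfl) le_rfl)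
      le_rfl) le_rfl) le_rfl) le_rfl) le_rfl) le_rfl) (by omega))) (by omega)
    simp only [Expr.eval, e1, Data.hd, Data.tl, Function.update_of_ne (show (0 : ℕ) ≠ 2 by decide),
      Function.update_of_ne (show (0 : ℕ) ≠ 1 by decide)]
    exact .refl _ _ _
  have hσ : StoreRel P t (start A x').store τ := by
    refine ⟨fun y => ?_, by simp [hτ], by simp [hτ], by simp [hτ]⟩
    rw [hτ, Function.update_of_ne (by omega), Function.update_of_ne (by omega)]
    rcases eq_or_ne y 0 with rfl | hy
    · simp [start]
    · rw [Function.update_of_ne (by omega), Function.update_of_ne (by omega), f1 _ (by omega)]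
      simp [start, hy]
  exact (hΦ.le_Pr O hS hSp t [A] _ _ _ (.cons A .done) hσ).trans
    (h2.le_Pr (by simpa [add_comm] using hN) Y)

variable {W : Fn} {P : Data} {ans : Data → Option Data} {Y : Set Data}

/-- If every output of the simulation lies in `Y`, then it has such an output surely. -/
theorem Potential.one (hW : ∀ y, W.eval (.cons y P) ∈ Y)
    (hans : ∀ q, ans q = none → Data.cons .nil .nil ∈ Y) :
    Potential W P ans Y fun _ _ _ => 1 := by
  refine ⟨fun k σ => ?_, fun t σ => ?_, fun _ _ _ => le_rfl, fun _ _ _ _ _ => le_rfl,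
    fun t x k σ => ?_, fun _ _ _ _ _ _ _ => le_rfl, fun t x e k σ h => ?_, fun _ _ _ _ _ => le_rfl,
    fun _ _ _ _ _ _ _ => le_rfl, fun _ _ _ _ _ _ _ => le_rfl, fun _ _ _ _ _ _ => le_rfl,
    fun _ _ _ _ _ _ => le_rfl⟩
  · rw [if_pos (hW _)]
  · rw [if_pos (hW _)]
  · rw [mul_one, ENNReal.inv_two_add_inv_two]
  · rw [if_pos (hans _ h)]

/-- If the answers of the simulated oracle differ from those of `O` with probability at most `p`,
then the output of the simulation differs with probability at most `p` times the number of steps. -/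
theorem Potential.of_oracle {O : Oracle} {p : ℝ≥0∞} {G : Set Data} (a : ℕ)
    (hG : ∀ y ∈ G, W.eval (.cons y P) ∈ Y) (h_abort : Data.cons .nil .nil ∈ Y)
    (hans : ∀ q y, ans q = some y → ∀ h : Data → ℝ≥0∞, (∀ z, h z ≤ 1) →
      ∑' z, O q z * h z ≤ h y + p) :
    Potential W P ans Y fun t k σ => Pr O (t - a) ⟨k, σ⟩ G - (t - a : ℕ) * p := by
  classical
  have hone : ∀ (n : ℕ) k σ, Pr O n ⟨k, σ⟩ G - n * p ≤ 1 := fun n k σ =>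
    tsub_le_self.trans (Pr_le_one ..)
  have halt : ∀ (n : ℕ) (σ : Store), (if σ 0 ∈ G then (1 : ℝ≥0∞) else 0) ≤
      if W.eval (.cons (σ 0) P) ∈ Y then 1 else 0 := by
    intro n σ
    split_ifs with h1 h2
    · exact le_rfl
    · exact absurd (hG _ h1) h2
    · exact zero_le
    · exact zero_le
  -- The clock of the simulation exceeds the time of the algorithm by `a`. For `t < a` truncated
  -- subtraction leaves no steps before the next move, and a nonempty stack has not halted, so the
  -- potential there is zero.
  have hz : ∀ c k σ, Pr O 0 ⟨c :: k, σ⟩ G = 0 := fun c k σ => by rw [Pr_zero]; simp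
  have det : ∀ t c k σ k' σ', step O ⟨c :: k, σ⟩ = PMF.pure ⟨k', σ'⟩ →
      Pr O (t + 1 - a) ⟨c :: k, σ⟩ G - (t + 1 - a : ℕ) * p ≤
        Pr O (t - a) ⟨k', σ'⟩ G - (t - a : ℕ) * p := by
    intro t c k σ k' σ' h
    rcases le_or_gt a t with hat | hat
    · rw [Nat.sub_add_comm hat, Pr_succ_of_step h]
      gcongr
      exact Nat.le_succ _
    · rw [Nat.sub_eq_zero_of_le hat, hz]; simp
  refine ⟨fun k σ => ?_, fun t σ => ?_, fun t k σ => det _ _ _ _ _ _ (step_skip ..),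
    fun t x e k σ => det _ _ _ _ _ _ (step_assign ..), fun t x k σ => ?_,
    fun t x e k σ y hy => ?_, fun t x e k σ _ => by rw [if_pos h_abort]; exact hone _ _ _,
    fun t p q k σ => det _ _ _ _ _ _ (step_seq ..),
    fun t e p q k σ h => det _ _ _ _ _ _ (step_ite_nil _ _ _ _ _ h),
    fun t e p q k σ h => det _ _ _ _ _ _ (step_ite_ne _ _ _ _ _ h),
    fun t e p k σ h => det _ _ _ _ _ _ (step_loop_nil _ _ _ _ h),
    fun t e p k σ h => det _ _ _ _ _ _ (step_loop_ne _ _ _ _ h)⟩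
  · refine tsub_le_self.trans (le_trans ?_ (halt 0 σ))
    rw [Nat.zero_sub, Pr_zero]
    split_ifs <;> simp_all
  · exact tsub_le_self.trans ((Pr_halted ..).trans_le (halt 0 σ))
  · rcases le_or_gt a t with hat | hat
    · rw [Nat.sub_add_comm hat, Pr_succ_of_step_map (μ := PMF.uniformOfFintype Bool)
        (g := fun b => ⟨k, Function.update σ x (Data.ofBool b)⟩) (by simp [step]), tsum_bool,
        tsub_le_iff_right]
      simp only [PMF.uniformOfFintype_apply, Fintype.card_bool, Nat.cast_ofNat]
      -- The error term is subtracted from both outcomes of the coin; truncation at zero only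
      -- increases the right side.
      have key : ∀ x y z : ℝ≥0∞, 2⁻¹ * x + 2⁻¹ * y ≤ 2⁻¹ * (y - z) + 2⁻¹ * (x - z) + z := by
        intro x y z
        calc 2⁻¹ * x + 2⁻¹ * y ≤ 2⁻¹ * (x - z + z) + 2⁻¹ * (y - z + z) := by
              gcongr <;> exact le_tsub_add
          _ = 2⁻¹ * (y - z) + 2⁻¹ * (x - z) + (2⁻¹ + 2⁻¹) * z := by ring
          _ = _ := by rw [ENNReal.inv_two_add_inv_two, one_mul]
      refine (key _ _ ((t - a : ℕ) * p)).trans (add_le_add_right ?_ _)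
      gcongr
      exact Nat.le_succ _
    · rw [Nat.sub_eq_zero_of_le hat, hz]; simp
  · rcases le_or_gt a t with hat | hat
    · rw [Nat.sub_add_comm hat, Pr_succ_of_step_map (μ := O (e.eval σ))
        (g := fun y => ⟨k, Function.update σ x y⟩) (by simp [step])]
      rw [tsub_le_iff_right]
      -- The continuation probability is the test function `h`; replacing the random answer by `y`
      -- costs one further `p`, which the decrease of the factor `t - a` pays for.
      refine (hans _ _ hy (fun y => Pr O (t - a) ⟨k, Function.update σ x y⟩ G)
        (fun _ => Pr_le_one ..)).trans ?_
      push_cast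
      rw [add_mul, one_mul, ← add_assoc]
      gcongr
      exact le_tsub_add
    · rw [Nat.sub_eq_zero_of_le hat, hz]; simp

end Simulation

/-! ### Comparison of the simulated oracle with the oracle of the decision process. -/

namespace Fn

open Data Simulation

variable {v : ℕ} {φ : Formula v} {m r d : ℕ} (w₀ : Fin v → Bool)

theorem answer_queryF_of_not_call (hm : 0 < m) {q : Data}
    (hq : ∀ c : (Game.mdp φ m r d w₀).Call, c.toData ≠ q) :
    answer queryF (paramsData φ m r d) q = some .nil := by
  rw [answer, eval_queryF_of_not_call w₀ hm hq]

open Classical in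
theorem answer_queryF_call (c : (Game.mdp φ m r d w₀).Call) :
    answer queryF (paramsData φ m r d) c.toData =
      if Satisfies (callState w₀ c).2 φ then none else some (callAnswer w₀ c) := by
  rw [answer, eval_queryF_call]
  split_ifs <;> rfl

/-- An abort means YES, so it must be impossible for unsatisfiable formulas. -/
theorem answer_queryF_ne_none (hm : 0 < m) (hφ : ¬ ∃ w, Satisfies w φ) (q : Data) :
    answer queryF (paramsData φ m r d) q ≠ none := by
  by_cases h : ∃ c : (Game.mdp φ m r d fun _ => false).Call, c.toData = q
  · obtain ⟨c, rfl⟩ := h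
    rw [answer_queryF_call, if_neg fun h => hφ ⟨_, h⟩]
    simp
  · rw [answer_queryF_of_not_call (fun _ => false) hm fun c hc => h ⟨c, hc⟩]
    simp

theorem _root_.LinearRL.FeaturedMDP.oracle_toData {k d : ℕ} (M : FeaturedMDP k d) (c : M.Call) :
    M.oracle c.toData = c.answer := by
  have h : ∃ c' : M.Call, c'.toData = c.toData := ⟨c, rfl⟩
  rw [FeaturedMDP.oracle, dif_pos h, FeaturedMDP.Call.toData_injective M h.choose_spec]

theorem tsum_bern_le {x : ℝ≥0∞} (h : ℚ → ℝ≥0∞) (h1 : h 1 ≤ 1) :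
    ∑' q, bern x q * h q ≤ h 0 + x := by
  have : ∑' q, bern x q * h q = ∑ q ∈ {0, 1}, bern x q * h q := by
    refine tsum_eq_sum fun q hq => ?_
    have : bern x q = 0 := by
      by_contra h'
      exact hq (by simpa using mem_support_bern ((PMF.mem_support_iff _ _).2 h'))
    rw [this, zero_mul]
  rw [this, Finset.sum_pair (by norm_num)]
  have e0 : bern x 0 ≤ 1 := PMF.coe_le_one _ _
  have e1 : bern x 1 ≤ x := by simp [bern_apply]
  calc bern x 0 * h 0 + bern x 1 * h 1 ≤ 1 * h 0 + x * 1 := by gcongr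
    _ = h 0 + x := by simp

/-- The simulated oracle differs from the oracle of the decision process only in the rewards at the
end of the counter. -/
theorem tsum_oracle_le (hm : 0 < m) {q y : Data}
    (hy : answer queryF (paramsData φ m r d) q = some y) (h : Data → ℝ≥0∞) (h1 : ∀ z, h z ≤ 1) :
    ∑' z, (Game.mdp φ m r d w₀).oracle q z * h z ≤
      h y + ENNReal.ofReal (((1 + v) / 2 ^ m) ^ r) := by
  classical
  have hpure : ∀ y : Data, ∑' z, PMF.pure y z * h z = h y := by
    intro y
    rw [tsum_eq_single y fun z hz => by simp [PMF.pure_apply, hz]]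
    simp
  by_cases hc : ∃ c : (Game.mdp φ m r d w₀).Call, c.toData = q
  · obtain ⟨c, rfl⟩ := hc
    rw [answer_queryF_call] at hy
    split_ifs at hy with hsat
    obtain rfl : callAnswer w₀ c = y := by simpa using hy
    rw [FeaturedMDP.oracle_toData]
    cases c with
    | trans s a =>
      refine (hpure _).le.trans ?_
      refine le_trans (le_of_eq ?_) le_self_add
      congr 1
      rw [callAnswer]
      cases hn : Game.next φ m s a <;> simp only [Game.mdp, hn, FeaturedMDP.stateData]
    | featS s => exact (hpure _).le.trans le_self_add
    | featSA s a => exact (hpure _).le.trans le_self_add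
    | reward s a =>
      have e : ∀ μ : PMF ℚ, ∑' z, μ.map ofRat z * h z = ∑' x, μ x * h (ofRat x) := by
        intro μ
        simp_rw [PMF.map_apply, ← ENNReal.tsum_mul_right]
        rw [ENNReal.tsum_comm]
        refine tsum_congr fun x => ?_
        rw [tsum_eq_single (ofRat x) fun z hz => by simp [hz]]
        simp
      rw [FeaturedMDP.Call.answer, e]
      -- At an unsatisfied state the game ends only through the counter, and there the probability
      -- of reward 1 is at most the value at the last time step.
      by_cases hn : Game.next φ m s a = none
      · have : (Game.mdp φ m r d w₀).reward s a = bern (ENNReal.ofReal (Game.value m r w₀ s)) := by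
          simp [Game.mdp, hn]
        rw [this]
        refine (tsum_bern_le (fun x => h (ofRat x)) (h1 _)).trans ?_
        refine add_le_add_right (ENNReal.ofReal_le_ofReal ?_) _
        exact Game.value_last_le r w₀ ((Game.next_eq_none.1 hn).resolve_left hsat)
      · have : (Game.mdp φ m r d w₀).reward s a = PMF.pure 0 := by
          simp [Game.mdp, hn]
        rw [this, tsum_eq_single 0 fun x hx => by simp [PMF.pure_apply, hx]]
        simp only [PMF.pure_apply, if_true, one_mul]
        exact le_self_add
  · rw [answer_queryF_of_not_call w₀ hm fun c h => hc ⟨c, h⟩] at hy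
    obtain rfl : Data.nil = y := by simpa using hy
    rw [FeaturedMDP.oracle, dif_neg hc, hpure]
    exact le_self_add

end Fn

namespace Fn

open Data Simulation

/-! ### Choice of the parameters -/

section Parameters

variable {N c₀ : ℕ} (v : ℕ)

theorem succ_le_pow_scale : v + 1 ≤ 8 ^ scale N v :=
  (lt_pow_log8 v).trans_le (Nat.pow_le_pow_right (by norm_num) (Nat.le_add_right _ _))

theorem le_scale : N ≤ scale N v := Nat.le_add_left _ _

theorem four_mul_le_pow {M : ℕ} (hM : 2 ≤ M) : 4 * M ≤ 4 ^ M := by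
  induction M, hM using Nat.le_induction with
  | base => norm_num
  | succ n hn ih => rw [pow_succ]; omega

/-- Absorbs the powers of `M` (logarithmic in `v`) into one further factor `r = 2 ^ M`. -/
theorem pow_three_le (M : ℕ) : M ^ 3 ≤ 8 * 2 ^ M := by
  rcases le_or_gt M 4 with h | h
  · interval_cases M <;> norm_num
  · induction M, h using Nat.le_induction with
    | base => norm_num
    | succ n hn ih =>
      rw [pow_succ 2]
      have : (n + 1) ^ 3 ≤ 2 * n ^ 3 := by nlinarith [Nat.mul_le_mul hn hn]
      omega

/-- Both `m = 4 M 2 ^ M` and `v` are at most `8 ^ M`, so `1 + m + v ≤ 2 ^ (4 M)`, whose `r`-th power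
is `2 ^ (4 M r) = 2 ^ m`. This dictates the length of the counter. -/
theorem tensor_le_pow_counter (hN : 2 ≤ N) :
    (1 + counter N v + v) ^ degree N v ≤ 2 ^ counter N v := by
  have h1 := succ_le_pow_scale (N := N) v
  have hM : 2 ≤ scale N v := hN.trans (le_scale v)
  have h2 := four_mul_le_pow hM
  set M := scale N v with hMdef
  have h3 : counter N v ≤ 8 ^ M := by
    calc counter N v = 4 * M * 2 ^ M := rfl
      _ ≤ 4 ^ M * 2 ^ M := by gcongr
      _ = 8 ^ M := by rw [← mul_pow]; norm_num
  have h4 : 2 ≤ 2 ^ M := Nat.le_self_pow (by omega) 2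
  calc (1 + counter N v + v) ^ degree N v ≤ (2 ^ M * 8 ^ M) ^ degree N v := by
        gcongr
        nlinarith
    _ = 2 ^ counter N v := by
        rw [← mul_pow, show 2 * 8 = 2 ^ 4 by norm_num, ← pow_mul, ← pow_mul, counter, ← hMdef, mul_assoc]

theorem pow_counter_le_dim : 2 ^ counter N v ≤ dim N c₀ v :=
  Nat.pow_le_pow_right (by norm_num) (Nat.le_add_right _ _)

theorem counter_add_lt_pow_counter (hN : 2 ≤ N) : counter N v + v < 2 ^ counter N v := by
  have h := tensor_le_pow_counter v hN
  have : 1 + counter N v + v ≤ (1 + counter N v + v) ^ degree N v :=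
    Nat.le_self_pow (by simp [degree]) _
  omega

theorem scale_le_counter : scale N v ≤ counter N v := by
  have : 1 ≤ degree N v := Nat.one_le_two_pow
  rw [counter]; nlinarith

theorem logDim_le (hc : c₀ ≤ N) :
    logDim N c₀ v ≤ 5 * scale N v * 2 ^ scale N v := by
  have h1 : 1 ≤ 2 ^ scale N v := Nat.one_le_two_pow
  have h2 := le_scale (N := N) v
  rw [logDim, counter, degree]
  nlinarith

theorem dim_le_limit : dim N c₀ v ≤ limit N c₀ v :=
  Nat.pow_le_pow_right (by norm_num) (Nat.le_mul_self _)

theorem fits {c : ℕ} (hN : 2 ≤ N) (φ : Formula v) (hφ : φ.length ≤ c * v) :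
    Fits φ (counter N v) (degree N v) (dim N c₀ v) ((c + 30) * limit N c₀ v) := by
  have h1 := counter_add_lt_pow_counter v hN
  have h2 := pow_counter_le_dim (N := N) (c₀ := c₀) v
  have h3 := dim_le_limit (N := N) (c₀ := c₀) v
  have h4 := tensor_le_pow_counter (N := N) v hN
  have h5 : degree N v ≤ 2 ^ counter N v :=
    Nat.pow_le_pow_right (by norm_num) (scale_le_counter v)
  have h6 : limit N c₀ v ≤ (c + 30) * limit N c₀ v := Nat.le_mul_of_pos_left _ (by omega)
  have h7 : 1 ≤ limit N c₀ v := Nat.one_le_two_pow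
  have h8 : c * v ≤ c * limit N c₀ v := Nat.mul_le_mul_left _ (by omega)
  exact ⟨by nlinarith, by nlinarith, by omega, by omega, by omega, by omega, by omega⟩

theorem ok_setupF_limit (c : ℕ) (hN : 2 ≤ N) (hc : c₀ ≤ N) (φ : Formula v) :
    (setupF N c₀).Ok ((c + 30) * limit N c₀ v) (formulaData φ) := by
  have h1 := counter_add_lt_pow_counter v hN
  have h2 := pow_counter_le_dim (N := N) (c₀ := c₀) v
  have h3 := dim_le_limit (N := N) (c₀ := c₀) v
  have h4 := (le_scale v).trans (scale_le_counter (N := N) v)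
  have h6 : 30 * limit N c₀ v ≤ (c + 30) * limit N c₀ v := by gcongr; omega
  have h7 : 1 ≤ limit N c₀ v := Nat.one_le_two_pow
  have h8 : logDim N c₀ v ^ 2 < limit N c₀ v := by rw [sq]; exact Nat.lt_two_pow_self
  exact ok_setupF N c₀ φ (by omega) (by omega)

theorem succ_div_pow_counter_le :
    ((1 + v : ℝ) / 2 ^ counter N v) ≤ 2 ^ (3 * scale N v) / 2 ^ counter N v := by
  have h1 : ((v + 1 : ℕ) : ℝ) ≤ ((8 ^ scale N v : ℕ) : ℝ) := by
    exact_mod_cast succ_le_pow_scale (N := N) v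
  gcongr
  rw [pow_mul]
  push_cast at h1
  norm_num
  linarith

theorem sixteen_mul_scale_le_counter (hN : 2 ≤ N) : 16 * scale N v ≤ counter N v := by
  have : 2 ^ 2 ≤ degree N v := Nat.pow_le_pow_right (by norm_num) (hN.trans (le_scale v))
  rw [counter]; nlinarith

theorem value_bound (hN : 2 ≤ N) : (degree N v : ℝ) * v / 2 ^ counter N v +
    ((1 + v) / 2 ^ counter N v) ^ degree N v ≤ 3 / 4 := by
  have h1 := succ_div_pow_counter_le (N := N) v
  have h2 := sixteen_mul_scale_le_counter (N := N) v hN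
  have hM := hN.trans (le_scale (N := N) v)
  -- The exponent is at most `3 M - 16 M ≤ -8`, as `M ≥ 2`; together with the bound `1 / 2` below
  -- this stays under `3 / 4`.
  have h3 : ((1 + v : ℝ) / 2 ^ counter N v) ≤ 1 / 2 ^ (4 * 2) := by
    refine h1.trans ?_
    rw [div_le_div_iff₀ (by positivity) (by positivity), ← pow_add, one_mul]
    exact pow_le_pow_right₀ (by norm_num) (by omega)
  have h4 : (degree N v : ℝ) * v / 2 ^ counter N v ≤ 1 / 2 := by
    have : (degree N v : ℝ) * v ≤ 2 ^ (4 * scale N v) := by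
      have : degree N v * v ≤ 2 ^ (4 * scale N v) := by
        calc degree N v * v ≤ 2 ^ scale N v * 8 ^ scale N v :=
              Nat.mul_le_mul_left _ ((Nat.le_succ v).trans (succ_le_pow_scale v))
          _ = 2 ^ (4 * scale N v) := by rw [← mul_pow, pow_mul]; norm_num
      exact_mod_cast this
    rw [div_le_div_iff₀ (by positivity) (by positivity), one_mul]
    calc (degree N v : ℝ) * v * 2 ≤ 2 ^ (4 * scale N v) * 2 := by gcongr
      _ = 2 ^ (4 * scale N v + 1) := by rw [pow_succ]
      _ ≤ 2 ^ counter N v := pow_le_pow_right₀ (by norm_num) (by omega)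
  have h5 : ((1 + v : ℝ) / 2 ^ counter N v) ^ degree N v ≤ (1 + v : ℝ) / 2 ^ counter N v :=
    pow_le_of_le_one (by positivity) (h3.trans (by norm_num)) (by simp [degree])
  norm_num at h3
  linarith

/-- The error of the simulation in `2 ^ (M * 4 ^ M + M)` steps, `M` the scale. -/
theorem error_bound (hN : 2 ≤ N) : (2 : ℝ) ^ (scale N v * degree N v ^ 2 + scale N v) *
    ((1 + v) / 2 ^ counter N v) ^ degree N v ≤ 1 := by
  have h1 := succ_div_pow_counter_le (N := N) v
  have h2 : 2 ^ 2 ≤ degree N v := Nat.pow_le_pow_right (by norm_num) (hN.trans (le_scale v))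
  calc (2 : ℝ) ^ (scale N v * degree N v ^ 2 + scale N v) *
        ((1 + v) / 2 ^ counter N v) ^ degree N v
      ≤ 2 ^ (scale N v * degree N v ^ 2 + scale N v) *
        (2 ^ (3 * scale N v) / 2 ^ counter N v) ^ degree N v := by gcongr
    _ = 2 ^ (scale N v * degree N v ^ 2 + scale N v + 3 * scale N v * degree N v) /
        2 ^ (counter N v * degree N v) := by
        rw [div_pow, ← pow_mul, ← pow_mul, mul_div_assoc', ← pow_add]
    _ ≤ 1 := by
        rw [div_le_one (by positivity)]
        refine pow_le_pow_right₀ (by norm_num) ?_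
        have h3 : degree N v ≤ degree N v ^ 2 := Nat.le_self_pow (by norm_num) _
        have h4 : 4 * degree N v ≤ degree N v ^ 2 := by nlinarith
        -- As `r ≥ 4`, `r ^ 2 + 1 + 3 r ≤ 4 r ^ 2`, and `4 M r ^ 2` is the exponent gained from `(2
        -- ^ m) ^ r`.
        calc scale N v * degree N v ^ 2 + scale N v + 3 * scale N v * degree N v
            = scale N v * (degree N v ^ 2 + 1 + 3 * degree N v) := by ring
          _ ≤ scale N v * (4 * degree N v ^ 2) := by gcongr; omega
          _ = counter N v * degree N v := by rw [counter]; ring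

/-- The running time `T` of the given algorithm need not be computable, so the clock is started at
the explicit number `limit`, which has to dominate `T`. -/
theorem pow_scale_le_limit (hN : 2 ≤ N) :
    2 ^ (scale N v * degree N v ^ 2 + scale N v) ≤ limit N c₀ v := by
  refine Nat.pow_le_pow_right (by norm_num) ?_
  have h1 : counter N v ≤ logDim N c₀ v := Nat.le_add_right _ _
  have h2 : 1 ≤ degree N v := Nat.one_le_two_pow
  have h3 := hN.trans (le_scale v)
  calc scale N v * degree N v ^ 2 + scale N v ≤
        scale N v * (16 * scale N v * degree N v ^ 2) := by
          nlinarith [Nat.mul_le_mul h3 (Nat.one_le_pow 2 (degree N v) h2)]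
    _ = counter N v * counter N v := by rw [counter]; ring
    _ ≤ _ := Nat.mul_le_mul h1 h1

/-- With `L = log d`, `2 ^ M ≤ L ≤ 5 M r` gives `log L ≥ M`, hence `L ^ 2 / (32 log L) ≤ 25 M ^ 2 r
^ 2 / (32 M) ≤ M r ^ 2`. -/
theorem rpow_dim_le (hN : 2 ≤ N) (hc : c₀ ≤ N) :
    (dim N c₀ v : ℝ) ^ (Real.logb 2 (dim N c₀ v) /
      (32 * Real.logb 2 (Real.logb 2 (dim N c₀ v)))) ≤ 2 ^ (scale N v * degree N v ^ 2) := by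
  have hM : 2 ≤ scale N v := hN.trans (le_scale v)
  have h1 := logDim_le (c₀ := c₀) v hc
  have h2 : 2 ^ scale N v ≤ logDim N c₀ v := by
    have : 1 * 2 ^ scale N v ≤ 4 * scale N v * 2 ^ scale N v := by gcongr; omega
    rw [logDim, counter, degree]; omega
  have e1 : ((dim N c₀ v : ℕ) : ℝ) = (2 : ℝ) ^ (logDim N c₀ v : ℝ) := by
    rw [dim, Real.rpow_natCast]; push_cast; rfl
  have e2 : Real.logb 2 (dim N c₀ v) = logDim N c₀ v := by
    rw [e1, Real.logb_rpow (by norm_num) (by norm_num)]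
  rw [e2, e1, ← Real.rpow_mul (by norm_num), ← Real.rpow_natCast 2 (_ * _)]
  refine Real.rpow_le_rpow_of_exponent_le (by norm_num) ?_
  have h3 : (scale N v : ℝ) ≤ Real.logb 2 (logDim N c₀ v) := by
    rw [Real.le_logb_iff_rpow_le (by norm_num), Real.rpow_natCast]
    · exact_mod_cast h2
    · exact_mod_cast (Nat.two_pow_pos _).trans_le h2
  have hM' : (2 : ℝ) ≤ scale N v := by exact_mod_cast hM
  have h4 : (logDim N c₀ v : ℝ) ≤ 5 * scale N v * degree N v := by exact_mod_cast h1
  rw [mul_div_assoc', div_le_iff₀ (by linarith)]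
  push_cast
  calc (logDim N c₀ v : ℝ) * logDim N c₀ v
      ≤ (5 * scale N v * degree N v) * (5 * scale N v * degree N v) := by gcongr
    _ = scale N v * degree N v ^ 2 * (25 * scale N v) := by ring
    _ ≤ scale N v * degree N v ^ 2 * (32 * Real.logb 2 (logDim N c₀ v)) := by
        gcongr
        · norm_num

/-- Since `log v ≤ 3 M`, the square of `log d` times `log v` is at most `75 M ^ 3 r ^ 2 ≤ 600 r ^
3`, and `r ^ 3 = 8 ^ M ≤ 8 ^ N * 9 v`; thus `5400 = 600 * 9`. -/
theorem logDim_sq_le (hc : c₀ ≤ N) (hv : 2 ≤ v) :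
    (logDim N c₀ v * logDim N c₀ v : ℝ) ≤ 5400 * 8 ^ N * (v / Real.logb 2 v) := by
  have h1 : (logDim N c₀ v : ℝ) ≤ 5 * scale N v * degree N v := by
    exact_mod_cast logDim_le (c₀ := c₀) v hc
  have hv' : (2 : ℝ) ≤ v := by exact_mod_cast hv
  have hlog : 0 < Real.logb 2 v := Real.logb_pos (by norm_num) (by linarith)
  have h2 : Real.logb 2 v ≤ 3 * scale N v := by
    rw [Real.logb_le_iff_le_rpow (by norm_num) (by linarith)]
    have : (v : ℝ) ≤ 8 ^ scale N v := by
      exact_mod_cast (Nat.le_succ v).trans (succ_le_pow_scale (N := N) v)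
    refine this.trans (le_of_eq ?_)
    rw [Real.rpow_mul (by norm_num), Real.rpow_natCast]
    norm_num
  have h3 : (scale N v : ℝ) ^ 3 ≤ 8 * degree N v := by exact_mod_cast pow_three_le (scale N v)
  have h4 : (degree N v : ℝ) ^ 3 ≤ 8 ^ N * (9 * v) := by
    have : degree N v ^ 3 ≤ 8 ^ N * (9 * v) := by
      calc degree N v ^ 3 = 8 ^ N * 8 ^ log8 v := by
            rw [degree, ← pow_mul, mul_comm, pow_mul, scale, pow_add, mul_comm]; norm_num
        _ ≤ _ := Nat.mul_le_mul_left _ ((pow_log8_le v).trans (by omega))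
    exact_mod_cast this
  rw [mul_div_assoc', le_div_iff₀ hlog]
  calc (logDim N c₀ v * logDim N c₀ v : ℝ) * Real.logb 2 v
      ≤ (5 * scale N v * degree N v) * (5 * scale N v * degree N v) * (3 * scale N v) := by gcongr
    _ = 75 * scale N v ^ 3 * degree N v ^ 2 := by ring
    _ ≤ 75 * (8 * degree N v) * degree N v ^ 2 := by gcongr
    _ = 600 * degree N v ^ 3 := by ring
    _ ≤ 600 * (8 ^ N * (9 * v)) := by gcongr
    _ = _ := by ring

end Parameters

end Fn

namespace Fn

open Data Simulation

/-! ### The reduction -/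

/-- The algorithm for Unique-3-SAT that simulates the algorithm `A` for Linear-3-RL. -/
def reduction (N c₀ : ℕ) (A : Program) : Program := driver (setupF N c₀) queryF walkF A

/-- Coefficient of the time bound. -/
def totalWt (N c₀ : ℕ) : ℕ := (setupF N c₀).wt + queryF.wt + walkF.wt + 51

/-- Exponent of the time bound. -/
def totalDep (N c₀ : ℕ) : ℕ := (setupF N c₀).dep + queryF.dep + walkF.dep + 1

/-- Running time of the reduction. -/
def time (N c₀ c v : ℕ) : ℕ :=
  totalWt N c₀ * ((c + 30) * limit N c₀ v + 1) ^ totalDep N c₀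

variable {N c₀ c v : ℕ}

/-- The assignment `w₀` only serves to write down the input of the simulated algorithm; that input
and the program are the same for all `w₀`. The remaining work is to add up the costs. -/
theorem le_Pr_reduction {φ : Formula v} {A : Program} {Y : Set Data}
    {Φ : ℕ → List Program → Store → ℝ≥0∞} (O : Oracle) (w₀ : Fin v → Bool) (hN : 2 ≤ N)
    (hc : c₀ ≤ N) (hφ : φ.length ≤ c * v)
    (hΦ : Potential walkF (paramsData φ (counter N v) (degree N v) (dim N c₀ v))
      (answer queryF (paramsData φ (counter N v) (degree N v) (dim N c₀ v))) Y Φ) :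
    Φ (limit N c₀ v) [A]
        (start A (Game.mdp φ (counter N v) (degree N v) (dim N c₀ v) w₀).input).store ≤
      Pr O (time N c₀ c v) (start (reduction N c₀ A) (formulaData φ)) Y := by
  have hfit := fits (N := N) (c₀ := c₀) v hN φ hφ
  have h1 := cost_le _ _ (ok_setupF_limit v c hN hc φ)
  refine hΦ.le_Pr_driver O (eval_setupF N c₀ φ w₀)
    (fun q => Nat.add_le_add_right (cost_le _ _ (ok_queryF hfit q)) _)
    (fun y => Nat.add_le_add_right (cost_le _ _ (ok_walkF hfit y)) _) ?_
  have hlim : limit N c₀ v ≤ (c + 30) * limit N c₀ v := Nat.le_mul_of_pos_left _ (by omega)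
  rw [time]
  set L := (c + 30) * limit N c₀ v
  have hpow : ∀ n ≤ totalDep N c₀, (L + 1) ^ n ≤ (L + 1) ^ totalDep N c₀ := fun n hn =>
    Nat.pow_le_pow_right (by omega) hn
  have g1 := hpow (setupF N c₀).dep (by rw [totalDep]; omega)
  have g2 := hpow (queryF.dep + 1) (by rw [totalDep]; omega)
  have g3 := hpow walkF.dep (by rw [totalDep]; omega)
  have g4 := hpow 1 (by rw [totalDep]; omega)
  have g5 := hpow 0 (Nat.zero_le _)
  have g6 : 1 ≤ (L + 1) ^ queryF.dep := Nat.one_le_pow _ _ (by omega)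
  set X := (L + 1) ^ totalDep N c₀
  rw [pow_one] at g4
  rw [pow_zero] at g5
  calc (setupF N c₀).cost (formulaData φ) + 12 + (limit N c₀ v *
        (queryF.wt * (L + 1) ^ queryF.dep + 20) + (1 + limit N c₀ v) * 8 +
        (walkF.wt * (L + 1) ^ walkF.dep + 3))
      ≤ (setupF N c₀).wt * X + 12 * X + ((queryF.wt + 20) * X + X * 8 +
        (walkF.wt * X + 3 * X)) := by
        have : limit N c₀ v * (queryF.wt * (L + 1) ^ queryF.dep + 20) ≤ (queryF.wt + 20) * X := by
          calc limit N c₀ v * (queryF.wt * (L + 1) ^ queryF.dep + 20)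
              ≤ (L + 1) * (queryF.wt * (L + 1) ^ queryF.dep + 20 * (L + 1) ^ queryF.dep) := by
                gcongr
                · omega
                · omega
            _ = (queryF.wt + 20) * (L + 1) ^ (queryF.dep + 1) := by ring
            _ ≤ _ := Nat.mul_le_mul_left _ g2
        have h2 := Nat.mul_le_mul_left (setupF N c₀).wt g1
        have h3 := Nat.mul_le_mul_left walkF.wt g3
        omega
    _ ≤ totalWt N c₀ * X := by
        have : ((setupF N c₀).wt + queryF.wt + walkF.wt + 43) * X ≤ totalWt N c₀ * X := by
          gcongr; rw [totalWt]; omega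
        nlinarith

theorem haltsWithin_reduction {φ : Formula v} (A : Program) (hN : 2 ≤ N) (hc : c₀ ≤ N)
    (hφ : φ.length ≤ c * v) :
    HaltsWithin noOracle (reduction N c₀ A) (formulaData φ) (time N c₀ c v) :=
  haltsWithin_of_Pr (le_Pr_reduction noOracle (fun _ => false) hN hc hφ
    (Potential.one (fun _ => Set.mem_univ _) fun _ _ => Set.mem_univ _))

theorem counter_pos (hN : 2 ≤ N) : 0 < counter N v := by
  have := (hN.trans (le_scale v)).trans (scale_le_counter (N := N) v)
  omega

/-- Whatever the simulated algorithm does, even if it is cut off by the clock, no query aborts and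
no walk succeeds. -/
theorem outputProb_reduction_of_unsat {φ : Formula v} (A : Program) (hN : 2 ≤ N) (hc : c₀ ≤ N)
    (hφ : φ.length ≤ c * v) (hunsat : ¬ ∃ w, Satisfies w φ) :
    outputProb noOracle (reduction N c₀ A) (formulaData φ) (time N c₀ c v) {.nil} = 1 := by
  have h := le_Pr_reduction (A := A) noOracle (fun _ => false) hN hc hφ
    (Potential.one (Y := {.nil}) (fun y => ?_) fun q hq =>
      absurd hq (answer_queryF_ne_none (counter_pos hN) hunsat q))
  · rw [outputProb_eq, le_antisymm (Pr_le_one ..) h, ENNReal.toReal_one]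
  · rw [eval_walkF fun _ => false]
    exact congrArg ofBool (walk_of_unsat hunsat _ _ y)

/-- The simulated algorithm succeeds with probability at least `9 / 10` with the true oracle, and
the zero rewards cost at most `T * p ≤ 1 / 40`; the difference is `7 / 8`. -/
theorem outputProb_reduction_of_sat {φ : Formula v} {A : Program} {T : ℕ} (hN : 2 ≤ N)
    (hc : c₀ ≤ N) (hφ : φ.length ≤ c * v) {w₀ : Fin v → Bool} (hw₀ : Satisfies w₀ φ)
    (hT : (40 * T : ℝ) ≤ 2 ^ (scale N v * degree N v ^ 2 + scale N v))
    (hA : 1 - 1 / 10 ≤ outputProb (Game.mdp φ (counter N v) (degree N v) (dim N c₀ v) w₀).oracle A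
      (Game.mdp φ (counter N v) (degree N v) (dim N c₀ v) w₀).input T
      (Game.mdp φ (counter N v) (degree N v) (dim N c₀ v) w₀).goodOutputs) :
    1 - 1 / 8 ≤ outputProb noOracle (reduction N c₀ A) (formulaData φ) (time N c₀ c v)
      {y | y ≠ .nil} := by
  set M := Game.mdp φ (counter N v) (degree N v) (dim N c₀ v) w₀ with hM
  set p : ℝ := ((1 + v) / 2 ^ counter N v) ^ degree N v with hp
  have hp0 : 0 ≤ p := by positivity
  have hTlim : T ≤ limit N c₀ v := by
    have h2 : (2 : ℝ) ^ (scale N v * degree N v ^ 2 + scale N v) ≤ limit N c₀ v := by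
      exact_mod_cast pow_scale_le_limit v hN
    have h3 : (0 : ℝ) ≤ T := Nat.cast_nonneg T
    have : (T : ℝ) ≤ limit N c₀ v := by linarith
    exact_mod_cast this
  have h := le_Pr_reduction (A := A) noOracle w₀ hN hc hφ
    (Potential.of_oracle (Y := {y | y ≠ .nil}) (O := M.oracle) (p := ENNReal.ofReal p)
      (G := M.goodOutputs) (limit N c₀ v - T) (fun y hy => ?_) (by simp)
      fun q y hy h h1 => tsum_oracle_le w₀ (counter_pos hN) hy h h1)
  · rw [Nat.sub_sub_self hTlim] at h
    rw [outputProb_eq] at hA ⊢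
    have hTp : (T : ℝ) * p ≤ 1 / 40 := by
      have := error_bound v hN
      have := mul_le_mul_of_nonneg_right hT hp0
      linarith
    have h2 : (Pr M.oracle T (start A M.input) M.goodOutputs).toReal -
        ((T : ℝ≥0∞) * ENNReal.ofReal p).toReal ≤ _ :=
      ENNReal.le_toReal_sub (by finiteness)
    have h3 := ENNReal.toReal_mono ((Pr_le_one ..).trans_lt ENNReal.one_lt_top).ne h
    rw [ENNReal.toReal_mul, ENNReal.toReal_natCast, ENNReal.toReal_ofReal hp0] at h2
    refine le_trans ?_ (h2.trans h3)
    linarith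
  · rw [Set.mem_ofPred_eq, eval_walkF w₀, walk_of_good hw₀ (value_bound v hN) hy]
    simp [ofBool]

theorem time_le (hc : c₀ ≤ N) (hv : 2 ≤ v) : (time N c₀ c v : ℝ) ≤
    (totalWt N c₀ * (c + 31) ^ totalDep N c₀) *
      2 ^ (totalDep N c₀ * (5400 * 8 ^ N) * (v / Real.logb 2 v)) := by
  have h1 : (limit N c₀ v : ℝ) ≤ 2 ^ (5400 * 8 ^ N * (v / Real.logb 2 v)) := by
    rw [limit]
    push_cast
    rw [← Real.rpow_natCast]
    refine Real.rpow_le_rpow_of_exponent_le (by norm_num) ?_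
    push_cast
    exact logDim_sq_le v hc hv
  have h2 : (1 : ℝ) ≤ limit N c₀ v := by exact_mod_cast Nat.one_le_two_pow
  rw [time]
  push_cast
  calc (totalWt N c₀ : ℝ) * ((c + 30) * limit N c₀ v + 1) ^ totalDep N c₀
      ≤ totalWt N c₀ * ((c + 31) * 2 ^ (5400 * 8 ^ N * (v / Real.logb 2 v))) ^ totalDep N c₀ := by
        gcongr
        nlinarith
    _ = _ := by
        rw [mul_pow, ← Real.rpow_natCast (2 ^ _), ← Real.rpow_mul (by norm_num), ← mul_assoc]
        ring_nf

theorem exists_parameters {C : ℝ} (hC : 0 < C) {T : ℕ → ℕ}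
    (hT : (fun d => (T d : ℝ)) =O[atTop] fun d : ℕ =>
      (d : ℝ) ^ (Real.logb 2 d / (32 * Real.logb 2 (Real.logb 2 d)))) :
    ∃ N c₀, 2 ≤ N ∧ c₀ ≤ N ∧ 1 ≤ C * 2 ^ c₀ ∧ ∀ v,
      (40 * T (dim N c₀ v) : ℝ) ≤ 2 ^ (scale N v * degree N v ^ 2 + scale N v) := by
  obtain ⟨K, hK, hT⟩ := hT.exists_pos
  obtain ⟨D, hD⟩ := eventually_atTop.1 hT.bound
  obtain ⟨c₀, hc₀⟩ := pow_unbounded_of_one_lt C⁻¹ one_lt_two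
  obtain ⟨n, hn⟩ := pow_unbounded_of_one_lt (40 * K) one_lt_two
  -- `c₀` makes the horizon `2 ^ m` at most `C * d`. `N ≥ D` puts every dimension, also for small
  -- `v`, into the range of the asymptotic bound, and `N ≥ n` lets the extra factor `2 ^ M` absorb
  -- `40 * K`.
  refine ⟨max (max 2 c₀) (max D n), c₀, by omega, by omega, ?_, fun v => ?_⟩
  · rw [inv_lt_iff_one_lt_mul₀ hC] at hc₀
    linarith
  set N := max (max 2 c₀) (max D n) with hN
  have h1 := le_scale (N := N) v
  have h2 := scale_le_counter (N := N) v
  have h3 : D ≤ dim N c₀ v := by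
    refine le_trans ?_ Nat.lt_two_pow_self.le
    rw [logDim]
    omega
  have h4 := hD _ h3
  rw [Real.norm_of_nonneg (Nat.cast_nonneg _), Real.norm_of_nonneg (by positivity)] at h4
  have h5 := rpow_dim_le (N := N) (c₀ := c₀) v (by omega) (by omega)
  have h6 : (2 : ℝ) ^ n ≤ 2 ^ scale N v := pow_le_pow_right₀ (by norm_num) (by omega)
  calc (40 * T (dim N c₀ v) : ℝ) ≤ 40 * (K * 2 ^ (scale N v * degree N v ^ 2)) := by
        gcongr
        exact h4.trans (by gcongr)
    _ = 2 ^ (scale N v * degree N v ^ 2) * (40 * K) := by ring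
    _ ≤ 2 ^ (scale N v * degree N v ^ 2) * 2 ^ scale N v := by gcongr; linarith
    _ = _ := by rw [pow_add]

end Fn

end LinearRL

/-! ### The main theorem. -/

theorem mainTheorem6 (C : ℝ) (hC : 0 < C) (b : ℕ) (hb : 1 ≤ b) (c : ℕ)
    (hRL : LinearRL.LinearRLSolvable 3 C b
      (fun d => (d : ℝ) ^ (Real.logb 2 d / (32 * Real.logb 2 (Real.logb 2 d)))) (1 / 10)) :
    ∃ K : ℝ, LinearRL.Unique3SATSolvable c
      (fun v => (2 : ℝ) ^ (K * (v / Real.logb 2 v))) (1 / 8) := by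
  obtain ⟨A, T, hT, hA⟩ := hRL
  obtain ⟨N, c₀, hN, hc₀, hC', hT⟩ := LinearRL.Fn.exists_parameters hC hT
  refine ⟨LinearRL.Fn.totalDep N c₀ * (5400 * 8 ^ N), LinearRL.Fn.reduction N c₀ A,
    LinearRL.Fn.time N c₀ c, ?_, fun v φ hφ =>
      ⟨LinearRL.Fn.haltsWithin_reduction A hN hc₀ hφ, ?_,
        LinearRL.Fn.outputProb_reduction_of_unsat A hN hc₀ hφ⟩⟩
  · refine IsBigO.of_bound (LinearRL.Fn.totalWt N c₀ * (c + 31) ^ LinearRL.Fn.totalDep N c₀) ?_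
    filter_upwards [eventually_ge_atTop 2] with v hv
    rw [Real.norm_of_nonneg (Nat.cast_nonneg _), Real.norm_of_nonneg (by positivity)]
    exact LinearRL.Fn.time_le hc₀ hv
  · rintro ⟨w₀, hw₀, -⟩
    have h1 := LinearRL.Fn.counter_add_lt_pow_counter v hN
    have h2 := LinearRL.Fn.pow_counter_le_dim (N := N) (c₀ := c₀) v
    have h3 := LinearRL.Fn.counter_pos (v := v) hN
    have h4 := Nat.le_self_pow (n := b) (by omega) (LinearRL.Fn.dim N c₀ v)
    have h5 : 2 ^ 1 ≤ 2 ^ LinearRL.Fn.counter N v := Nat.pow_le_pow_right (by norm_num) h3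
    -- The assumed algorithm is applied to the game of `w₀`. Its size bound holds because `d ^ b ≥ d
    -- ≥ 2 ^ m` exceeds `m + v` and is at least 2, the bit size of the number one.
    refine LinearRL.Fn.outputProb_reduction_of_sat hN hc₀ hφ hw₀ (hT v)
      (hA _ (LinearRL.Game.mdp φ _ _ _ w₀) ?_
        (LinearRL.Game.sizeBound _ _ _ (by omega) (by omega))
        (LinearRL.Game.isLinear _ _ _ ((LinearRL.Fn.tensor_le_pow_counter v hN).trans h2) hw₀)).2
    have e : ((LinearRL.Game.mdp φ (LinearRL.Fn.counter N v) (LinearRL.Fn.degree N v)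
      (LinearRL.Fn.dim N c₀ v) w₀).horizon : ℝ) = 2 ^ LinearRL.Fn.counter N v := by
      simp [LinearRL.Game.mdp]
    rw [e, LinearRL.Fn.dim, LinearRL.Fn.logDim, pow_add]
    push_cast
    have : (0 : ℝ) < 2 ^ LinearRL.Fn.counter N v := by positivity
    nlinarith
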